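/- **Setting.** Let $g:\mathbb R\to\mathbb R$ be infinitely differentiable with $g$ and all its derivatives of at most polynomial growth, and let $f=e^{-g}$ be a probability density on $\mathbb R$ with all moments finite. Let $\kappa\ge 0$ and $\lambda_i=i^{-\kappa}$. For $n\ge 1$ let $\tilde\pi_n$ be the law on $\mathbb R^n$ with Lebesgue density $\prod_{i=1}^n\lambda_i^{-1}f(x_i/\lambda_i)$, and let $\pi_n$ be a probability measure with $\frac{d\pi_n}{d\tilde\pi_n}=e^{-\phi_n}$, where $\phi_n:\mathbb R^n\to\mathbb R$ is measurable. For $s\in\mathbb R$ put $|x|_s=\big(\sum_{i=1}^n i^{2s}x_i^2\big)^{1/2}$. Assume that, possibly after changing each $\phi_n$ on a $\tilde\pi_n$-null set: * there is $M\in\mathbb R$ such that $\phi_n(x)\ge M$ for all sufficiently large $n$ and all $x\in\mathbb R^n$; * there are a locally bounded function $\delta:[0,\infty)^2\to[0,\infty)$, constants $C,p>0$ and $s,s',s''<\kappa-\frac12$ such that, for all sufficiently large $n$ and all $x,y\in\mathbb R^n$, $|\phi_n(y)-\phi_n(x)|\le\delta(|x|_s,|y|_s)\,|y-x|_{s'}$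 and $|\phi_n(x)|\le C(1+|x|_{s''}^p)$. Let $l,\rho>0$ and let $\sigma_n>0$ with $\sigma_n^2=l^2n^{-\rho}$. Consider the Metropolis–Hastings chain with target $\pi_n$ and with one of the two proposals $$\text{RWM: } y=x+\sigma_nZ,\qquad \text{SLA: } y=x+\tfrac{\sigma_n^2}{2}\nabla\log\tilde\pi_n(x)+\sigma_nZ,\qquad Z\sim\mathcal N(0,I_n),$$ that is, from $x$ the chain moves to $x'=y$ with probability $a_n(x,y)=1\wedge\frac{\pi_n(y)q_n(y,x)}{\pi_n(x)q_n(x,y)}$ and to $x'=x$ otherwise, where $\pi_n(\cdot)$ is the Lebesgue density of $\pi_n$ and $q_n(x,\cdot)$ is the proposal density from $x$. Put $I=1$ for RWM and $I=\frac13$ for SLA. With $X\sim f$ and $\Phi$ the standard normal distribution function, put $$K^{\mathrm{RWM}}=E[g'(X)^2],\qquad K^{\mathrm{SLA}}=\tfrac1{48}E[3g''(X)^3+5g'''(X)^2],$$ $$a^{\mathrm{RWM}}(l)=2\Phi\Big(-\tfrac l2\sqrt{\tfrac{K^{\mathrm{RWM}}}{1+2\kappa}}\Big),\qquad a^{\mathrm{SLA}}(l)=2\Phi\Big(-\tfrac{l^3}2\sqrt{\tfrac{K^{\mathrm{SLA}}}{1+6\kappa}}\Big).$$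 Fix a coordinate $i^*\ge1$ and, for $n\ge i^*$, let $S_n=E[(x'_{i^*}-x_{i^*})^2]$, where $x\sim\pi_n$ and $x'$ is the location of the chain one step after $x$. **Theorem.** For each of RWM and SLA (with the corresponding $I$, $K$ and $a$), $S_n$ is finite for all sufficiently large $n$ whenever $\rho>2\kappa$, and, as $n\to\infty$: 1. if $\rho=2\kappa+I$, then $S_n=l^2a(l)\,n^{-2\kappa-I}+o(n^{-2\kappa-I})$; 2. if $\rho>2\kappa+I$, then $S_n=l^2n^{-\rho}+o(n^{-\rho})$; 3. if $2\kappa<\rho<2\kappa+I$, then $S_n=O(n^{-p})$ for every $p\ge0$. Moreover $K>0$, and the coefficient $l\mapsto l^2a(l)$ in (1) has a unique maximizer $\hat l$ on $(0,\infty)$; the corresponding acceptance rate $a(\hat l)$ is, to three decimals, $0.234$ for RWM and $0.574$ for SLA. -/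

import Mathlib

open MeasureTheory ProbabilityTheory Filter Asymptotics Topology

namespace MHScaling

/-- The two algorithms: random-walk Metropolis and the simplified Langevin algorithm. -/
inductive Algorithm
  | RWM
  | SLA

/-- The index `I`: `1` for RWM and `1/3` for SLA. -/
noncomputable def Algorithm.index : Algorithm → ℝ
  | .RWM => 1
  | .SLA => 1 / 3

/-- Regularity of `g`, where `f = exp (-g)` is a probability density on `ℝ`: the function `g` is
smooth, all its derivatives have polynomial growth, and all moments of `f` are finite. -/
structure IsRegularLogDensity (g : ℝ → ℝ) : Prop where
  smooth : ContDiff ℝ (⊤ : ℕ∞) g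
  growth : ∀ k : ℕ, ∃ C : ℝ, ∃ N : ℕ, ∀ u : ℝ, |iteratedDeriv k g u| ≤ C * (1 + |u| ^ N)
  moments : ∀ k : ℕ, Integrable (fun u : ℝ => u ^ k * Real.exp (-g u))
  density : ∫ u : ℝ, Real.exp (-g u) = 1

/-- `λ_i = i ^ (-κ)` for `i = 1, 2, …`; the coordinate `i : ℕ` counts from `0`, so it is the
`(i+1)`-st one. -/
noncomputable def scale (κ : ℝ) (i : ℕ) : ℝ := ((i : ℝ) + 1) ^ (-κ)

/-- The Lebesgue density of the reference product law:
`∏ i, (1 / λ_i) * exp (-g (x_i / λ_i))`. -/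
noncomputable def refDensity (g : ℝ → ℝ) (κ : ℝ) {n : ℕ} (x : Fin n → ℝ) : ℝ :=
  ∏ i : Fin n, (1 / scale κ (i : ℕ)) * Real.exp (-g (x i / scale κ (i : ℕ)))

/-- The reference product law on `ℝⁿ`. -/
noncomputable def refMeasure (g : ℝ → ℝ) (κ : ℝ) (n : ℕ) : Measure (Fin n → ℝ) :=
  (volume : Measure (Fin n → ℝ)).withDensity (fun x => ENNReal.ofReal (refDensity g κ x))

/-- The target law on `ℝⁿ`, with density `exp (-φ)` with respect to the reference law. -/
noncomputable def target (g : ℝ → ℝ) (κ : ℝ) {n : ℕ} (φ : (Fin n → ℝ) → ℝ) :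
    Measure (Fin n → ℝ) :=
  (refMeasure g κ n).withDensity (fun x => ENNReal.ofReal (Real.exp (-φ x)))

/-- The Lebesgue density of the target law. -/
noncomputable def targetDensity (g : ℝ → ℝ) (κ : ℝ) {n : ℕ} (φ : (Fin n → ℝ) → ℝ)
    (x : Fin n → ℝ) : ℝ :=
  Real.exp (-φ x) * refDensity g κ x

/-- The gradient of the logarithm of the reference density. -/
noncomputable def gradLogRef (g : ℝ → ℝ) (κ : ℝ) {n : ℕ} (x : Fin n → ℝ) : Fin n → ℝ :=
  fun i => deriv (fun t : ℝ => Real.log (refDensity g κ (Function.update x i t))) (x i)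

/-- The mean of the proposal from `x`: `x` for RWM and
`x + (σ² / 2) ∇ log (refDensity) (x)` for SLA. -/
noncomputable def proposalMean (alg : Algorithm) (g : ℝ → ℝ) (κ σ : ℝ) {n : ℕ}
    (x : Fin n → ℝ) : Fin n → ℝ :=
  match alg with
  | .RWM => x
  | .SLA => fun i => x i + σ ^ 2 / 2 * gradLogRef g κ x i

/-- The proposal `y = mean(x) + σ z`, where `z` is a standard Gaussian vector. -/
noncomputable def proposal (alg : Algorithm) (g : ℝ → ℝ) (κ σ : ℝ) {n : ℕ}
    (x z : Fin n → ℝ) : Fin n → ℝ :=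
  fun i => proposalMean alg g κ σ x i + σ * z i

/-- The density `q(x, y)` of the proposal from `x`. -/
noncomputable def proposalDensity (alg : Algorithm) (g : ℝ → ℝ) (κ σ : ℝ) {n : ℕ}
    (x y : Fin n → ℝ) : ℝ :=
  ∏ i, gaussianPDFReal (proposalMean alg g κ σ x i) ⟨σ ^ 2, sq_nonneg σ⟩ (y i)

open Classical in
/-- The Metropolis–Hastings acceptance probability `a(x, y)`. -/
noncomputable def acceptProb (alg : Algorithm) (g : ℝ → ℝ) (κ σ : ℝ) {n : ℕ}
    (φ : (Fin n → ℝ) → ℝ) (x y : Fin n → ℝ) : ℝ :=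
  if 0 < targetDensity g κ φ x * proposalDensity alg g κ σ x y then
    min 1 ((targetDensity g κ φ y * proposalDensity alg g κ σ y x) /
      (targetDensity g κ φ x * proposalDensity alg g κ σ x y))
  else 0

open Classical in
/-- One Metropolis–Hastings step from `x`, driven by a Gaussian vector `z` and a uniform variable
`u` on `[0, 1]`: the proposal `y` is accepted if `u ≤ a(x, y)`, so with probability `a(x, y)`. -/
noncomputable def mhStep (alg : Algorithm) (g : ℝ → ℝ) (κ σ : ℝ) {n : ℕ}
    (φ : (Fin n → ℝ) → ℝ) (x z : Fin n → ℝ) (u : ℝ) : Fin n → ℝ :=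
  if u ≤ acceptProb alg g κ σ φ x (proposal alg g κ σ x z) then proposal alg g κ σ x z else x

/-- The joint law of `(x, z, u)` in stationarity: `x` has the target law, `z` is standard Gaussian,
`u` is uniform on `[0, 1]`, and the three are independent. -/
noncomputable def stepLaw (g : ℝ → ℝ) (κ : ℝ) {n : ℕ} (φ : (Fin n → ℝ) → ℝ) :
    Measure (((Fin n → ℝ) × (Fin n → ℝ)) × ℝ) :=
  ((target g κ φ).prod (Measure.pi fun _ : Fin n => gaussianReal 0 1)).prod
    (volume.restrict (Set.Icc (0 : ℝ) 1))

/-- The squared jump `(x'_i - x_i)²` of the coordinate `i` in one step. -/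
noncomputable def sqJump (alg : Algorithm) (g : ℝ → ℝ) (κ σ : ℝ) {n : ℕ}
    (φ : (Fin n → ℝ) → ℝ) (i : Fin n) (w : ((Fin n → ℝ) × (Fin n → ℝ)) × ℝ) : ℝ :=
  (mhStep alg g κ σ φ w.1.1 w.1.2 w.2 i - w.1.1 i) ^ 2

/-- The mean squared jump distance `S_n = E[(x'_i - x_i)²]` of the coordinate `i` (counted from
`0`), in stationarity. It makes sense for `n > i` only, and is set to `0` for the finitely many
other `n`. -/
noncomputable def meanSqJump (alg : Algorithm) (g : ℝ → ℝ) (κ σ : ℝ) {n : ℕ}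
    (φ : (Fin n → ℝ) → ℝ) (i : ℕ) : ℝ :=
  if h : i < n then ∫ w, sqJump alg g κ σ φ ⟨i, h⟩ w ∂(stepLaw g κ φ) else 0

/-- The norm `|x|_s = (∑ i, i ^ (2 s) * x_i ²) ^ (1/2)` on `ℝⁿ`, with `i` from `1` to `n`. -/
noncomputable def weightedNorm (s : ℝ) {n : ℕ} (x : Fin n → ℝ) : ℝ :=
  Real.sqrt (∑ i : Fin n, ((i : ℕ) + 1 : ℝ) ^ (2 * s) * x i ^ 2)

/-- The functions `φ_n` are bounded below, uniformly in all large `n`. -/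
def EventuallyBoundedBelow (φ : (n : ℕ) → (Fin n → ℝ) → ℝ) : Prop :=
  ∃ M : ℝ, ∀ᶠ n in atTop, ∀ x : Fin n → ℝ, M ≤ φ n x

/-- The local Lipschitz and growth condition on the `φ_n`. Only the values of `δ` on
`[0, ∞) × [0, ∞)` matter; there `δ` is nonnegative and locally bounded (bounded on every
`[0, R] × [0, R]`). -/
def LocallyLipschitzWithGrowth (κ : ℝ) (φ : (n : ℕ) → (Fin n → ℝ) → ℝ) : Prop :=
  ∃ δ : ℝ → ℝ → ℝ,
    (∀ R : ℝ, ∃ B : ℝ, ∀ a ∈ Set.Icc 0 R, ∀ b ∈ Set.Icc 0 R, 0 ≤ δ a b ∧ δ a b ≤ B) ∧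
    ∃ C p s s' s'' : ℝ, 0 < C ∧ 0 < p ∧ s < κ - 1 / 2 ∧ s' < κ - 1 / 2 ∧ s'' < κ - 1 / 2 ∧
      ∀ᶠ n in atTop, ∀ x y : Fin n → ℝ,
        |φ n y - φ n x| ≤ δ (weightedNorm s x) (weightedNorm s y) * weightedNorm s' (y - x) ∧
        |φ n x| ≤ C * (1 + weightedNorm s'' x ^ p)

/-- The constant `K`, with `X` of density `f = exp (-g)`: `E[g'(X)²]` for RWM and
`E[3 g''(X)³ + 5 g'''(X)²] / 48` for SLA. -/
noncomputable def constK (alg : Algorithm) (g : ℝ → ℝ) : ℝ :=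
  match alg with
  | .RWM => ∫ u : ℝ, deriv g u ^ 2 * Real.exp (-g u)
  | .SLA => (∫ u : ℝ, (3 * iteratedDeriv 2 g u ^ 3 + 5 * iteratedDeriv 3 g u ^ 2) *
      Real.exp (-g u)) / 48

/-- The limiting acceptance probability `a(l)`: `2 Φ(-(l/2) √(K / (1 + 2κ)))` for RWM and
`2 Φ(-(l³/2) √(K / (1 + 6κ)))` for SLA, where `Φ` is the standard normal distribution function. -/
noncomputable def limitAccept (alg : Algorithm) (g : ℝ → ℝ) (κ l : ℝ) : ℝ :=
  match alg with
  | .RWM => 2 * cdf (gaussianReal 0 1) (-(l / 2) * Real.sqrt (constK .RWM g / (1 + 2 * κ)))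
  | .SLA => 2 * cdf (gaussianReal 0 1) (-(l ^ 3 / 2) * Real.sqrt (constK .SLA g / (1 + 6 * κ)))

/-- The optimal acceptance rate to three decimals. -/
noncomputable def Algorithm.optimalRate : Algorithm → ℝ
  | .RWM => 0.234
  | .SLA => 0.574

end MHScaling

namespace MHScaling

/-! Divide each coordinate by its scale. Under the reference law the scaled coordinates are
independent with density `exp (-g)`, and coordinate `j` makes a step of size `ε_j = σ / λ_j`. The
logarithm of the acceptance ratio becomes a change of `φ` plus a sum of independent one-dimensional
increments `incr`, one for each pair of a position and a Gaussian variable. The mean squared jump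
divided by `σ²` is then an expectation of `exp (-φ)` times the squared move of one coordinate times
`min 1 (exp (log ratio))` (`integral_sqJump_eq_version`).

A Taylor expansion gives `incr = ε^k * lead + O(ε^(k+1))`, with `k = 1` for RWM and `k = 3` for SLA,
which is where `I = 1/k` comes from (`exists_incr_sub_lead_le`). Given the position, `lead` is
centred, and the mean of its conditional variance is `K` after an integration by parts
(`integral_leadVar`). The mean of `incr` is much smaller than the expansion shows; it is found from
reversibility instead of further Taylor terms. An odd function of the log ratio that is weighted
symmetrically integrates to zero, hence `E incr = -E incr² / 2` up to third order, that is, `-ε^(2k)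
K / 2` (`exists_integral_incr_add_le`).

Let `∑ ε_j^(2k)` tend to `τ`. In `L²` the sum of increments is the sum of leading terms shifted by
`-τ K / 2`. Conditionally on the positions, the leading terms are independent, so their
characteristic function is a product close to `exp (-t²/2 * ∑ ε_j^(2k) leadVar)`, and the law of
large numbers replaces that sum by `τ K`. The weight `exp (-φ)` depends on positions alone and is
bounded, so it passes through this argument, and the factor `z²` of the observed coordinate alters a
single factor of the product (`tendsto_integral_exp_sum_lead`). The local Lipschitz condition makes
the change of `φ` negligible (`tendsto_integral_min_one_abs_sub`). Lévy's theorem leaves the mean of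
`min 1 (exp Y)` for `Y` normal with mean `-s/2` and variance `s = τ K`, which is `2 Φ(-√s / 2)`
(`gaussianAccept_sq`). At the critical exponent `τ = l^(2k) / (1 + 2kκ)`; for larger `ρ`, `τ = 0`
and the limit is `1`.

For smaller `ρ` the sum grows like a power of `n`. Since `min 1 (exp x) ≤ exp (x / 2)`, the jump is
bounded by a product of Hellinger affinities, each at most `exp (-(K/16) ε_j^(2k))` for small steps,
apart from one bounded factor (`exists_integral_weighted_jump_le`).

For the optimum, put `t = c l^k`. The derivative of the speed has the sign of `tailScore (2 / k) t`,
which changes sign once. A rational bracket of the zero and Taylor bounds for the normal density and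
tail give the rate to three decimals. -/

/-! ### Polynomially bounded functions and Taylor remainders -/

/-- The weight `(1 + |u|) (1 + |z|)` that controls all functions of a position `u` and a Gaussian
increment `z`. -/
noncomputable def weight (p : ℝ × ℝ) : ℝ := (1 + |p.1|) * (1 + |p.2|)

lemma one_le_weight (p : ℝ × ℝ) : 1 ≤ weight p := by
  have h1 := abs_nonneg p.1
  have h2 := abs_nonneg p.2
  unfold weight
  nlinarith [mul_nonneg h1 h2]

/-- A family of functions on `ℝ × ℝ` that is bounded by a power of the weight, uniformly in the
step size `ε ∈ (0, 1]`. -/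
def PolyBound (F : ℝ → ℝ × ℝ → ℝ) : Prop :=
  ∃ A : ℝ, ∃ N : ℕ, 0 ≤ A ∧ ∀ ε ∈ Set.Ioc (0 : ℝ) 1, ∀ p, |F ε p| ≤ A * weight p ^ N

namespace PolyBound

variable {F G : ℝ → ℝ × ℝ → ℝ}

lemma mono (hG : PolyBound G) (h : ∀ ε ∈ Set.Ioc (0 : ℝ) 1, ∀ p, |F ε p| ≤ |G ε p|) :
    PolyBound F := by
  obtain ⟨A, N, hA, hb⟩ := hG
  exact ⟨A, N, hA, fun ε hε p => (h ε hε p).trans (hb ε hε p)⟩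

lemma congr (hG : PolyBound G) (h : ∀ ε ∈ Set.Ioc (0 : ℝ) 1, ∀ p, F ε p = G ε p) :
    PolyBound F :=
  hG.mono fun ε hε p => by rw [h ε hε p]

lemma add (hF : PolyBound F) (hG : PolyBound G) : PolyBound fun ε p => F ε p + G ε p := by
  obtain ⟨A, N, hA, hF⟩ := hF
  obtain ⟨B, M, hB, hG⟩ := hG
  refine ⟨A + B, max N M, by positivity, fun ε hε p => ?_⟩
  calc |F ε p + G ε p| ≤ |F ε p| + |G ε p| := abs_add_le _ _
    _ ≤ A * weight p ^ N + B * weight p ^ M := add_le_add (hF ε hε p) (hG ε hε p)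
    _ ≤ A * weight p ^ max N M + B * weight p ^ max N M := by
        gcongr <;> first | exact one_le_weight p | simp
    _ = _ := by ring

lemma mul (hF : PolyBound F) (hG : PolyBound G) : PolyBound fun ε p => F ε p * G ε p := by
  obtain ⟨A, N, hA, hF⟩ := hF
  obtain ⟨B, M, hB, hG⟩ := hG
  refine ⟨A * B, N + M, by positivity, fun ε hε p => ?_⟩
  calc |F ε p * G ε p| = |F ε p| * |G ε p| := abs_mul _ _
    _ ≤ (A * weight p ^ N) * (B * weight p ^ M) :=
        mul_le_mul (hF ε hε p) (hG ε hε p) (abs_nonneg _) ((abs_nonneg _).trans (hF ε hε p))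
    _ = _ := by ring

lemma const (c : ℝ) : PolyBound fun _ _ => c :=
  ⟨|c|, 0, abs_nonneg c, fun _ _ _ => by simp⟩

lemma neg (hF : PolyBound F) : PolyBound fun ε p => -F ε p :=
  hF.mono fun ε _ p => by rw [abs_neg]

lemma abs (hF : PolyBound F) : PolyBound fun ε p => |F ε p| :=
  hF.mono fun ε _ p => by rw [abs_abs]

lemma sub (hF : PolyBound F) (hG : PolyBound G) : PolyBound fun ε p => F ε p - G ε p :=
  (hF.add hG.neg).congr fun _ _ _ => sub_eq_add_neg _ _

lemma pow (hF : PolyBound F) (k : ℕ) : PolyBound fun ε p => F ε p ^ k := by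
  induction k with
  | zero => simpa using const 1
  | succ k ih => simpa only [pow_succ] using ih.mul hF

lemma eps : PolyBound fun ε _ => ε :=
  (const 1).mono fun ε hε _ => by
    rw [abs_of_pos hε.1, abs_one]
    exact hε.2

lemma fst : PolyBound fun _ p => p.1 := by
  refine ⟨1, 1, zero_le_one, fun _ _ p => ?_⟩
  have h1 := abs_nonneg p.1
  have h2 := abs_nonneg p.2
  simp only [weight, pow_one, one_mul]
  nlinarith [mul_nonneg h1 h2]

lemma snd : PolyBound fun _ p => p.2 := by
  refine ⟨1, 1, zero_le_one, fun _ _ p => ?_⟩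
  have h1 := abs_nonneg p.1
  have h2 := abs_nonneg p.2
  simp only [weight, pow_one, one_mul]
  nlinarith [mul_nonneg h1 h2]

end PolyBound

/-- A function on `ℝ` of at most polynomial growth. -/
def PolyGrowth (f : ℝ → ℝ) : Prop :=
  ∃ A : ℝ, ∃ N : ℕ, 0 ≤ A ∧ ∀ u, |f u| ≤ A * (1 + |u|) ^ N

lemma PolyBound.comp {f : ℝ → ℝ} (hf : PolyGrowth f) {F : ℝ → ℝ × ℝ → ℝ} (hF : PolyBound F) :
    PolyBound fun ε p => f (F ε p) := by
  obtain ⟨A, N, hA, hf⟩ := hf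
  refine PolyBound.mono (((PolyBound.const A).mul (((PolyBound.const 1).add hF.abs).pow N)))
    fun ε hε p => ?_
  rw [abs_of_nonneg (a := A * _) (by positivity)]
  exact hf _

/-- Smooth functions all of whose derivatives have at most polynomial growth. -/
structure SmoothPolyGrowth (f : ℝ → ℝ) : Prop where
  smooth : ContDiff ℝ (⊤ : ℕ∞) f
  growth : ∀ k : ℕ, PolyGrowth (iteratedDeriv k f)

namespace SmoothPolyGrowth

variable {f : ℝ → ℝ}

lemma polyGrowth (hf : SmoothPolyGrowth f) : PolyGrowth f := by
  simpa using hf.growth 0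

lemma deriv (hf : SmoothPolyGrowth f) : SmoothPolyGrowth (deriv f) where
  smooth := (contDiff_infty_iff_deriv.mp hf.smooth).2
  growth k := by
    have := hf.growth (k + 1)
    rwa [iteratedDeriv_succ'] at this

lemma iteratedDeriv (hf : SmoothPolyGrowth f) (m : ℕ) : SmoothPolyGrowth (iteratedDeriv m f) := by
  induction m with
  | zero => simpa using hf
  | succ m ih => rw [iteratedDeriv_succ]; exact ih.deriv

lemma differentiable (hf : SmoothPolyGrowth f) : Differentiable ℝ f :=
  hf.smooth.differentiable (by simp)

lemma continuous (hf : SmoothPolyGrowth f) : Continuous f := hf.smooth.continuous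

lemma hasDerivAt (hf : SmoothPolyGrowth f) (u : ℝ) : HasDerivAt f (_root_.deriv f u) u :=
  (hf.differentiable u).hasDerivAt

end SmoothPolyGrowth

lemma IsRegularLogDensity.smoothPolyGrowth {g : ℝ → ℝ} (hg : IsRegularLogDensity g) :
    SmoothPolyGrowth g where
  smooth := hg.smooth
  growth k := by
    obtain ⟨C, N, h⟩ := hg.growth k
    refine ⟨|C| * 2, N, by positivity, fun u => (h u).trans ?_⟩
    have h1 : (1 : ℝ) ≤ (1 + |u|) ^ N := one_le_pow₀ (by linarith [abs_nonneg u])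
    have h2 : |u| ^ N ≤ (1 + |u|) ^ N := by gcongr; linarith [abs_nonneg u]
    calc C * (1 + |u| ^ N) ≤ |C| * (1 + |u| ^ N) := by gcongr; exact le_abs_self C
      _ ≤ |C| * (2 * (1 + |u|) ^ N) := by gcongr; linarith
      _ = _ := by ring

/-- The remainder of order `m` of the Taylor expansion of `f` at `a`. -/
noncomputable def taylorRem (f : ℝ → ℝ) (m : ℕ) (a d : ℝ) : ℝ :=
  f (a + d) - ∑ j ∈ Finset.range m, iteratedDeriv j f a * d ^ j / j.factorial

/-- Differentiating in the displacement lowers the order by one and replaces `f` by its derivative;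
the induction for `taylorRem_bound` rests on this. -/
lemma hasDerivAt_taylorRem {f : ℝ → ℝ} (hf : SmoothPolyGrowth f) (m : ℕ) (a d : ℝ) :
    HasDerivAt (taylorRem f (m + 1) a) (taylorRem (deriv f) m a d) d := by
  have h1 : HasDerivAt (fun d => f (a + d)) (deriv f (a + d)) d := by
    simpa using (hf.hasDerivAt (a + d)).comp_const_add a d
  have h2 : HasDerivAt
      (fun d => ∑ j ∈ Finset.range m, iteratedDeriv (j + 1) f a * d ^ (j + 1) / (j + 1).factorial)
      (∑ j ∈ Finset.range m, iteratedDeriv j (deriv f) a * d ^ j / j.factorial) d := by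
    refine HasDerivAt.fun_sum fun j _ => ?_
    have h3 := ((hasDerivAt_pow (j + 1) d).const_mul (iteratedDeriv (j + 1) f a)).div_const
      ((j + 1).factorial : ℝ)
    refine h3.congr_deriv ?_
    rw [← iteratedDeriv_succ', Nat.factorial_succ]
    push_cast
    have : (j.factorial : ℝ) ≠ 0 := by positivity
    have : (j : ℝ) + 1 ≠ 0 := by positivity
    field_simp
  refine ((h1.sub h2).sub_const (f a)).congr_of_eventuallyEq (Eventually.of_forall fun d => ?_)
  simp [taylorRem, Finset.sum_range_succ']
  ring

/-- Induction on the order, over all `f` at once because the step passes to `deriv f`. The mean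
value inequality contributes the extra factor `|d|`. -/
lemma taylorRem_bound (m : ℕ) : ∀ {f : ℝ → ℝ}, SmoothPolyGrowth f →
    ∃ A : ℝ, ∃ N : ℕ, 0 ≤ A ∧
      ∀ a d, |taylorRem f m a d| ≤ A * |d| ^ m * ((1 + |a|) * (1 + |d|)) ^ N := by
  induction m with
  | zero =>
    intro f hf
    obtain ⟨A, N, hA, h⟩ := hf.polyGrowth
    refine ⟨A, N, hA, fun a d => ?_⟩
    simp only [taylorRem, Finset.range_zero, Finset.sum_empty, sub_zero, pow_zero, mul_one]
    refine (h _).trans ?_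
    gcongr
    nlinarith [abs_add_le a d, mul_nonneg (abs_nonneg a) (abs_nonneg d)]
  | succ m ih =>
    intro f hf
    obtain ⟨A, N, hA, h⟩ := ih hf.deriv
    refine ⟨A, N, hA, fun a d => ?_⟩
    -- The symmetric interval contains both `0` and `d`, so no case distinction on the sign of `d`
    -- arises.
    have key := (convex_Icc (-|d|) |d|).norm_image_sub_le_of_norm_hasDerivWithin_le
      (f := taylorRem f (m + 1) a) (f' := taylorRem (deriv f) m a)
      (C := A * |d| ^ m * ((1 + |a|) * (1 + |d|)) ^ N) (x := 0) (y := d)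
      (fun t _ => (hasDerivAt_taylorRem hf m a t).hasDerivWithinAt)
      (fun t ht => by
        have ht' : |t| ≤ |d| := abs_le.mpr ht
        refine (h a t).trans ?_
        gcongr)
      ⟨by simp, by simp⟩ ⟨neg_abs_le d, le_abs_self d⟩
    have h0 : taylorRem f (m + 1) a 0 = 0 := by
      simp [taylorRem, Finset.sum_range_succ']
    rw [h0, sub_zero, sub_zero, Real.norm_eq_abs, Real.norm_eq_abs] at key
    calc _ ≤ _ := key
      _ = _ := by ring

/-- The remainder of order `m` at a displacement `ε * E` is `ε ^ m` times a polynomially bounded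
function. -/
lemma PolyBound.taylorRem {f : ℝ → ℝ} (hf : SmoothPolyGrowth f) (m : ℕ) {E : ℝ → ℝ × ℝ → ℝ}
    (hE : PolyBound E) :
    PolyBound fun ε p => taylorRem f m p.1 (ε * E ε p) / ε ^ m := by
  obtain ⟨A, N, hA, h⟩ := taylorRem_bound m hf
  refine PolyBound.mono (((PolyBound.const A).mul (hE.abs.pow m)).mul
    ((((PolyBound.const 1).add PolyBound.fst.abs).mul
      ((PolyBound.const 1).add (PolyBound.eps.mul hE).abs)).pow N)) fun ε hε p => ?_
  have hε' : 0 < ε := hε.1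
  rw [abs_div, abs_of_pos (pow_pos hε' m), div_le_iff₀ (pow_pos hε' m),
    abs_of_nonneg (a := _ * _) (by positivity)]
  refine (h _ _).trans (le_of_eq ?_)
  rw [abs_mul ε, abs_of_pos hε']
  ring

/-! ### The increments of the logarithm of the acceptance ratio -/

/-- The order of the leading term of the increments: `1` for RWM and `3` for SLA. -/
def Algorithm.order : Algorithm → ℕ
  | .RWM => 1
  | .SLA => 3

lemma Algorithm.order_pos (alg : Algorithm) : 0 < alg.order := by cases alg <;> decide

lemma Algorithm.index_eq (alg : Algorithm) : alg.index = 1 / alg.order := by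
  cases alg <;> simp [Algorithm.index, Algorithm.order]

/-- The drift of the proposal, for a single coordinate of unit scale. -/
noncomputable def drift (alg : Algorithm) (g : ℝ → ℝ) (u : ℝ) : ℝ :=
  match alg with
  | .RWM => 0
  | .SLA => -(deriv g u / 2)

/-- The displacement of a coordinate of unit scale divided by the step size. -/
noncomputable def move (alg : Algorithm) (g : ℝ → ℝ) (ε : ℝ) (p : ℝ × ℝ) : ℝ :=
  p.2 + ε * drift alg g p.1

/-- The logarithm of the Metropolis–Hastings ratio in dimension one, for a proposal from `u` to
`v` with step size `ε`. -/
noncomputable def logRatio (alg : Algorithm) (g : ℝ → ℝ) (ε u v : ℝ) : ℝ :=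
  g u - g v + ((v - (u + ε ^ 2 * drift alg g u)) ^ 2 - (u - (v + ε ^ 2 * drift alg g v)) ^ 2) /
    (2 * ε ^ 2)

/-- The logarithm of the Metropolis–Hastings ratio as a function of the position and the Gaussian
increment. -/
noncomputable def incr (alg : Algorithm) (g : ℝ → ℝ) (ε : ℝ) (p : ℝ × ℝ) : ℝ :=
  logRatio alg g ε p.1 (p.1 + ε * move alg g ε p)

/-- The leading coefficient of `incr` as the step size tends to `0`. -/
noncomputable def lead (alg : Algorithm) (g : ℝ → ℝ) (p : ℝ × ℝ) : ℝ :=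
  match alg with
  | .RWM => -(deriv g p.1 * p.2)
  | .SLA => iteratedDeriv 3 g p.1 * p.2 ^ 3 / 12 - deriv g p.1 * iteratedDeriv 2 g p.1 * p.2 / 4

lemma polyBound_drift {g : ℝ → ℝ} (hg : SmoothPolyGrowth g) (alg : Algorithm) :
    PolyBound fun _ p => drift alg g p.1 := by
  cases alg
  · exact PolyBound.const 0
  · exact ((PolyBound.fst.comp hg.deriv.polyGrowth).mul (PolyBound.const (-(1 / 2)))).congr
      fun _ _ _ => by simp only [drift]; ring

lemma polyBound_move {g : ℝ → ℝ} (hg : SmoothPolyGrowth g) (alg : Algorithm) :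
    PolyBound (move alg g) :=
  PolyBound.snd.add (PolyBound.eps.mul (polyBound_drift hg alg))

lemma polyBound_lead {g : ℝ → ℝ} (hg : SmoothPolyGrowth g) (alg : Algorithm) :
    PolyBound fun _ p => lead alg g p := by
  have h1 := PolyBound.fst.comp hg.deriv.polyGrowth
  cases alg
  · exact (h1.mul PolyBound.snd).neg
  · have h2 := PolyBound.fst.comp (hg.growth 2)
    have h3 := PolyBound.fst.comp (hg.growth 3)
    refine (((h3.mul (PolyBound.snd.pow 3)).mul (PolyBound.const (1 / 12))).sub
      (((h1.mul h2).mul PolyBound.snd).mul (PolyBound.const (1 / 4)))).congr fun _ _ _ => ?_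
    simp only [lead]
    ring

/-- Without drift the two Gaussian terms cancel, and only the difference of `g` at the two points
remains. -/
lemma incr_rwm_eq {g : ℝ → ℝ} {ε : ℝ} (hε : ε ≠ 0) (p : ℝ × ℝ) :
    incr .RWM g ε p =
      ε * lead .RWM g p + ε ^ 2 * -(taylorRem g 2 p.1 (ε * move .RWM g ε p) / ε ^ 2) := by
  simp only [incr, logRatio, lead, move, drift, taylorRem, Finset.sum_range_succ,
    Finset.sum_range_zero, iteratedDeriv_zero, iteratedDeriv_one]
  simp only [mul_zero, add_zero, zero_add, pow_zero, pow_one, mul_one, Nat.factorial_zero,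
    Nat.factorial_one, Nat.cast_one, div_one]
  field_simp
  ring

/-- The Langevin drift cancels every term below order `ε ^ 3`. With the move `E` and the remainders
`R₃`, `R₄` as free variables, the claim is a polynomial identity once `g` is expanded to order four,
`g'` to order three, and `z` is eliminated in favour of `E`. -/
lemma incr_sla_eq {g : ℝ → ℝ} {ε : ℝ} (hε : ε ≠ 0) (u z : ℝ) {E R₃ R₄ : ℝ}
    (hE : E = move .SLA g ε (u, z))
    (hR₃ : R₃ = taylorRem (deriv g) 3 u (ε * E) / ε ^ 3)
    (hR₄ : R₄ = taylorRem g 4 u (ε * E) / ε ^ 4) :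
    incr .SLA g ε (u, z) = ε ^ 3 * lead .SLA g (u, z) + ε ^ 4 *
      (iteratedDeriv 3 g u * (-(deriv g u / 2)) * (E ^ 2 + E * z + z ^ 2) / 12 - R₄ + E * R₃ / 2
        + deriv g u ^ 2 * iteratedDeriv 2 g u / 8
        - deriv g u * (iteratedDeriv 3 g u * E ^ 2 / 2 + ε * R₃) / 4
        - (iteratedDeriv 2 g u * E + ε * iteratedDeriv 3 g u * E ^ 2 / 2 + ε ^ 2 * R₃) ^ 2 / 8) := by
  have h0 : z = E + ε * (deriv g u / 2) := by
    rw [hE]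
    simp only [move, drift]
    ring
  have hg4 : g (u + ε * E) = ε ^ 4 * R₄ + (g u + deriv g u * (ε * E)
      + iteratedDeriv 2 g u * (ε * E) ^ 2 / 2 + iteratedDeriv 3 g u * (ε * E) ^ 3 / 6) := by
    rw [hR₄, mul_div_cancel₀ _ (pow_ne_zero 4 hε)]
    simp only [taylorRem, Finset.sum_range_succ, Finset.sum_range_zero, iteratedDeriv_zero,
      iteratedDeriv_one]
    norm_num [Nat.factorial]
  have hg3 : deriv g (u + ε * E) = ε ^ 3 * R₃ + (deriv g u + iteratedDeriv 2 g u * (ε * E)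
      + iteratedDeriv 3 g u * (ε * E) ^ 2 / 2) := by
    rw [hR₃, mul_div_cancel₀ _ (pow_ne_zero 3 hε)]
    simp only [taylorRem, Finset.sum_range_succ, Finset.sum_range_zero, ← iteratedDeriv_succ']
    norm_num [Nat.factorial]
  simp only [incr, logRatio, lead, ← hE, drift]
  rw [hg4, hg3, h0]
  field_simp
  ring

/-- The expansion of the logarithm of the acceptance ratio in the step size. -/
lemma exists_incr_sub_lead_le {g : ℝ → ℝ} (hg : SmoothPolyGrowth g) (alg : Algorithm) :
    ∃ Q : ℝ → ℝ × ℝ → ℝ, PolyBound Q ∧ ∀ ε ∈ Set.Ioc (0 : ℝ) 1, ∀ p,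
      incr alg g ε p = ε ^ alg.order * lead alg g p + ε ^ (alg.order + 1) * Q ε p := by
  have hE := polyBound_move hg alg
  cases alg
  · exact ⟨_, (PolyBound.taylorRem hg 2 hE).neg, fun ε hε p => by
      simpa [Algorithm.order] using incr_rwm_eq hε.1.ne' p⟩
  · have h1 := PolyBound.fst.comp hg.deriv.polyGrowth
    have h2 := PolyBound.fst.comp (hg.growth 2)
    have h3 := PolyBound.fst.comp (hg.growth 3)
    have hR₃ := PolyBound.taylorRem hg.deriv 3 hE
    have hR₄ := PolyBound.taylorRem hg 4 hE
    have hz := PolyBound.snd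
    have he := PolyBound.eps
    refine ⟨_, ?_, fun ε hε p => incr_sla_eq hε.1.ne' p.1 p.2 rfl rfl rfl⟩
    refine ((((((((h3.mul h1).mul (((hE.pow 2).add (hE.mul hz)).add (hz.pow 2))).mul
      (PolyBound.const (-(1 / 24)))).sub hR₄).add ((hE.mul hR₃).mul (PolyBound.const (1 / 2)))).add
      (((h1.pow 2).mul h2).mul (PolyBound.const (1 / 8)))).sub
      ((h1.mul (((h3.mul (hE.pow 2)).mul (PolyBound.const (1 / 2))).add (he.mul hR₃))).mul
        (PolyBound.const (1 / 4)))).sub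
      (((((h2.mul hE).add (((he.mul h3).mul (hE.pow 2)).mul (PolyBound.const (1 / 2)))).add
        ((he.pow 2).mul hR₃)).pow 2).mul (PolyBound.const (1 / 8)))).congr fun ε _ p => ?_
    ring

/-! ### The one-dimensional laws -/

/-- The law on `ℝ` with density `exp (-g)`. -/
noncomputable def marginal (g : ℝ → ℝ) : Measure ℝ :=
  (volume : Measure ℝ).withDensity fun u => ENNReal.ofReal (Real.exp (-g u))

/-- The joint law of a position and an independent standard Gaussian increment. -/
noncomputable def pairLaw (g : ℝ → ℝ) : Measure (ℝ × ℝ) := (marginal g).prod (gaussianReal 0 1)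

lemma integrable_exp_neg {g : ℝ → ℝ} (hg : IsRegularLogDensity g) :
    Integrable fun u => Real.exp (-g u) := by
  simpa using hg.moments 0

lemma isProbabilityMeasure_marginal {g : ℝ → ℝ} (hg : IsRegularLogDensity g) :
    IsProbabilityMeasure (marginal g) := by
  refine ⟨?_⟩
  rw [marginal, withDensity_apply _ MeasurableSet.univ, Measure.restrict_univ,
    ← ofReal_integral_eq_lintegral_ofReal (integrable_exp_neg hg)
      (ae_of_all _ fun _ => (Real.exp_pos _).le), hg.density, ENNReal.ofReal_one]

lemma isProbabilityMeasure_pairLaw {g : ℝ → ℝ} (hg : IsRegularLogDensity g) :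
    IsProbabilityMeasure (pairLaw g) := by
  have := isProbabilityMeasure_marginal hg
  unfold pairLaw
  infer_instance

lemma measurable_ofReal_exp_neg {g : ℝ → ℝ} (hg : Continuous g) :
    Measurable fun u => ENNReal.ofReal (Real.exp (-g u)) := by fun_prop

lemma integral_marginal {g : ℝ → ℝ} (hg : Continuous g) (F : ℝ → ℝ) :
    ∫ u, F u ∂marginal g = ∫ u, F u * Real.exp (-g u) := by
  rw [marginal, integral_withDensity_eq_integral_toReal_smul (measurable_ofReal_exp_neg hg)
    (ae_of_all _ fun _ => ENNReal.ofReal_lt_top)]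
  refine integral_congr_ae (ae_of_all _ fun u => ?_)
  simp only [ENNReal.toReal_ofReal (Real.exp_pos _).le, smul_eq_mul]
  ring

lemma integrable_marginal_iff {g : ℝ → ℝ} (hg : Continuous g) (F : ℝ → ℝ) :
    Integrable F (marginal g) ↔ Integrable fun u => F u * Real.exp (-g u) := by
  rw [marginal, integrable_withDensity_iff (measurable_ofReal_exp_neg hg)
    (ae_of_all _ fun _ => ENNReal.ofReal_lt_top)]
  simp only [ENNReal.toReal_ofReal (Real.exp_pos _).le]

lemma one_add_abs_pow_le (u : ℝ) (N : ℕ) : (1 + |u|) ^ N ≤ 2 ^ N * (1 + |u| ^ N) := by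
  have h1 : 1 + |u| ≤ 2 * max 1 |u| := by
    linarith [le_max_left 1 |u|, le_max_right 1 |u|]
  calc (1 + |u|) ^ N ≤ (2 * max 1 |u|) ^ N := by gcongr
    _ = 2 ^ N * (max 1 |u|) ^ N := mul_pow _ _ _
    _ ≤ 2 ^ N * (1 + |u| ^ N) := by
        gcongr
        rcases max_choice 1 |u| with h | h <;> rw [h]
        · simp
        · linarith

lemma integrable_one_add_abs_pow {μ : Measure ℝ} [IsProbabilityMeasure μ]
    (h : ∀ k : ℕ, Integrable (fun u => u ^ k) μ) (N : ℕ) :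
    Integrable (fun u => (1 + |u|) ^ N) μ := by
  refine Integrable.mono' (g := fun u => 2 ^ N * (1 + |u| ^ N)) ?_ (by fun_prop) ?_
  · refine (((integrable_const 1).add ?_).const_mul _)
    simpa only [abs_pow] using (h N).abs
  · refine ae_of_all _ fun u => ?_
    rw [Real.norm_of_nonneg (by positivity)]
    exact one_add_abs_pow_le u N

lemma integrable_pow_gaussianReal (k : ℕ) : Integrable (fun z : ℝ => z ^ k) (gaussianReal 0 1) := by
  have h := (memLp_id_gaussianReal (μ := 0) (v := 1) (k : NNReal)).integrable_norm_pow' 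
  exact h.mono' (by fun_prop) (ae_of_all _ fun z => by rw [norm_pow]; rfl)

lemma integrable_weight_pow {g : ℝ → ℝ} (hg : IsRegularLogDensity g) (N : ℕ) :
    Integrable (fun p => weight p ^ N) (pairLaw g) := by
  have := isProbabilityMeasure_marginal hg
  have h1 := integrable_one_add_abs_pow (μ := marginal g) (fun k =>
    (integrable_marginal_iff hg.smooth.continuous _).2 (hg.moments k)) N
  have h2 := integrable_one_add_abs_pow integrable_pow_gaussianReal N
  refine (h1.mul_prod h2).congr (ae_of_all _ fun p => ?_)
  simp [weight, mul_pow]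

lemma PolyBound.integrable {g : ℝ → ℝ} (hg : IsRegularLogDensity g) {F : ℝ → ℝ × ℝ → ℝ}
    (hF : PolyBound F) {ε : ℝ} (hε : ε ∈ Set.Ioc (0 : ℝ) 1)
    (hm : AEStronglyMeasurable (F ε) (pairLaw g)) : Integrable (F ε) (pairLaw g) := by
  obtain ⟨A, N, -, h⟩ := hF
  exact ((integrable_weight_pow hg N).const_mul A).mono' hm (ae_of_all _ fun p => h ε hε p)

lemma PolyBound.exists_integral_abs_le {g : ℝ → ℝ} (hg : IsRegularLogDensity g)
    {F : ℝ → ℝ × ℝ → ℝ} (hF : PolyBound F) :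
    ∃ c : ℝ, 0 ≤ c ∧ ∀ ε ∈ Set.Ioc (0 : ℝ) 1, ∫ p, |F ε p| ∂pairLaw g ≤ c := by
  obtain ⟨A, N, hA, h⟩ := hF
  refine ⟨∫ p, A * weight p ^ N ∂pairLaw g, integral_nonneg fun p => ?_, fun ε hε => ?_⟩
  · have := one_le_weight p
    positivity
  · exact integral_mono_of_nonneg (ae_of_all _ fun _ => abs_nonneg _)
      ((integrable_weight_pow hg N).const_mul A) (ae_of_all _ fun p => h ε hε p)

/-! ### Continuity of the increments -/

section Continuity

variable {g : ℝ → ℝ} (hg : SmoothPolyGrowth g) (alg : Algorithm)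
include hg

lemma continuous_drift : Continuous (drift alg g) := by
  have := hg.deriv.continuous
  cases alg
  · exact continuous_const
  · exact (this.div_const 2).neg

lemma continuous_move (ε : ℝ) : Continuous (move alg g ε) := by
  have := continuous_drift hg alg
  unfold move
  fun_prop

lemma continuous_logRatio (ε : ℝ) : Continuous fun p : ℝ × ℝ => logRatio alg g ε p.1 p.2 := by
  have := continuous_drift hg alg
  have := hg.continuous
  unfold logRatio
  fun_prop

lemma continuous_incr (ε : ℝ) : Continuous (incr alg g ε) := by
  have h1 := continuous_move hg alg ε
  exact (continuous_logRatio hg alg ε).comp (f := fun p => (p.1, p.1 + ε * move alg g ε p))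
    (by fun_prop)

lemma continuous_lead : Continuous (lead alg g) := by
  have h1 := hg.deriv.continuous
  have h2 := (hg.iteratedDeriv 2).continuous
  have h3 := (hg.iteratedDeriv 3).continuous
  cases alg
  · exact ((h1.comp continuous_fst).mul continuous_snd).neg
  · unfold lead
    fun_prop

end Continuity

/-! ### Detailed balance -/

/-- The joint density of the position and the proposal in dimension one, in stationarity. -/
noncomputable def pairDensity (alg : Algorithm) (g : ℝ → ℝ) (ε : ℝ) (p : ℝ × ℝ) : ℝ :=
  Real.exp (-g p.1) *
    gaussianPDFReal (p.1 + ε ^ 2 * drift alg g p.1) (NNReal.mk (ε ^ 2) (sq_nonneg ε)) p.2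

lemma logRatio_swap (alg : Algorithm) (g : ℝ → ℝ) (ε u v : ℝ) :
    logRatio alg g ε v u = -logRatio alg g ε u v := by
  unfold logRatio
  ring

lemma gaussianPDFReal_mul_exp {ε : ℝ} (m m' x x' : ℝ) :
    gaussianPDFReal m (NNReal.mk (ε ^ 2) (sq_nonneg ε)) x *
        Real.exp (((x - m) ^ 2 - (x' - m') ^ 2) / (2 * ε ^ 2)) =
      gaussianPDFReal m' (NNReal.mk (ε ^ 2) (sq_nonneg ε)) x' := by
  simp only [gaussianPDFReal, NNReal.coe_mk]
  rw [mul_assoc, ← Real.exp_add]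
  congr 2
  ring

/-- Detailed balance: the exponential of the log ratio is the likelihood ratio between the reversed
and the original pair of position and proposal. -/
lemma pairDensity_swap (alg : Algorithm) (g : ℝ → ℝ) (ε u v : ℝ) :
    pairDensity alg g ε (u, v) * Real.exp (logRatio alg g ε u v) = pairDensity alg g ε (v, u) := by
  simp only [pairDensity, logRatio]
  rw [Real.exp_add, ← gaussianPDFReal_mul_exp (u + ε ^ 2 * drift alg g u)
    (v + ε ^ 2 * drift alg g v) v u]
  have : Real.exp (-g v) = Real.exp (-g u) * Real.exp (g u - g v) := by
    rw [← Real.exp_add]; ring_nf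
  rw [this]
  ring

lemma continuous_pairDensity {g : ℝ → ℝ} (hg : SmoothPolyGrowth g) (alg : Algorithm) (ε : ℝ) :
    Continuous (pairDensity alg g ε) := by
  have h1 := continuous_drift hg alg
  have h2 := hg.continuous
  unfold pairDensity
  simp only [gaussianPDFReal]
  fun_prop

/-- Given `u`, the proposal is normal with mean `u + ε ^ 2 * drift` and variance `ε ^ 2`. In the
variables position and proposal, reversal of the step is the swap of coordinates. -/
lemma map_move_eq {g : ℝ → ℝ} (hg : IsRegularLogDensity g) (alg : Algorithm) {ε : ℝ} (hε : 0 < ε) :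
    (pairLaw g).map (fun p => (p.1, p.1 + ε * move alg g ε p)) =
      (volume : Measure (ℝ × ℝ)).withDensity fun p => ENNReal.ofReal (pairDensity alg g ε p) := by
  have hs := hg.smoothPolyGrowth
  have hm := continuous_move hs alg ε
  have hv : NNReal.mk (ε ^ 2) (sq_nonneg ε) ≠ 0 := fun h =>
    pow_ne_zero 2 hε.ne' (congrArg NNReal.toReal h)
  have := isProbabilityMeasure_marginal hg
  refine Measure.ext_of_lintegral _ fun f hf => ?_
  have hp : Measurable fun p => ENNReal.ofReal (pairDensity alg g ε p) :=
    (continuous_pairDensity hs alg ε).measurable.ennreal_ofReal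
  rw [lintegral_map hf (by fun_prop), lintegral_withDensity_eq_lintegral_mul _ hp hf, pairLaw,
    lintegral_prod _ (by fun_prop), Measure.volume_eq_prod, lintegral_prod _ (by fun_prop),
    marginal, lintegral_withDensity_eq_lintegral_mul _ (measurable_ofReal_exp_neg hs.continuous)
      (by fun_prop)]
  refine lintegral_congr fun u => ?_
  have hmap : (gaussianReal 0 1).map (fun z => u + ε * move alg g ε (u, z)) =
      gaussianReal (u + ε ^ 2 * drift alg g u) (NNReal.mk (ε ^ 2) (sq_nonneg ε)) := by
    have h1 : (fun z => u + ε * move alg g ε (u, z)) =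
        (fun x => (u + ε ^ 2 * drift alg g u) + x) ∘ (fun z => ε * z) := by
      funext z
      simp only [move, Function.comp]
      ring
    rw [h1, ← Measure.map_map (by fun_prop) (by fun_prop), gaussianReal_map_const_mul,
      gaussianReal_map_const_add]
    simp
  have h2 : ∫⁻ z, f (u, u + ε * move alg g ε (u, z)) ∂gaussianReal 0 1 =
      ∫⁻ v, f (u, v) ∂((gaussianReal 0 1).map (fun z => u + ε * move alg g ε (u, z))) := by
    rw [lintegral_map (by fun_prop) (by fun_prop)]
  simp only [Pi.mul_apply]
  rw [h2, hmap, gaussianReal_of_var_ne_zero _ hv,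
    lintegral_withDensity_eq_lintegral_mul _ (measurable_gaussianPDF _ _) (by fun_prop),
    ← lintegral_const_mul _ (by fun_prop)]
  refine lintegral_congr fun v => ?_
  rw [Pi.mul_apply, pairDensity, ENNReal.ofReal_mul (Real.exp_pos _).le, gaussianPDF, mul_assoc]

lemma lintegral_pairDensity {g : ℝ → ℝ} (hg : IsRegularLogDensity g) (alg : Algorithm) {ε : ℝ}
    (hε : 0 < ε) : ∫⁻ p, ENNReal.ofReal (pairDensity alg g ε p) = 1 := by
  have := isProbabilityMeasure_pairLaw hg
  have hm := continuous_move hg.smoothPolyGrowth alg ε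
  have h := congrArg (fun μ => μ Set.univ) (map_move_eq hg alg hε)
  simp only [withDensity_apply _ MeasurableSet.univ, Measure.restrict_univ] at h
  rw [← h, Measure.map_apply (by fun_prop) MeasurableSet.univ, Set.preimage_univ, measure_univ]

lemma pairDensity_nonneg (alg : Algorithm) (g : ℝ → ℝ) (ε : ℝ) (p : ℝ × ℝ) :
    0 ≤ pairDensity alg g ε p :=
  mul_nonneg (Real.exp_pos _).le (gaussianPDFReal_nonneg _ _ _)

/-- By detailed balance the tilted density is the swapped density, which has the same mass. -/
lemma lintegral_exp_incr {g : ℝ → ℝ} (hg : IsRegularLogDensity g) (alg : Algorithm) {ε : ℝ}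
    (hε : 0 < ε) : ∫⁻ p, ENNReal.ofReal (Real.exp (incr alg g ε p)) ∂pairLaw g = 1 := by
  have hs := hg.smoothPolyGrowth
  have hm := continuous_move hs alg ε
  have hl := continuous_logRatio hs alg ε
  have hp : Measurable fun p => ENNReal.ofReal (pairDensity alg g ε p) :=
    (continuous_pairDensity hs alg ε).measurable.ennreal_ofReal
  have h1 : ∫⁻ p, ENNReal.ofReal (Real.exp (incr alg g ε p)) ∂pairLaw g =
      ∫⁻ p, ENNReal.ofReal (Real.exp (logRatio alg g ε p.1 p.2))
        ∂((pairLaw g).map (fun p => (p.1, p.1 + ε * move alg g ε p))) := by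
    rw [lintegral_map (by fun_prop) (by fun_prop)]
    rfl
  rw [h1, map_move_eq hg alg hε, lintegral_withDensity_eq_lintegral_mul _ hp (by fun_prop),
    ← lintegral_pairDensity hg alg hε, Measure.volume_eq_prod,
    ← lintegral_prod_swap (fun p => ENNReal.ofReal (pairDensity alg g ε p))]
  refine lintegral_congr fun p => ?_
  rw [Pi.mul_apply, ← ENNReal.ofReal_mul (pairDensity_nonneg _ _ _ _),
    pairDensity_swap alg g ε p.1 p.2]
  rfl

lemma integrable_exp_incr {g : ℝ → ℝ} (hg : IsRegularLogDensity g) (alg : Algorithm) {ε : ℝ}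
    (hε : 0 < ε) : Integrable (fun p => Real.exp (incr alg g ε p)) (pairLaw g) := by
  have hc := continuous_incr hg.smoothPolyGrowth alg ε
  refine ⟨by fun_prop, ?_⟩
  rw [hasFiniteIntegral_iff_ofReal (ae_of_all _ fun _ => (Real.exp_pos _).le),
    lintegral_exp_incr hg alg hε]
  exact ENNReal.one_lt_top

lemma integral_exp_incr {g : ℝ → ℝ} (hg : IsRegularLogDensity g) (alg : Algorithm) {ε : ℝ}
    (hε : 0 < ε) : ∫ p, Real.exp (incr alg g ε p) ∂pairLaw g = 1 := by
  rw [integral_eq_lintegral_of_nonneg_ae (ae_of_all _ fun _ => (Real.exp_pos _).le)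
    (integrable_exp_incr hg alg hε).1, lintegral_exp_incr hg alg hε, ENNReal.toReal_one]

/-- Reversibility: the increments times their logistic transform integrate to zero. -/
lemma integral_incr_mul_sigmoid {g : ℝ → ℝ} (hg : IsRegularLogDensity g) (alg : Algorithm) {ε : ℝ}
    (hε : 0 < ε) :
    ∫ p, incr alg g ε p * Real.exp (incr alg g ε p) / (1 + Real.exp (incr alg g ε p))
      ∂pairLaw g = 0 := by
  have hs := hg.smoothPolyGrowth
  have hm := continuous_move hs alg ε
  have hl := continuous_logRatio hs alg ε
  have hp : Measurable fun p => ENNReal.ofReal (pairDensity alg g ε p) :=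
    (continuous_pairDensity hs alg ε).measurable.ennreal_ofReal
  set G : ℝ × ℝ → ℝ := fun p => logRatio alg g ε p.1 p.2 * Real.exp (logRatio alg g ε p.1 p.2) /
    (1 + Real.exp (logRatio alg g ε p.1 p.2)) with hG
  have hGm : Measurable G := by
    have := hl.measurable
    fun_prop
  have h1 : ∫ p, incr alg g ε p * Real.exp (incr alg g ε p) / (1 + Real.exp (incr alg g ε p))
      ∂pairLaw g = ∫ p, G p ∂((pairLaw g).map (fun p => (p.1, p.1 + ε * move alg g ε p))) := by
    rw [integral_map (by fun_prop) hGm.aestronglyMeasurable]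
    rfl
  rw [h1, map_move_eq hg alg hε, integral_withDensity_eq_integral_toReal_smul hp
    (ae_of_all _ fun _ => ENNReal.ofReal_lt_top)]
  simp only [ENNReal.toReal_ofReal (pairDensity_nonneg _ _ _ _), smul_eq_mul]
  -- With `p` and `p'` the densities of the pair and of the swapped pair, the density times the
  -- logistic factor is `p * p' / (p + p')`, which is symmetric, while the log ratio is
  -- antisymmetric. The integral thus equals its own negative.
  have hanti : ∀ p : ℝ × ℝ,
      pairDensity alg g ε p.swap * G p.swap = -(pairDensity alg g ε p * G p) := by
    rintro ⟨u, v⟩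
    simp only [Prod.swap_prod_mk, hG]
    rw [← pairDensity_swap alg g ε u v, logRatio_swap alg g ε u v, Real.exp_neg]
    have := Real.exp_pos (logRatio alg g ε u v)
    field_simp
    ring
  have h2 : ∫ p, pairDensity alg g ε p * G p =
      ∫ p : ℝ × ℝ, pairDensity alg g ε p.swap * G p.swap := by
    rw [Measure.volume_eq_prod]
    exact (integral_prod_swap (fun p => pairDensity alg g ε p * G p)).symm
  have h3 : ∫ p, pairDensity alg g ε p * G p = -∫ p, pairDensity alg g ε p * G p := by
    rw [← integral_neg]
    exact h2.trans (integral_congr_ae (ae_of_all _ hanti))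
  linarith

/-! ### Moments of the leading term -/

lemma hasDerivAt_gaussianPDFReal (z : ℝ) :
    HasDerivAt (gaussianPDFReal 0 1) (-z * gaussianPDFReal 0 1 z) z := by
  have h1 : HasDerivAt (fun x : ℝ => -(x ^ 2) / 2) (-z) z := by
    refine ((hasDerivAt_pow 2 z).fun_neg.div_const 2).congr_deriv ?_
    simp
    ring
  have h2 := h1.exp.const_mul (√(2 * Real.pi))⁻¹
  have h3 : gaussianPDFReal 0 1 = fun x => (√(2 * Real.pi))⁻¹ * Real.exp (-(x ^ 2) / 2) := by
    funext x
    simp [gaussianPDFReal]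
  rw [h3]
  exact h2.congr_deriv (by ring)

lemma integral_gaussianReal_eq (F : ℝ → ℝ) :
    ∫ z, F z ∂gaussianReal 0 1 = ∫ z, F z * gaussianPDFReal 0 1 z := by
  rw [integral_gaussianReal_eq_integral_smul one_ne_zero]
  simp [mul_comm]

lemma integrable_pow_mul_gaussianPDFReal (k : ℕ) :
    Integrable fun z : ℝ => z ^ k * gaussianPDFReal 0 1 z := by
  have h := integrable_pow_gaussianReal k
  rw [gaussianReal_of_var_ne_zero _ one_ne_zero,
    integrable_withDensity_iff (measurable_gaussianPDF _ _)
      (ae_of_all _ fun _ => gaussianPDF_lt_top)] at h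
  simpa only [toReal_gaussianPDF] using h

/-- Integration by parts: the derivative of `z ^ (k + 1)` times the normal density integrates to
zero. -/
lemma integral_pow_add_two_gaussianReal (k : ℕ) :
    ∫ z, z ^ (k + 2) ∂gaussianReal 0 1 = (k + 1) * ∫ z, z ^ k ∂gaussianReal 0 1 := by
  have h1 := integrable_pow_mul_gaussianPDFReal k
  have h2 := integrable_pow_mul_gaussianPDFReal (k + 2)
  have key := integral_eq_zero_of_hasDerivAt_of_integrable
    (f := fun z : ℝ => z ^ (k + 1) * gaussianPDFReal 0 1 z)
    (f' := fun z : ℝ => (k + 1) * (z ^ k * gaussianPDFReal 0 1 z) -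
      z ^ (k + 2) * gaussianPDFReal 0 1 z)
    (fun z => by
      refine ((hasDerivAt_pow (k + 1) z).mul (hasDerivAt_gaussianPDFReal z)).congr_deriv ?_
      push_cast
      ring)
    ((h1.const_mul _).sub h2) (integrable_pow_mul_gaussianPDFReal (k + 1))
  rw [integral_sub (h1.const_mul _) h2, integral_const_mul] at key
  rw [integral_gaussianReal_eq, integral_gaussianReal_eq]
  linarith

lemma integral_pow_one_gaussianReal : ∫ z, z ^ 1 ∂gaussianReal 0 1 = (0 : ℝ) := by
  simp

lemma integral_pow_zero_gaussianReal : ∫ z, z ^ 0 ∂gaussianReal 0 1 = (1 : ℝ) := by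
  simp

lemma integral_pow_two_gaussianReal : ∫ z, z ^ 2 ∂gaussianReal 0 1 = (1 : ℝ) := by
  have := integral_pow_add_two_gaussianReal 0
  rw [integral_pow_zero_gaussianReal] at this
  simpa using this

lemma integral_pow_three_gaussianReal : ∫ z, z ^ 3 ∂gaussianReal 0 1 = (0 : ℝ) := by
  rw [integral_pow_add_two_gaussianReal 1, integral_pow_one_gaussianReal, mul_zero]

lemma integral_pow_four_gaussianReal : ∫ z, z ^ 4 ∂gaussianReal 0 1 = (3 : ℝ) := by
  rw [integral_pow_add_two_gaussianReal 2, integral_pow_two_gaussianReal]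
  norm_num

lemma integral_pow_six_gaussianReal : ∫ z, z ^ 6 ∂gaussianReal 0 1 = (15 : ℝ) := by
  rw [integral_pow_add_two_gaussianReal 4, integral_pow_four_gaussianReal]
  norm_num

/-- Only odd powers of the Gaussian variable occur in `lead`. -/
lemma integral_lead (alg : Algorithm) (g : ℝ → ℝ) (u : ℝ) :
    ∫ z, lead alg g (u, z) ∂gaussianReal 0 1 = 0 := by
  have h1 := integral_pow_one_gaussianReal
  have h3 := integral_pow_three_gaussianReal
  have i1 := integrable_pow_gaussianReal 1
  have i3 := integrable_pow_gaussianReal 3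
  cases alg
  · have : ∀ z : ℝ, lead .RWM g (u, z) = -deriv g u * z ^ 1 := fun z => by
      simp only [lead]; ring
    simp only [this, integral_const_mul, h1, mul_zero]
  · have : ∀ z : ℝ, lead .SLA g (u, z) = iteratedDeriv 3 g u / 12 * z ^ 3 -
        deriv g u * iteratedDeriv 2 g u / 4 * z ^ 1 := fun z => by
      simp only [lead]; ring
    simp only [this]
    rw [integral_sub (i3.const_mul _) (i1.const_mul _), integral_const_mul, integral_const_mul, h1,
      h3]
    ring

/-- The variance of the leading term given the position. -/
noncomputable def leadVar (alg : Algorithm) (g : ℝ → ℝ) (u : ℝ) : ℝ :=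
  match alg with
  | .RWM => deriv g u ^ 2
  | .SLA => 15 * (iteratedDeriv 3 g u / 12) ^ 2
      - 6 * (iteratedDeriv 3 g u / 12) * (deriv g u * iteratedDeriv 2 g u / 4)
      + (deriv g u * iteratedDeriv 2 g u / 4) ^ 2

lemma integral_lead_sq (alg : Algorithm) (g : ℝ → ℝ) (u : ℝ) :
    ∫ z, lead alg g (u, z) ^ 2 ∂gaussianReal 0 1 = leadVar alg g u := by
  have h2 := integral_pow_two_gaussianReal
  have h4 := integral_pow_four_gaussianReal
  have h6 := integral_pow_six_gaussianReal
  have i2 := integrable_pow_gaussianReal 2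
  have i4 := integrable_pow_gaussianReal 4
  have i6 := integrable_pow_gaussianReal 6
  cases alg
  · have : ∀ z : ℝ, lead .RWM g (u, z) ^ 2 = deriv g u ^ 2 * z ^ 2 := fun z => by
      simp only [lead]; ring
    simp only [this, integral_const_mul, h2, leadVar, mul_one]
  · set a := iteratedDeriv 3 g u / 12 with ha
    set b := deriv g u * iteratedDeriv 2 g u / 4 with hb
    have : ∀ z : ℝ, lead .SLA g (u, z) ^ 2 = (a ^ 2 * z ^ 6 - 2 * a * b * z ^ 4) + b ^ 2 * z ^ 2 :=
      fun z => by simp only [lead, ha, hb]; ring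
    simp only [this, leadVar, ← ha, ← hb]
    rw [integral_add (f := fun z => a ^ 2 * z ^ 6 - 2 * a * b * z ^ 4)
      ((i6.const_mul _).sub (i4.const_mul _)) (i2.const_mul _), integral_sub (i6.const_mul _) (i4.const_mul _)]
    simp only [integral_const_mul, h2, h4, h6]
    ring

lemma leadVar_nonneg (alg : Algorithm) (g : ℝ → ℝ) (u : ℝ) : 0 ≤ leadVar alg g u := by
  rw [← integral_lead_sq]
  exact integral_nonneg fun _ => sq_nonneg _

lemma continuous_leadVar {g : ℝ → ℝ} (hg : SmoothPolyGrowth g) (alg : Algorithm) :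
    Continuous (leadVar alg g) := by
  have h1 := hg.deriv.continuous
  have h2 := (hg.iteratedDeriv 2).continuous
  have h3 := (hg.iteratedDeriv 3).continuous
  cases alg
  · exact h1.pow 2
  · unfold leadVar
    fun_prop

lemma polyBound_leadVar {g : ℝ → ℝ} (hg : SmoothPolyGrowth g) (alg : Algorithm) :
    PolyBound fun _ p => leadVar alg g p.1 := by
  have h1 := PolyBound.fst.comp hg.deriv.polyGrowth
  cases alg
  · exact h1.pow 2
  · have h2 := PolyBound.fst.comp (hg.growth 2)
    have h3 := PolyBound.fst.comp (hg.growth 3)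
    refine ((((h3.pow 2).mul (PolyBound.const (15 / 144))).sub
      ((h3.mul (h1.mul h2)).mul (PolyBound.const (1 / 8)))).add
      (((h1.mul h2).pow 2).mul (PolyBound.const (1 / 16)))).congr fun _ _ _ => ?_
    simp only [leadVar]
    ring

lemma PolyGrowth.integrable {g : ℝ → ℝ} (hg : IsRegularLogDensity g) {f : ℝ → ℝ}
    (hf : PolyGrowth f) (hc : Continuous f) : Integrable f (marginal g) := by
  obtain ⟨A, N, -, h⟩ := hf
  have := isProbabilityMeasure_marginal hg
  have h1 := integrable_one_add_abs_pow (μ := marginal g) (fun k =>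
    (integrable_marginal_iff hg.smooth.continuous _).2 (hg.moments k)) N
  exact (h1.const_mul A).mono' hc.aestronglyMeasurable (ae_of_all _ h)

lemma polyGrowth_of_polyBound {f : ℝ → ℝ} (hf : PolyBound fun _ p => f p.1) : PolyGrowth f := by
  obtain ⟨A, N, hA, h⟩ := hf
  refine ⟨A, N, hA, fun u => ?_⟩
  simpa [weight] using h 1 ⟨one_pos, le_rfl⟩ (u, 0)

/-- Integration by parts against `exp (-g)`. -/
lemma integral_deriv_marginal {g G G' : ℝ → ℝ} (hg : IsRegularLogDensity g)
    (hG : ∀ u, HasDerivAt G (G' u) u) (hG' : Continuous G')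
    (hp : PolyBound fun _ p => G p.1) (hp' : PolyBound fun _ p => G' p.1) :
    ∫ u, (G' u - deriv g u * G u) ∂marginal g = 0 := by
  have hs := hg.smoothPolyGrowth
  have hGc : Continuous G := continuous_iff_continuousAt.2 fun u => (hG u).continuousAt
  have hc := hs.deriv.continuous
  rw [integral_marginal hs.continuous]
  refine integral_eq_zero_of_hasDerivAt_of_integrable (f := fun u => G u * Real.exp (-g u))
    (fun u => ?_) ?_ ?_
  · refine ((hG u).mul (hs.hasDerivAt u).fun_neg.exp).congr_deriv ?_
    ring
  · rw [← integrable_marginal_iff hs.continuous]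
    exact PolyGrowth.integrable hg (polyGrowth_of_polyBound
      (hp'.sub ((PolyBound.fst.comp hs.deriv.polyGrowth).mul hp))) (by fun_prop)
  · rw [← integrable_marginal_iff hs.continuous]
    exact PolyGrowth.integrable hg (polyGrowth_of_polyBound hp) hGc

lemma hasDerivAt_iteratedDeriv {g : ℝ → ℝ} (hg : SmoothPolyGrowth g) (k : ℕ) (u : ℝ) :
    HasDerivAt (iteratedDeriv k g) (iteratedDeriv (k + 1) g u) u := by
  rw [iteratedDeriv_succ]
  exact (hg.iteratedDeriv k).hasDerivAt u

/-- For SLA the conditional variance differs from the integrand of `K` by `-1/16` times `G' - g' G`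
with `G = g' * g'' ^ 2`, and this integrates to zero against `exp (-g)`. -/
lemma integral_leadVar {g : ℝ → ℝ} (hg : IsRegularLogDensity g) (alg : Algorithm) :
    ∫ u, leadVar alg g u ∂marginal g = constK alg g := by
  have hs := hg.smoothPolyGrowth
  cases alg
  · rw [integral_marginal hs.continuous]
    rfl
  · have b1 := PolyBound.fst.comp hs.deriv.polyGrowth
    have b2 := PolyBound.fst.comp (hs.growth 2)
    have b3 := PolyBound.fst.comp (hs.growth 3)
    have c1 := hs.deriv.continuous
    have c2 := (hs.iteratedDeriv 2).continuous
    have c3 := (hs.iteratedDeriv 3).continuous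
    have d1 : ∀ u, HasDerivAt (deriv g) (iteratedDeriv 2 g u) u := fun u => by
      simpa only [iteratedDeriv_one] using hasDerivAt_iteratedDeriv hs 1 u
    have d2 := hasDerivAt_iteratedDeriv hs 2
    have key := integral_deriv_marginal hg (G := fun u => deriv g u * iteratedDeriv 2 g u ^ 2)
      (fun u => (d1 u).mul ((d2 u).fun_pow 2)) (by fun_prop) (b1.mul (b2.pow 2))
      (((b2.mul (b2.pow 2)).add ((b1.mul (b2.mul b3)).mul (PolyBound.const 2))).congr
        fun _ _ _ => by push_cast; ring)
    have i1 : Integrable (fun u => (3 * iteratedDeriv 2 g u ^ 3 + 5 * iteratedDeriv 3 g u ^ 2) / 48)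
        (marginal g) := by
      refine PolyGrowth.integrable hg (polyGrowth_of_polyBound
        ((((PolyBound.const 3).mul (b2.pow 3)).add ((PolyBound.const 5).mul (b3.pow 2))).mul
          (PolyBound.const (1 / 48)) |>.congr fun _ _ _ => ?_)) (by fun_prop)
      ring
    have i2 := PolyGrowth.integrable hg (polyGrowth_of_polyBound (polyBound_leadVar hs .SLA))
      (continuous_leadVar hs .SLA)
    have e1 : constK .SLA g =
        ∫ u, (3 * iteratedDeriv 2 g u ^ 3 + 5 * iteratedDeriv 3 g u ^ 2) / 48 ∂marginal g := by
      rw [integral_div, integral_marginal hs.continuous]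
      rfl
    rw [e1, ← sub_eq_zero, ← integral_sub i2 i1]
    rw [← mul_zero (-(1 / 16) : ℝ), ← key, ← integral_const_mul]
    refine integral_congr_ae (ae_of_all _ fun u => ?_)
    simp only [leadVar]
    push_cast
    ring

/-- If `g''` vanished, `g'` would be constant, and that constant is zero because the mean of `g'` is
zero. Then `exp (-g)` would be a positive constant, which is not integrable on the line. -/
lemma deriv_two_ne_zero {g : ℝ → ℝ} (hg : IsRegularLogDensity g) :
    ¬ ∀ u, iteratedDeriv 2 g u = 0 := by
  intro h
  have hs := hg.smoothPolyGrowth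
  have := isProbabilityMeasure_marginal hg
  have d1 : ∀ u, HasDerivAt (deriv g) (iteratedDeriv 2 g u) u := fun u => by
    simpa only [iteratedDeriv_one] using hasDerivAt_iteratedDeriv hs 1 u
  have c1 : ∀ u, deriv g u = deriv g 0 := fun u =>
    is_const_of_deriv_eq_zero (fun u => (d1 u).differentiableAt)
      (fun u => (d1 u).deriv.trans (h u)) u 0
  have key := integral_deriv_marginal hg (G := fun _ => 1) (G' := fun _ => 0)
    (fun u => hasDerivAt_const u 1) continuous_const (PolyBound.const 1) (PolyBound.const 0)
  simp only [c1, mul_one, zero_sub, integral_const, probReal_univ, one_smul, neg_eq_zero] at key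
  have c0 : ∀ u, g u = g 0 := fun u =>
    is_const_of_deriv_eq_zero hs.differentiable (fun u => (c1 u).trans key) u 0
  have hi := integrable_exp_neg hg
  simp only [c0] at hi
  rw [integrable_const_iff] at hi
  rcases hi with hi | hi
  · exact (Real.exp_pos _).ne' hi
  · have := hi.measure_univ_lt_top
    simp at this

/-- The conditional variance is continuous and nonnegative, so its integral is positive unless it
vanishes identically; in that case `g''` vanishes too, which `deriv_two_ne_zero` excludes. -/
lemma constK_pos {g : ℝ → ℝ} (hg : IsRegularLogDensity g) (alg : Algorithm) :
    0 < constK alg g := by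
  have hs := hg.smoothPolyGrowth
  have hc := continuous_leadVar hs alg
  rw [← integral_leadVar hg alg, integral_marginal hs.continuous]
  have hge := hs.continuous
  have hi : Integrable fun u => leadVar alg g u * Real.exp (-g u) :=
    (integrable_marginal_iff hge _).1
      (PolyGrowth.integrable hg (polyGrowth_of_polyBound (polyBound_leadVar hs alg)) hc)
  by_cases h : ∃ u, leadVar alg g u ≠ 0
  · obtain ⟨u, hu⟩ := h
    exact integral_pos_of_integrable_nonneg_nonzero (x := u) (by fun_prop) hi
      (fun u => mul_nonneg (leadVar_nonneg alg g u) (Real.exp_pos _).le)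
      (mul_ne_zero hu (Real.exp_pos _).ne')
  push Not at h
  refine absurd (fun u => ?_) (deriv_two_ne_zero hg)
  have hzero : (∀ u, deriv g u = 0) → iteratedDeriv 2 g u = 0 := fun h1 => by
    rw [iteratedDeriv_succ', iteratedDeriv_one, (funext h1 : deriv g = fun _ => 0)]
    simp
  cases alg
  · exact hzero fun u => by simpa [leadVar] using h u
  · have h3 : ∀ u, iteratedDeriv 3 g u = 0 := fun u => by
      have := h u
      simp only [leadVar] at this
      -- With `a = g''' / 12` and `b = g' g'' / 4` the conditional variance is `(3a - b)² + 6a²`, so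
      -- its vanishing forces `a = 0`.
      nlinarith [sq_nonneg (3 * (iteratedDeriv 3 g u / 12) - deriv g u * iteratedDeriv 2 g u / 4)]
    have h12 : ∀ u, deriv g u * iteratedDeriv 2 g u = 0 := fun u => by
      have := h u
      simp only [leadVar, h3 u] at this
      nlinarith
    have h2 : ∀ v, iteratedDeriv 2 g v = iteratedDeriv 2 g u := fun v =>
      is_const_of_deriv_eq_zero (hs.iteratedDeriv 2).differentiable
        (fun v => by rw [← iteratedDeriv_succ]; exact h3 v) v u
    -- Here `g''` is constant; were it nonzero, `g' g'' = 0` would make `g'` vanish, and `g''` with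
    -- it.
    by_contra hne
    exact hne (hzero fun v => by
      have := h12 v
      rw [h2 v] at this
      exact (mul_eq_zero.1 this).resolve_right hne)

/-! ### Estimates for a single increment -/

lemma integrable_lead_pow {g : ℝ → ℝ} (hg : IsRegularLogDensity g) (alg : Algorithm) (k : ℕ) :
    Integrable (fun p => lead alg g p ^ k) (pairLaw g) := by
  have hs := hg.smoothPolyGrowth
  exact ((polyBound_lead hs alg).pow k).integrable hg (ε := 1) ⟨one_pos, le_rfl⟩
    ((continuous_lead hs alg).pow k).aestronglyMeasurable

lemma integral_lead_pairLaw {g : ℝ → ℝ} (hg : IsRegularLogDensity g) (alg : Algorithm) :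
    ∫ p, lead alg g p ∂pairLaw g = 0 := by
  have := isProbabilityMeasure_marginal hg
  rw [pairLaw, integral_prod _ (by simpa [pairLaw] using integrable_lead_pow hg alg 1)]
  simp only [integral_lead, integral_zero]

lemma integral_lead_sq_pairLaw {g : ℝ → ℝ} (hg : IsRegularLogDensity g) (alg : Algorithm) :
    ∫ p, lead alg g p ^ 2 ∂pairLaw g = constK alg g := by
  have := isProbabilityMeasure_marginal hg
  rw [pairLaw, integral_prod _ (by simpa only [pairLaw] using integrable_lead_pow hg alg 2)]
  simp only [integral_lead_sq, integral_leadVar hg]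

lemma polyBound_incr {g : ℝ → ℝ} (hg : SmoothPolyGrowth g) (alg : Algorithm) :
    ∃ H : ℝ → ℝ × ℝ → ℝ, PolyBound H ∧ ∀ ε ∈ Set.Ioc (0 : ℝ) 1, ∀ p,
      incr alg g ε p = ε ^ alg.order * H ε p := by
  obtain ⟨Q, hQ, h⟩ := exists_incr_sub_lead_le hg alg
  refine ⟨_, (polyBound_lead hg alg).add (PolyBound.eps.mul hQ), fun ε hε p => ?_⟩
  rw [h ε hε p]
  ring

lemma integrable_incr_pow {g : ℝ → ℝ} (hg : IsRegularLogDensity g) (alg : Algorithm) (k : ℕ)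
    {ε : ℝ} (hε : ε ∈ Set.Ioc (0 : ℝ) 1) : Integrable (fun p => incr alg g ε p ^ k) (pairLaw g) := by
  have hs := hg.smoothPolyGrowth
  obtain ⟨H, hH, h⟩ := polyBound_incr hs alg
  have hb : PolyBound (incr alg g) := ((PolyBound.eps.pow _).mul hH).congr h
  exact (hb.pow k).integrable hg hε ((continuous_incr hs alg ε).pow k).aestronglyMeasurable

lemma exists_integral_incr_sub_lead_sq_le {g : ℝ → ℝ} (hg : IsRegularLogDensity g)
    (alg : Algorithm) : ∃ c : ℝ, 0 ≤ c ∧ ∀ ε ∈ Set.Ioc (0 : ℝ) 1,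
      ∫ p, (incr alg g ε p - ε ^ alg.order * lead alg g p) ^ 2 ∂pairLaw g ≤
        c * ε ^ (2 * alg.order + 1) := by
  obtain ⟨Q, hQ, h⟩ := exists_incr_sub_lead_le hg.smoothPolyGrowth alg
  obtain ⟨c, hc, hQ2⟩ := (hQ.pow 2).exists_integral_abs_le hg
  refine ⟨c, hc, fun ε hε => ?_⟩
  have h1 : ∀ p, (incr alg g ε p - ε ^ alg.order * lead alg g p) ^ 2 =
      ε ^ (2 * alg.order + 2) * |Q ε p ^ 2| := fun p => by
    rw [h ε hε p, abs_of_nonneg (sq_nonneg _)]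
    ring
  simp only [h1, integral_const_mul]
  calc ε ^ (2 * alg.order + 2) * ∫ p, |Q ε p ^ 2| ∂pairLaw g
      ≤ ε ^ (2 * alg.order + 2) * c := by
        have := hε.1
        gcongr
        exact hQ2 ε hε
    _ ≤ ε ^ (2 * alg.order + 1) * c := by
        gcongr ?_ * c
        exact pow_le_pow_of_le_one hε.1.le hε.2 (by omega)
    _ = _ := mul_comm _ _

lemma exists_integral_incr_sq_sub_le {g : ℝ → ℝ} (hg : IsRegularLogDensity g)
    (alg : Algorithm) : ∃ c : ℝ, 0 ≤ c ∧ ∀ ε ∈ Set.Ioc (0 : ℝ) 1,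
      |∫ p, incr alg g ε p ^ 2 ∂pairLaw g - ε ^ (2 * alg.order) * constK alg g| ≤
        c * ε ^ (2 * alg.order + 1) := by
  have hs := hg.smoothPolyGrowth
  obtain ⟨Q, hQ, h⟩ := exists_incr_sub_lead_le hs alg
  obtain ⟨c, hc, hc'⟩ := (((PolyBound.const 2).mul ((polyBound_lead hs alg).mul hQ)).add
    (PolyBound.eps.mul (hQ.pow 2))).exists_integral_abs_le hg
  refine ⟨c, hc, fun ε hε => ?_⟩
  have hε0 := hε.1
  rw [← integral_lead_sq_pairLaw hg alg, ← integral_const_mul,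
    ← integral_sub (integrable_incr_pow hg alg 2 hε) ((integrable_lead_pow hg alg 2).const_mul _)]
  calc |∫ p, (incr alg g ε p ^ 2 - ε ^ (2 * alg.order) * lead alg g p ^ 2) ∂pairLaw g|
      ≤ ∫ p, |incr alg g ε p ^ 2 - ε ^ (2 * alg.order) * lead alg g p ^ 2| ∂pairLaw g :=
        abs_integral_le_integral_abs
    _ = ∫ p, ε ^ (2 * alg.order + 1) *
          |2 * (lead alg g p * Q ε p) + ε * Q ε p ^ 2| ∂pairLaw g := by
        refine integral_congr_ae (ae_of_all _ fun p => ?_)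
        simp only
        rw [← abs_of_pos (pow_pos hε0 (2 * alg.order + 1)), ← abs_mul, h ε hε p]
        ring_nf
    _ ≤ ε ^ (2 * alg.order + 1) * c := by
        rw [integral_const_mul]
        gcongr
        exact hc' ε hε
    _ = _ := mul_comm _ _

lemma exists_integral_incr_cube_le {g : ℝ → ℝ} (hg : IsRegularLogDensity g)
    (alg : Algorithm) : ∃ c : ℝ, 0 ≤ c ∧ ∀ ε ∈ Set.Ioc (0 : ℝ) 1,
      ∫ p, |incr alg g ε p| ^ 3 ∂pairLaw g ≤ c * ε ^ (2 * alg.order + 1) := by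
  have hs := hg.smoothPolyGrowth
  obtain ⟨H, hH, h⟩ := polyBound_incr hs alg
  obtain ⟨c, hc, hc'⟩ := (hH.pow 3).exists_integral_abs_le hg
  refine ⟨c, hc, fun ε hε => ?_⟩
  have hε0 := hε.1
  have h1 : ∀ p, |incr alg g ε p| ^ 3 = ε ^ (3 * alg.order) * |H ε p ^ 3| := fun p => by
    rw [h ε hε p, abs_mul, abs_of_pos (pow_pos hε0 _), abs_pow]
    ring
  simp only [h1, integral_const_mul]
  calc ε ^ (3 * alg.order) * ∫ p, |H ε p ^ 3| ∂pairLaw g ≤ ε ^ (3 * alg.order) * c := by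
        gcongr
        exact hc' ε hε
    _ ≤ ε ^ (2 * alg.order + 1) * c := by
        gcongr ?_ * c
        have := alg.order_pos
        exact pow_le_pow_of_le_one hε.1.le hε.2 (by omega)
    _ = _ := mul_comm _ _

/-- The first term is `t + t * tanh (t / 2)`, and `tanh (t / 2)` is `t / 2` up to a quadratic error:
by Taylor bounds when `|t| ≤ 1`, and because `tanh` is bounded otherwise. This turns the
reversibility identity into a relation between the first two moments. -/
lemma abs_sigmoid_sub_le (t : ℝ) :
    |2 * (t * Real.exp t / (1 + Real.exp t)) - t - t ^ 2 / 2| ≤ 2 * |t| ^ 3 := by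
  have he := Real.exp_pos t
  have h1 : 2 * (t * Real.exp t / (1 + Real.exp t)) - t - t ^ 2 / 2 =
      t * ((Real.exp t - 1) / (1 + Real.exp t) - t / 2) := by
    field_simp
    ring
  rw [h1, abs_mul]
  suffices h : |(Real.exp t - 1) / (1 + Real.exp t) - t / 2| ≤ 2 * t ^ 2 by
    calc |t| * |(Real.exp t - 1) / (1 + Real.exp t) - t / 2| ≤ |t| * (2 * t ^ 2) := by gcongr
      _ = _ := by rw [← sq_abs t]; ring
  rcases le_total |t| 1 with ht | ht
  · have h2 : (Real.exp t - 1) / (1 + Real.exp t) - t / 2 =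
        ((Real.exp t - 1 - t) - t / 2 * (Real.exp t - 1)) / (1 + Real.exp t) := by
      field_simp
      ring
    have h3 := Real.abs_exp_sub_one_sub_id_le ht
    have h4 := Real.abs_exp_sub_one_le ht
    rw [h2, abs_div, abs_of_pos (by positivity : 0 < 1 + Real.exp t), div_le_iff₀ (by positivity)]
    calc |Real.exp t - 1 - t - t / 2 * (Real.exp t - 1)|
        ≤ |Real.exp t - 1 - t| + |t / 2 * (Real.exp t - 1)| := abs_sub _ _
      _ ≤ t ^ 2 + |t| / 2 * (2 * |t|) := by
          rw [abs_mul, abs_div, abs_two]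
          gcongr
      _ = 2 * t ^ 2 := by rw [← sq_abs t]; ring
      _ ≤ 2 * t ^ 2 * (1 + Real.exp t) := le_mul_of_one_le_right (by positivity) (by linarith)
  · have h2 : |(Real.exp t - 1) / (1 + Real.exp t)| ≤ 1 := by
      rw [abs_div, abs_of_pos (by positivity : 0 < 1 + Real.exp t), div_le_one (by positivity),
        abs_le]
      constructor <;> linarith
    calc |(Real.exp t - 1) / (1 + Real.exp t) - t / 2|
        ≤ |(Real.exp t - 1) / (1 + Real.exp t)| + |t / 2| := abs_sub _ _
      _ ≤ 1 + |t| / 2 := by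
          rw [abs_div t, abs_two]
          gcongr
      _ ≤ 2 * t ^ 2 := by
          rw [← sq_abs t]
          nlinarith

/-- In stationarity, the mean of an increment is minus half its second moment, up to a term of
higher order. -/
lemma exists_integral_incr_add_le {g : ℝ → ℝ} (hg : IsRegularLogDensity g)
    (alg : Algorithm) : ∃ c : ℝ, 0 ≤ c ∧ ∀ ε ∈ Set.Ioc (0 : ℝ) 1,
      |∫ p, incr alg g ε p ∂pairLaw g + ε ^ (2 * alg.order) * (constK alg g / 2)| ≤
        c * ε ^ (2 * alg.order + 1) := by
  obtain ⟨c₁, hc₁, h₁⟩ := exists_integral_incr_sq_sub_le hg alg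
  obtain ⟨c₂, hc₂, h₂⟩ := exists_integral_incr_cube_le hg alg
  refine ⟨2 * c₂ + c₁ / 2, by positivity, fun ε hε => ?_⟩
  have hs := hg.smoothPolyGrowth
  have hc := continuous_incr hs alg ε
  have i1 : Integrable (fun p => incr alg g ε p) (pairLaw g) := by
    simpa using integrable_incr_pow hg alg 1 hε
  have i2 := integrable_incr_pow hg alg 2 hε
  have i3 : Integrable (fun p => |incr alg g ε p| ^ 3) (pairLaw g) := by
    simpa only [abs_pow] using (integrable_incr_pow hg alg 3 hε).abs
  have iF : Integrable (fun p => incr alg g ε p * Real.exp (incr alg g ε p) /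
      (1 + Real.exp (incr alg g ε p))) (pairLaw g) := by
    refine i1.mono (Continuous.aestronglyMeasurable ?_) (ae_of_all _ fun p => ?_)
    · exact (hc.mul hc.rexp).div (by fun_prop) fun p => by positivity
    · have := Real.exp_pos (incr alg g ε p)
      rw [mul_div_assoc, norm_mul, Real.norm_of_nonneg (r := _ / _) (by positivity)]
      refine mul_le_of_le_one_right (norm_nonneg _) ?_
      rw [div_le_one (by positivity)]
      linarith
  -- Reversibility removes the logistic term, so the last integral is minus the mean minus half the
  -- second moment; it is of third order.
  have key : ∫ p, incr alg g ε p ∂pairLaw g = -(∫ p, incr alg g ε p ^ 2 ∂pairLaw g) / 2 -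
      ∫ p, (2 * (incr alg g ε p * Real.exp (incr alg g ε p) / (1 + Real.exp (incr alg g ε p))) -
        incr alg g ε p - incr alg g ε p ^ 2 / 2) ∂pairLaw g := by
    have iF1 : Integrable (fun p => 2 * (incr alg g ε p * Real.exp (incr alg g ε p) /
        (1 + Real.exp (incr alg g ε p))) - incr alg g ε p) (pairLaw g) := (iF.const_mul 2).sub i1
    rw [integral_sub iF1 (i2.div_const 2), integral_sub (iF.const_mul 2) i1, integral_const_mul, integral_incr_mul_sigmoid hg alg hε.1, integral_div]
    ring
  have hb : |∫ p, (2 * (incr alg g ε p * Real.exp (incr alg g ε p) /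
      (1 + Real.exp (incr alg g ε p))) - incr alg g ε p - incr alg g ε p ^ 2 / 2) ∂pairLaw g| ≤
      2 * (c₂ * ε ^ (2 * alg.order + 1)) := by
    refine abs_integral_le_integral_abs.trans ?_
    calc _ ≤ ∫ p, 2 * |incr alg g ε p| ^ 3 ∂pairLaw g :=
          integral_mono_of_nonneg (ae_of_all _ fun _ => abs_nonneg _) (i3.const_mul 2)
            (ae_of_all _ fun p => abs_sigmoid_sub_le _)
      _ ≤ _ := by
          rw [integral_const_mul]
          gcongr
          exact h₂ ε hε
  have h₃ := abs_le.1 (h₁ ε hε)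
  have h₄ := abs_le.1 hb
  rw [key, abs_le]
  constructor <;> linarith [h₃.1, h₃.2, h₄.1, h₄.2]

lemma integrable_exp_half_incr {g : ℝ → ℝ} (hg : IsRegularLogDensity g) (alg : Algorithm) {ε : ℝ}
    (hε : 0 < ε) : Integrable (fun p => Real.exp (incr alg g ε p / 2)) (pairLaw g) := by
  have := isProbabilityMeasure_pairLaw hg
  have hc := continuous_incr hg.smoothPolyGrowth alg ε
  refine ((integrable_const 1).add (integrable_exp_incr hg alg hε)).mono' (by fun_prop)
    (ae_of_all _ fun p => ?_)
  have h1 : Real.exp (incr alg g ε p) = Real.exp (incr alg g ε p / 2) ^ 2 := by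
    rw [← Real.exp_nat_mul]
    ring_nf
  rw [Real.norm_of_nonneg (Real.exp_pos _).le, Pi.add_apply, h1]
  nlinarith [sq_nonneg (Real.exp (incr alg g ε p / 2) - 1)]

/-- With `r = |t| / 2`, both signs of `t` give `|1 - exp (t / 2)| ≥ r / (1 + r)`, and `(1 - |t|) *
(1 + |t| / 2) ^ 2 ≤ 1`. -/
lemma sq_mul_one_sub_le (t : ℝ) : (t ^ 2 - |t| ^ 3) / 4 ≤ (1 - Real.exp (t / 2)) ^ 2 := by
  have h1 : ∀ r : ℝ, 0 ≤ r → r / (1 + r) ≤ 1 - Real.exp (-r) := fun r hr => by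
    have h2 := Real.add_one_le_exp r
    have h3 : Real.exp (-r) ≤ 1 / (1 + r) := by
      rw [Real.exp_neg, ← one_div]
      exact one_div_le_one_div_of_le (by positivity) (by linarith)
    have h4 : r / (1 + r) = 1 - 1 / (1 + r) := by field_simp; ring
    linarith
  have h2 : |t| / 2 / (1 + |t| / 2) ≤ |1 - Real.exp (t / 2)| := by
    have hp : (0 : ℝ) ≤ |t| / 2 := by positivity
    rcases le_total 0 t with ht | ht
    · rw [abs_of_nonneg ht] at hp ⊢
      rw [abs_sub_comm]
      refine le_trans ?_ (le_abs_self _)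
      refine (div_le_self hp (by linarith)).trans ?_
      linarith [Real.add_one_le_exp (t / 2)]
    · rw [abs_of_nonpos ht] at hp ⊢
      refine le_trans (h1 _ hp) (le_trans (le_of_eq ?_) (le_abs_self _))
      ring_nf
  have h3 : (|t| / 2 / (1 + |t| / 2)) ^ 2 ≤ (1 - Real.exp (t / 2)) ^ 2 := by
    rw [← sq_abs (1 - _)]
    gcongr
  refine le_trans ?_ h3
  rw [div_pow, le_div_iff₀ (by positivity), ← sq_abs t]
  have : 0 ≤ |t| := abs_nonneg t
  nlinarith [pow_nonneg this 3, pow_nonneg this 4, pow_nonneg this 5, pow_nonneg this 2]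

/-- The Hellinger affinity of a one-dimensional step. -/
lemma exists_integral_exp_half_incr_le {g : ℝ → ℝ} (hg : IsRegularLogDensity g)
    (alg : Algorithm) : ∃ c : ℝ, 0 ≤ c ∧ ∀ ε ∈ Set.Ioc (0 : ℝ) 1,
      ∫ p, Real.exp (incr alg g ε p / 2) ∂pairLaw g ≤
        1 - ε ^ (2 * alg.order) * (constK alg g / 8) + c * ε ^ (2 * alg.order + 1) := by
  have := isProbabilityMeasure_pairLaw hg
  obtain ⟨c₁, hc₁, h₁⟩ := exists_integral_incr_sq_sub_le hg alg
  obtain ⟨c₂, hc₂, h₂⟩ := exists_integral_incr_cube_le hg alg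
  refine ⟨(c₁ + c₂) / 8, by positivity, fun ε hε => ?_⟩
  have i1 := integrable_exp_half_incr hg alg hε.1
  have i2 := integrable_exp_incr hg alg hε.1
  have i3 := integrable_incr_pow hg alg 2 hε
  have i4 : Integrable (fun p => |incr alg g ε p| ^ 3) (pairLaw g) := by
    simpa only [abs_pow] using (integrable_incr_pow hg alg 3 hε).abs
  have e1 : ∀ p, (1 - Real.exp (incr alg g ε p / 2)) ^ 2 =
      1 - 2 * Real.exp (incr alg g ε p / 2) + Real.exp (incr alg g ε p) := fun p => by
    have h1 : Real.exp (incr alg g ε p) = Real.exp (incr alg g ε p / 2) ^ 2 := by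
      rw [← Real.exp_nat_mul]
      ring_nf
    rw [h1]
    ring
  have i5 : Integrable (fun p => 1 - 2 * Real.exp (incr alg g ε p / 2)) (pairLaw g) :=
    (integrable_const 1).sub (i1.const_mul 2)
  -- Since `exp incr` has mean one, the affinity is one minus half of this squared Hellinger
  -- distance, so a lower bound on the distance suffices.
  have key : ∫ p, (1 - Real.exp (incr alg g ε p / 2)) ^ 2 ∂pairLaw g =
      2 - 2 * ∫ p, Real.exp (incr alg g ε p / 2) ∂pairLaw g := by
    simp only [e1]
    rw [integral_add i5 i2, integral_sub (integrable_const 1) (i1.const_mul 2), integral_const_mul,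
      integral_exp_incr hg alg hε.1, integral_const, probReal_univ, one_smul]
    ring
  have hlow : ∫ p, (incr alg g ε p ^ 2 - |incr alg g ε p| ^ 3) / 4 ∂pairLaw g ≤
      ∫ p, (1 - Real.exp (incr alg g ε p / 2)) ^ 2 ∂pairLaw g := by
    refine integral_mono ((i3.sub i4).div_const 4) ?_ fun p => sq_mul_one_sub_le _
    simp only [e1]
    exact i5.add i2
  rw [integral_div, integral_sub i3 i4, key] at hlow
  have h₃ := abs_le.1 (h₁ ε hε)
  have h₄ := h₂ ε hε
  linarith [h₃.1]

/-! ### Auxiliary facts on integrals -/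

/-- The Cauchy–Schwarz inequality. -/
lemma integral_abs_mul_le_sqrt {Ω : Type*} {mΩ : MeasurableSpace Ω} {P : Measure Ω} {f h : Ω → ℝ}
    (hf : MemLp f 2 P) (hh : MemLp h 2 P) :
    ∫ ω, |f ω * h ω| ∂P ≤ √(∫ ω, f ω ^ 2 ∂P) * √(∫ ω, h ω ^ 2 ∂P) := by
  have := integral_mul_norm_le_Lp_mul_Lq (μ := P) (f := f) (g := h) (p := 2) (q := 2)
    Real.HolderConjugate.two_two (by simpa using hf) (by simpa using hh)
  simpa [abs_mul, Real.sqrt_eq_rpow] using this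

lemma integral_abs_le_sqrt {Ω : Type*} {mΩ : MeasurableSpace Ω} {P : Measure Ω}
    [IsProbabilityMeasure P] {f : Ω → ℝ} (hf : MemLp f 2 P) :
    ∫ ω, |f ω| ∂P ≤ √(∫ ω, f ω ^ 2 ∂P) := by
  simpa using integral_abs_mul_le_sqrt hf (memLp_const (1 : ℝ))

/-! ### Second moments of sums of independent variables. -/

section SumOfIndependent

variable {E : Type*} {mE : MeasurableSpace E} {μ : Measure E} [IsProbabilityMeasure μ] {n : ℕ}
  {X : Fin n → E → ℝ}

lemma memLp_sum_comp_eval (hX : ∀ j, MemLp (X j) 2 μ) (a : ℝ) :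
    MemLp (fun ω : Fin n → E => ∑ j, X j (ω j) + a) 2 (Measure.pi fun _ => μ) :=
  (memLp_finsetSum _ fun j _ =>
    (hX j).comp_measurePreserving (measurePreserving_eval (fun _ => μ) j)).add (memLp_const a)

/-- The second moment of a shifted sum of independent random variables. -/
lemma integral_sum_add_sq_le (hX : ∀ j, MemLp (X j) 2 μ) (a : ℝ) :
    ∫ ω : Fin n → E, (∑ j, X j (ω j) + a) ^ 2 ∂(Measure.pi fun _ => μ) ≤
      (∑ j, ∫ p, X j p ∂μ + a) ^ 2 + ∑ j, ∫ p, X j p ^ 2 ∂μ := by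
  have h0 : MemLp (fun ω : Fin n → E => ∑ j, X j (ω j)) 2 (Measure.pi fun _ => μ) := by
    simpa using memLp_sum_comp_eval hX 0
  have hS := memLp_sum_comp_eval hX a
  have h1 := variance_eq_sub hS
  rw [variance_add_const h0.aestronglyMeasurable] at h1
  have h2 : Var[fun ω : Fin n → E => ∑ j, X j (ω j); Measure.pi fun _ => μ] =
      ∑ j, Var[X j; μ] := by
    rw [← variance_sum_pi hX]
    congr 1
    ext ω
    simp
  have h3 : ∀ j, Var[X j; μ] ≤ ∫ p, X j p ^ 2 ∂μ := fun j =>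
    variance_le_expectation_sq (hX j).aestronglyMeasurable
  have h4 : ∫ ω : Fin n → E, (∑ j, X j (ω j) + a) ∂(Measure.pi fun _ => μ) =
      ∑ j, ∫ p, X j p ∂μ + a := by
    rw [integral_add (h0.integrable (by norm_num)) (integrable_const _), integral_const,
      probReal_univ, one_smul, integral_finsetSum]
    · congr 1
      exact Finset.sum_congr rfl fun j _ => integral_comp_eval (hX j).aestronglyMeasurable
    · exact fun j _ => integrable_comp_eval ((hX j).integrable (by norm_num))
  have h5 := Finset.sum_le_sum fun j (_ : j ∈ Finset.univ) => h3 j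
  simp only [Pi.pow_apply] at h1
  rw [h2, h4] at h1
  linarith

end SumOfIndependent

/-- Telescoping: exchange one factor at a time, the remaining factors being of norm at most one. -/
lemma norm_prod_sub_prod_le {ι : Type*} (s : Finset ι) (a b : ι → ℂ) (ha : ∀ j ∈ s, ‖a j‖ ≤ 1)
    (hb : ∀ j ∈ s, ‖b j‖ ≤ 1) :
    ‖∏ j ∈ s, a j - ∏ j ∈ s, b j‖ ≤ ∑ j ∈ s, ‖a j - b j‖ := by
  classical
  induction s using Finset.induction_on with
  | empty => simp
  | insert j s hj ih =>
    rw [Finset.prod_insert hj, Finset.prod_insert hj, Finset.sum_insert hj]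
    have h1 := ih (fun k hk => ha k (Finset.mem_insert_of_mem hk))
      (fun k hk => hb k (Finset.mem_insert_of_mem hk))
    have h2 : ‖∏ k ∈ s, b k‖ ≤ 1 := by
      rw [norm_prod]
      exact Finset.prod_le_one (fun _ _ => norm_nonneg _)
        fun k hk => hb k (Finset.mem_insert_of_mem hk)
    have h3 : a j * ∏ k ∈ s, a k - b j * ∏ k ∈ s, b k =
        a j * (∏ k ∈ s, a k - ∏ k ∈ s, b k) + (a j - b j) * ∏ k ∈ s, b k := by ring
    rw [h3]
    refine (norm_add_le _ _).trans ?_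
    rw [norm_mul, norm_mul, add_comm]
    refine add_le_add (mul_le_of_le_one_right (norm_nonneg _) h2) ?_
    exact (mul_le_of_le_one_left (norm_nonneg _) (ha j (Finset.mem_insert_self _ _))).trans h1

/-- Taylor's formula covers `|θ| ≤ 1`; for larger `θ` each of the four terms is at most `|θ| ^ 3`.
-/
lemma norm_exp_mul_I_sub_le (θ : ℝ) :
    ‖Complex.exp (θ * Complex.I) - 1 - θ * Complex.I + θ ^ 2 / 2‖ ≤ 4 * |θ| ^ 3 := by
  have hn : ‖(θ : ℂ) * Complex.I‖ = |θ| := by simp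
  rcases le_total |θ| 1 with h | h
  · have h1 := Complex.exp_bound (x := θ * Complex.I) (by rwa [hn]) (n := 3) (by norm_num)
    have h2 : Complex.exp (θ * Complex.I) - ∑ m ∈ Finset.range 3,
        ((θ : ℂ) * Complex.I) ^ m / m.factorial =
        Complex.exp (θ * Complex.I) - 1 - θ * Complex.I + θ ^ 2 / 2 := by
      simp [Finset.sum_range_succ, mul_pow]
      ring
    rw [h2, hn] at h1
    refine h1.trans ?_
    rw [mul_comm]
    gcongr
    norm_num [Nat.factorial]
  · have h1 : ‖Complex.exp (θ * Complex.I)‖ = 1 := Complex.norm_exp_ofReal_mul_I θ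
    have h2 : ‖(θ : ℂ) ^ 2 / 2‖ = |θ| ^ 2 / 2 := by simp
    calc ‖Complex.exp (θ * Complex.I) - 1 - θ * Complex.I + θ ^ 2 / 2‖
        ≤ ‖Complex.exp (θ * Complex.I)‖ + ‖(1 : ℂ)‖ + ‖(θ : ℂ) * Complex.I‖ +
            ‖(θ : ℂ) ^ 2 / 2‖ :=
          (norm_add_le _ _).trans (add_le_add_left ((norm_sub_le _ _).trans
            (add_le_add_left (norm_sub_le _ _) _)) _)
      _ = 1 + 1 + |θ| + |θ| ^ 2 / 2 := by rw [h1, h2, hn, norm_one]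
      _ ≤ 4 * |θ| ^ 3 := by
          have h3 := pow_le_pow_right₀ h (show 0 ≤ 3 by norm_num)
          have h4 := pow_le_pow_right₀ h (show 1 ≤ 3 by norm_num)
          have h5 := pow_le_pow_right₀ h (show 2 ≤ 3 by norm_num)
          linarith

lemma abs_exp_neg_sub_le {s : ℝ} (hs : 0 ≤ s) : |Real.exp (-s) - 1 + s| ≤ s ^ 2 := by
  have h1 : 0 ≤ Real.exp (-s) - 1 + s := by linarith [Real.add_one_le_exp (-s)]
  rw [abs_of_nonneg h1]
  have h2 : Real.exp (-s) ≤ 1 / (1 + s) := by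
    rw [Real.exp_neg, ← one_div]
    exact one_div_le_one_div_of_le (by positivity) (by linarith [Real.add_one_le_exp s])
  have h3 : 1 / (1 + s) ≤ 1 - s + s ^ 2 := by
    rw [div_le_iff₀ (by positivity)]
    nlinarith [pow_nonneg hs 3]
  linarith

lemma abs_exp_neg_sub_exp_neg_le {a b : ℝ} (ha : 0 ≤ a) (hb : 0 ≤ b) :
    |Real.exp (-a) - Real.exp (-b)| ≤ |a - b| := by
  wlog h : a ≤ b generalizing a b
  · rw [abs_sub_comm, abs_sub_comm a]
    exact this hb ha (le_of_not_ge h)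
  have h1 : Real.exp (-b) ≤ Real.exp (-a) := Real.exp_le_exp.2 (by linarith)
  rw [abs_of_nonneg (by linarith), abs_sub_comm, abs_of_nonneg (by linarith)]
  have h2 : Real.exp (-b) = Real.exp (-a) * Real.exp (-(b - a)) := by
    rw [← Real.exp_add]; ring_nf
  have h3 := Real.add_one_le_exp (-(b - a))
  have h4 : Real.exp (-a) ≤ 1 := Real.exp_le_one_iff.2 (by linarith)
  have h5 := Real.exp_pos (-a)
  rw [h2]
  nlinarith

/-- The function `x ↦ min 1 (exp x)` is nonexpansive with values in `[0, 1]`. -/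
lemma abs_min_one_exp_sub_le (a b : ℝ) :
    |min 1 (Real.exp a) - min 1 (Real.exp b)| ≤ |a - b| := by
  have h : ∀ x : ℝ, min 1 (Real.exp x) = Real.exp (-(max 0 (-x))) := fun x => by
    rcases le_total 0 x with hx | hx
    · rw [min_eq_left (Real.one_le_exp hx), max_eq_left (by linarith)]
      simp
    · rw [min_eq_right (Real.exp_le_one_iff.2 hx), max_eq_right (by linarith), neg_neg]
  rw [h, h]
  refine (abs_exp_neg_sub_exp_neg_le (le_max_left _ _) (le_max_left _ _)).trans ?_
  refine (abs_max_sub_max_le_max 0 (-a) 0 (-b)).trans (le_of_eq ?_)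
  rw [sub_self, abs_zero, max_eq_right (abs_nonneg _), ← abs_neg]
  ring_nf

/-- The perturbation `d` enters truncated at `1`, because the change of `φ` will be small only in
probability, whereas `a - b` will be controlled in `L²`. -/
lemma abs_min_one_exp_add_sub_le (d a b : ℝ) :
    |min 1 (Real.exp (d + a)) - min 1 (Real.exp b)| ≤ min 1 |d| + |a - b| := by
  have h1 := abs_min_one_exp_sub_le (d + a) a
  have h2 := abs_min_one_exp_sub_le a b
  have h3 : |min 1 (Real.exp (d + a)) - min 1 (Real.exp a)| ≤ 1 := by
    have := Real.exp_pos (d + a)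
    have := Real.exp_pos a
    rw [abs_le]
    constructor <;> linarith [min_le_left 1 (Real.exp (d + a)), min_le_left 1 (Real.exp a),
      le_min zero_le_one (Real.exp_pos (d + a)).le, le_min zero_le_one (Real.exp_pos a).le]
  rw [add_sub_cancel_right] at h1
  calc _ ≤ |min 1 (Real.exp (d + a)) - min 1 (Real.exp a)| +
        |min 1 (Real.exp a) - min 1 (Real.exp b)| := abs_sub_le _ _ _
    _ ≤ _ := add_le_add (le_min h3 h1) h2

/-- Lévy's continuity theorem for laws given by densities. -/
lemma tendsto_integral_of_tendsto_charFun {Ω : ℕ → Type*} {mΩ : ∀ m, MeasurableSpace (Ω m)}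
    (P : ∀ m, Measure (Ω m)) (r X : ∀ m, Ω m → ℝ)
    (hr : ∀ m, Measurable (r m)) (hX : ∀ m, Measurable (X m)) (hr0 : ∀ m ω, 0 ≤ r m ω)
    (hri : ∀ m, Integrable (r m) (P m)) (hr1 : ∀ m, ∫ ω, r m ω ∂P m = 1)
    (μ : Measure ℝ) [IsProbabilityMeasure μ]
    (hlim : ∀ t : ℝ, Tendsto (fun m => ∫ ω, (r m ω : ℂ) * Complex.exp (t * X m ω * Complex.I) ∂P m)
      atTop (𝓝 (charFun μ t)))
    (h : BoundedContinuousFunction ℝ ℝ) :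
    Tendsto (fun m => ∫ ω, r m ω * h (X m ω) ∂P m) atTop (𝓝 (∫ x, h x ∂μ)) := by
  have hrm : ∀ m, Measurable fun ω => ENNReal.ofReal (r m ω) := fun m => (hr m).ennreal_ofReal
  -- The densities `r m` have mass one, so they define probability measures, and the hypothesis is
  -- convergence of the characteristic functions of `X m` under them.
  let Q : ∀ m, Measure (Ω m) := fun m => (P m).withDensity fun ω => ENNReal.ofReal (r m ω)
  have hQ : ∀ m, IsProbabilityMeasure (Q m) := fun m => by
    refine ⟨?_⟩
    rw [withDensity_apply _ MeasurableSet.univ, Measure.restrict_univ,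
      ← ofReal_integral_eq_lintegral_ofReal (hri m) (ae_of_all _ (hr0 m)), hr1,
      ENNReal.ofReal_one]
  have hM : ∀ m, IsProbabilityMeasure ((Q m).map (X m)) := fun m =>
    Measure.isProbabilityMeasure_map (hX m).aemeasurable
  have key := ProbabilityMeasure.tendsto_of_tendsto_charFun
    (μ := fun m => ⟨(Q m).map (X m), hM m⟩) (μ₀ := ⟨μ, inferInstance⟩) (fun t => by
      refine (hlim t).congr fun m => ?_
      rw [charFun_apply_real, ProbabilityMeasure.coe_mk, integral_map (hX m).aemeasurable
        (by fun_prop), integral_withDensity_eq_integral_toReal_smul (hrm m)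
        (ae_of_all _ fun _ => ENNReal.ofReal_lt_top)]
      refine integral_congr_ae (ae_of_all _ fun ω => ?_)
      simp only [ENNReal.toReal_ofReal (hr0 m ω), Complex.real_smul])
  refine (ProbabilityMeasure.tendsto_iff_forall_integral_tendsto.1 key h).congr fun m => ?_
  rw [ProbabilityMeasure.coe_mk, integral_map (hX m).aemeasurable
    h.continuous.aestronglyMeasurable, integral_withDensity_eq_integral_toReal_smul (hrm m)
    (ae_of_all _ fun _ => ENNReal.ofReal_lt_top)]
  refine integral_congr_ae (ae_of_all _ fun ω => ?_)
  simp only [ENNReal.toReal_ofReal (hr0 m ω), smul_eq_mul]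

/-- Fubini's theorem for a product of functions of pairs and a weight that depends on the first
components only. -/
lemma integral_mul_prod_pairs {𝕜 E F : Type*} [RCLike 𝕜] {mE : MeasurableSpace E}
    {mF : MeasurableSpace F} {ν : Measure E} {γ : Measure F} [IsProbabilityMeasure ν]
    [IsProbabilityMeasure γ] {n : ℕ} {f : Fin n → E × F → 𝕜}
    (hf : ∀ j, Integrable (f j) (ν.prod γ)) {w : (Fin n → E) → 𝕜} (hw : Measurable w) {W : ℝ}
    (hW : ∀ u, ‖w u‖ ≤ W) :
    ∫ ω : Fin n → E × F, w (fun j => (ω j).1) * ∏ j, f j (ω j) ∂(Measure.pi fun _ => ν.prod γ) =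
      ∫ u : Fin n → E, w u * ∏ j, ∫ z, f j (u j, z) ∂γ ∂(Measure.pi fun _ => ν) := by
  have hmp := measurePreserving_arrowProdEquivProdArrow E F (Fin n) (fun _ => ν) (fun _ => γ)
  have hi : Integrable (fun ω : Fin n → E × F => w (fun j => (ω j).1) * ∏ j, f j (ω j))
      (Measure.pi fun _ => ν.prod γ) :=
    (Integrable.fintype_prod hf).bdd_mul
      (hw.comp (by fun_prop : Measurable fun (ω : Fin n → E × F) j => (ω j).1)).aestronglyMeasurable
      (ae_of_all _ fun ω => hW _)
  have hi' : Integrable (fun q : (Fin n → E) × (Fin n → F) => w q.1 * ∏ j, f j (q.1 j, q.2 j))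
      ((Measure.pi fun _ => ν).prod (Measure.pi fun _ => γ)) :=
    (hmp.integrable_comp_emb (MeasurableEquiv.measurableEmbedding _)).1 hi
  have h1 := hmp.integral_comp' (g := fun q : (Fin n → E) × (Fin n → F) =>
    w q.1 * ∏ j, f j (q.1 j, q.2 j))
  refine Eq.trans h1 ?_
  rw [integral_prod _ hi']
  refine integral_congr_ae (ae_of_all _ fun u => ?_)
  simp only
  rw [integral_const_mul, integral_fintype_prod_eq_prod (f := fun j z => f j (u j, z))]

/-! ### Sums of increments in high dimension -/

/-- The law of `n` independent pairs of a position and a Gaussian increment. -/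
noncomputable def productLaw (g : ℝ → ℝ) (n : ℕ) : Measure (Fin n → ℝ × ℝ) :=
  Measure.pi fun _ => pairLaw g

lemma isProbabilityMeasure_productLaw {g : ℝ → ℝ} (hg : IsRegularLogDensity g) (n : ℕ) :
    IsProbabilityMeasure (productLaw g n) := by
  have := isProbabilityMeasure_pairLaw hg
  unfold productLaw
  infer_instance

/-- Step sizes for the coordinates that tend to `0` uniformly and whose powers of exponent `2 k`
have a converging sum. -/
structure StepSizes (k : ℕ) {N : ℕ → ℕ} (ε : (m : ℕ) → Fin (N m) → ℝ) (τ : ℝ) : Prop where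
  mem : ∀ m j, ε m j ∈ Set.Ioc (0 : ℝ) 1
  small : ∃ δ : ℕ → ℝ, Tendsto δ atTop (𝓝 0) ∧ ∀ m j, ε m j ≤ δ m
  sum : Tendsto (fun m => ∑ j, ε m j ^ (2 * k)) atTop (𝓝 τ)

namespace StepSizes

variable {k : ℕ} {N : ℕ → ℕ} {ε : (m : ℕ) → Fin (N m) → ℝ} {τ : ℝ}

lemma tendsto_sum_succ (h : StepSizes k ε τ) :
    Tendsto (fun m => ∑ j, ε m j ^ (2 * k + 1)) atTop (𝓝 0) := by
  obtain ⟨δ, hδ, hle⟩ := h.small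
  have h1 : Tendsto (fun m => δ m * ∑ j, ε m j ^ (2 * k)) atTop (𝓝 0) := by
    simpa using hδ.mul h.sum
  refine squeeze_zero (fun m => Finset.sum_nonneg fun j _ => pow_nonneg (h.mem m j).1.le _)
    (fun m => ?_) h1
  rw [Finset.mul_sum]
  refine Finset.sum_le_sum fun j _ => ?_
  rw [pow_succ, mul_comm]
  exact mul_le_mul_of_nonneg_right (hle m j) (pow_nonneg (h.mem m j).1.le _)

lemma tendsto_coord (h : StepSizes k ε τ) (i : ∀ m, Fin (N m)) :
    Tendsto (fun m => ε m (i m)) atTop (𝓝 0) := by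
  obtain ⟨δ, hδ, hle⟩ := h.small
  exact squeeze_zero (fun m => (h.mem m _).1.le) (fun m => hle m _) hδ

end StepSizes

lemma memLp_incr {g : ℝ → ℝ} (hg : IsRegularLogDensity g) (alg : Algorithm) {ε : ℝ}
    (hε : ε ∈ Set.Ioc (0 : ℝ) 1) : MemLp (incr alg g ε) 2 (pairLaw g) :=
  (memLp_two_iff_integrable_sq (continuous_incr hg.smoothPolyGrowth alg ε).aestronglyMeasurable).2
    (integrable_incr_pow hg alg 2 hε)

lemma memLp_lead {g : ℝ → ℝ} (hg : IsRegularLogDensity g) (alg : Algorithm) :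
    MemLp (lead alg g) 2 (pairLaw g) :=
  (memLp_two_iff_integrable_sq (continuous_lead hg.smoothPolyGrowth alg).aestronglyMeasurable).2
    (integrable_lead_pow hg alg 2)

/-! ### Convergence of the centring and of the conditional variance. -/

section Limits

variable {g : ℝ → ℝ} (hg : IsRegularLogDensity g) (alg : Algorithm) {N : ℕ → ℕ}
  {ε : (m : ℕ) → Fin (N m) → ℝ} {τ : ℝ} (hε : StepSizes alg.order ε τ)
include hg hε

/-- The sum of the increments is the sum of their leading terms, shifted by a constant, up to an
error that tends to `0` in `L²`. -/
lemma tendsto_integral_sum_incr_sub_lead :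
    Tendsto (fun m => ∫ ω, (∑ j, (incr alg g (ε m j) (ω j) -
      ε m j ^ alg.order * lead alg g (ω j)) + τ * constK alg g / 2) ^ 2 ∂productLaw g (N m))
      atTop (𝓝 0) := by
  have := isProbabilityMeasure_pairLaw hg
  obtain ⟨c₁, hc₁, h₁⟩ := exists_integral_incr_add_le hg alg
  obtain ⟨c₂, hc₂, h₂⟩ := exists_integral_incr_sub_lead_sq_le hg alg
  have hs := hε.tendsto_sum_succ
  have hK := constK_pos hg alg
  have hlim : Tendsto (fun m => (c₁ * ∑ j, ε m j ^ (2 * alg.order + 1) +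
      |τ - ∑ j, ε m j ^ (2 * alg.order)| * (constK alg g / 2)) ^ 2 +
      c₂ * ∑ j, ε m j ^ (2 * alg.order + 1)) atTop (𝓝 0) := by
    have h1 := ((tendsto_const_nhds (x := τ)).sub hε.sum).abs.mul_const (constK alg g / 2)
    simpa using (((hs.const_mul c₁).add h1).pow 2).add (hs.const_mul c₂)
  refine squeeze_zero (fun m => integral_nonneg fun _ => sq_nonneg _) (fun m => ?_) hlim
  have hX : ∀ j, MemLp (fun p => incr alg g (ε m j) p - ε m j ^ alg.order * lead alg g p) 2
      (pairLaw g) := fun j => (memLp_incr hg alg (hε.mem m j)).sub ((memLp_lead hg alg).const_mul _)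
  refine (integral_sum_add_sq_le hX _).trans ?_
  -- The leading term is centred, so subtracting it leaves the mean of the increment as it is.
  have hE : ∀ j, ∫ p, (incr alg g (ε m j) p - ε m j ^ alg.order * lead alg g p) ∂pairLaw g =
      ∫ p, incr alg g (ε m j) p ∂pairLaw g := fun j => by
    rw [integral_sub ((memLp_incr hg alg (hε.mem m j)).integrable (by norm_num))
      (((memLp_lead hg alg).const_mul _).integrable (by norm_num)), integral_const_mul,
      integral_lead_pairLaw hg, mul_zero, sub_zero]
  refine add_le_add (sq_le_sq' ?_ ?_) ?_
  rotate_left 2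
  · rw [Finset.mul_sum]
    exact Finset.sum_le_sum fun j _ => h₂ _ (hε.mem m j)
  -- Both one-sided bounds on the shifted mean come from the triangle inequality: the errors of the
  -- individual means, plus the distance of `∑ ε ^ (2k)` from `τ`, times `K / 2`.
  all_goals
    have h3 : |∑ j, (∫ p, incr alg g (ε m j) p ∂pairLaw g +
        ε m j ^ (2 * alg.order) * (constK alg g / 2))| ≤
        c₁ * ∑ j, ε m j ^ (2 * alg.order + 1) := by
      refine (Finset.abs_sum_le_sum_abs _ _).trans ?_
      rw [Finset.mul_sum]
      exact Finset.sum_le_sum fun j _ => h₁ _ (hε.mem m j)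
    rw [Finset.sum_add_distrib, ← Finset.sum_mul] at h3
    have h4 := abs_le.1 h3
    have h5 := abs_le.1 (le_refl |τ - ∑ j, ε m j ^ (2 * alg.order)|)
    simp only [hE]
    nlinarith [h4.1, h4.2, h5.1, h5.2]

/-- The law of large numbers for the conditional variance of the leading terms. -/
lemma tendsto_integral_abs_sum_leadVar :
    Tendsto (fun m => ∫ u : Fin (N m) → ℝ, |∑ j, ε m j ^ (2 * alg.order) * leadVar alg g (u j) -
      τ * constK alg g| ∂(Measure.pi fun _ => marginal g)) atTop (𝓝 0) := by
  have := isProbabilityMeasure_marginal hg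
  have hsm := hg.smoothPolyGrowth
  have hvc := continuous_leadVar hsm alg
  have hv1 : Integrable (leadVar alg g) (marginal g) :=
    PolyGrowth.integrable hg (polyGrowth_of_polyBound (polyBound_leadVar hsm alg)) hvc
  have hv : MemLp (leadVar alg g) 2 (marginal g) :=
    (memLp_two_iff_integrable_sq hvc.aestronglyMeasurable).2
      (PolyGrowth.integrable hg (polyGrowth_of_polyBound ((polyBound_leadVar hsm alg).pow 2))
        (hvc.pow 2))
  set c := ∫ u, leadVar alg g u ^ 2 ∂marginal g with hc
  have hc0 : 0 ≤ c := integral_nonneg fun _ => sq_nonneg _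
  have hs := hε.tendsto_sum_succ
  have hlim : Tendsto (fun m => √((((∑ j, ε m j ^ (2 * alg.order)) - τ) * constK alg g) ^ 2 +
      (∑ j, ε m j ^ (2 * alg.order + 1)) * c)) atTop (𝓝 0) := by
    have h := ((((hε.sum.sub_const τ).mul_const (constK alg g)).pow 2).add
      (hs.mul_const c)).sqrt
    simpa using h
  refine squeeze_zero (fun m => integral_nonneg fun _ => abs_nonneg _) (fun m => ?_) hlim
  have hX : ∀ j, MemLp (fun u => ε m j ^ (2 * alg.order) * leadVar alg g u) 2 (marginal g) :=
    fun j => hv.const_mul _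
  have h1 := integral_abs_le_sqrt (memLp_sum_comp_eval hX (-(τ * constK alg g)))
  simp only [← sub_eq_add_neg] at h1
  refine h1.trans (Real.sqrt_le_sqrt ?_)
  have h2 := integral_sum_add_sq_le hX (-(τ * constK alg g))
  simp only [← sub_eq_add_neg] at h2
  refine h2.trans (add_le_add (le_of_eq ?_) ?_)
  · simp only [integral_const_mul, integral_leadVar hg, ← Finset.sum_mul]
    ring
  · rw [Finset.sum_mul]
    refine Finset.sum_le_sum fun j _ => ?_
    simp only [mul_pow, integral_const_mul]
    gcongr ?_ * c
    -- The variance carries `ε ^ (4k)`, which is at most `ε ^ (2k + 1)` as `k ≥ 1`; those powers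
    -- have vanishing sum.
    rw [← pow_mul]
    have := alg.order_pos
    exact pow_le_pow_of_le_one (hε.mem m j).1.le (hε.mem m j).2 (by omega)

end Limits

/-! ### Characteristic functions of the leading terms -/

lemma PolyBound.integrable_section {F : ℝ → ℝ × ℝ → ℝ} (hF : PolyBound F) {ε : ℝ}
    (hε : ε ∈ Set.Ioc (0 : ℝ) 1) (hc : Continuous (F ε)) (u : ℝ) :
    Integrable (fun z => F ε (u, z)) (gaussianReal 0 1) := by
  obtain ⟨A, N, -, h⟩ := hF
  refine ((integrable_one_add_abs_pow integrable_pow_gaussianReal N).const_mul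
    (A * (1 + |u|) ^ N)).mono' (by fun_prop) (ae_of_all _ fun z => (h ε hε (u, z)).trans ?_)
  simp only [weight, mul_pow, mul_assoc]
  exact le_rfl

/-- The characteristic function of a scaled leading term given the position, for a weight `q` of
the Gaussian increment. -/
noncomputable def leadCharFun (alg : Algorithm) (g q : ℝ → ℝ) (a u : ℝ) : ℂ :=
  ∫ z, (q z : ℂ) * Complex.exp ((a * lead alg g (u, z) : ℝ) * Complex.I) ∂gaussianReal 0 1

section LeadCharFun

variable {g : ℝ → ℝ} (hg : IsRegularLogDensity g) (alg : Algorithm)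
include hg

lemma integrable_section_lead_pow (k : ℕ) (u : ℝ) :
    Integrable (fun z => lead alg g (u, z) ^ k) (gaussianReal 0 1) :=
  ((polyBound_lead hg.smoothPolyGrowth alg).pow k).integrable_section (ε := 1) ⟨one_pos, le_rfl⟩
    ((continuous_lead hg.smoothPolyGrowth alg).pow k) u

lemma integrable_mul_exp_lead {q : ℝ → ℝ} (hq : Integrable q (gaussianReal 0 1)) (a : ℝ) :
    Integrable (fun p : ℝ × ℝ => (q p.2 : ℂ) * Complex.exp ((a * lead alg g p : ℝ) * Complex.I))
      (pairLaw g) := by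
  have := isProbabilityMeasure_marginal hg
  have hc := continuous_lead hg.smoothPolyGrowth alg
  refine Integrable.mul_bdd (c := 1) (hq.comp_snd (marginal g)).ofReal (by fun_prop)
    (ae_of_all _ fun p => ?_)
  rw [Complex.norm_exp_ofReal_mul_I]

lemma integrable_section_mul_exp_lead {q : ℝ → ℝ} (hq : Integrable q (gaussianReal 0 1))
    (a u : ℝ) :
    Integrable (fun z => (q z : ℂ) * Complex.exp ((a * lead alg g (u, z) : ℝ) * Complex.I))
      (gaussianReal 0 1) := by
  have hc := continuous_lead hg.smoothPolyGrowth alg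
  refine Integrable.mul_bdd (c := 1) hq.ofReal (by fun_prop) (ae_of_all _ fun p => ?_)
  rw [Complex.norm_exp_ofReal_mul_I]

lemma integrable_leadCharFun {q : ℝ → ℝ} (hq : Integrable q (gaussianReal 0 1)) (a : ℝ) :
    Integrable (leadCharFun alg g q a) (marginal g) := by
  have := isProbabilityMeasure_marginal hg
  exact (integrable_mul_exp_lead hg alg hq a).integral_prod_left

omit hg in
lemma norm_leadCharFun_le {q : ℝ → ℝ} (hq0 : ∀ z, 0 ≤ q z)
    (hq1 : ∫ z, q z ∂gaussianReal 0 1 = 1) (a u : ℝ) : ‖leadCharFun alg g q a u‖ ≤ 1 := by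
  refine (norm_integral_le_integral_norm _).trans (le_of_eq ?_)
  simp only [norm_mul, Complex.norm_exp_ofReal_mul_I, mul_one, Complex.norm_real,
    Real.norm_of_nonneg (hq0 _), hq1]

/-- The Gaussian approximation of the conditional characteristic function of a leading term. -/
lemma integral_norm_leadCharFun_sub_le (a : ℝ) :
    ∫ u, ‖leadCharFun alg g (fun _ => 1) a u - (Real.exp (-(a ^ 2 * leadVar alg g u / 2)) : ℂ)‖
        ∂marginal g ≤
      |a| ^ 3 * (4 * ∫ p, |lead alg g p| ^ 3 ∂pairLaw g) +
        a ^ 4 * ∫ u, leadVar alg g u ^ 2 ∂marginal g := by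
  have := isProbabilityMeasure_marginal hg
  have hsm := hg.smoothPolyGrowth
  have hvc := continuous_leadVar hsm alg
  have i3 : Integrable (fun p => |lead alg g p| ^ 3) (pairLaw g) := by
    simpa only [abs_pow] using (integrable_lead_pow hg alg 3).abs
  have i3' := Integrable.integral_prod_left i3
  have hv2 : Integrable (fun u => leadVar alg g u ^ 2) (marginal g) :=
    PolyGrowth.integrable hg (polyGrowth_of_polyBound ((polyBound_leadVar hsm alg).pow 2))
      (hvc.pow 2)
  have hpt : ∀ u, ‖leadCharFun alg g (fun _ => 1) a u -
      (Real.exp (-(a ^ 2 * leadVar alg g u / 2)) : ℂ)‖ ≤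
      4 * |a| ^ 3 * (∫ z, |lead alg g (u, z)| ^ 3 ∂gaussianReal 0 1) +
        a ^ 4 * leadVar alg g u ^ 2 := by
    intro u
    set s := a ^ 2 * leadVar alg g u / 2 with hs
    have hs0 : 0 ≤ s := by
      have := leadVar_nonneg alg g u
      positivity
    have j1 : Integrable (fun z => lead alg g (u, z)) (gaussianReal 0 1) := by
      simpa using integrable_section_lead_pow hg alg 1 u
    have j2 := integrable_section_lead_pow hg alg 2 u
    have j3 : Integrable (fun z => |lead alg g (u, z)| ^ 3) (gaussianReal 0 1) := by
      simpa only [abs_pow] using (integrable_section_lead_pow hg alg 3 u).abs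
    have k0 : Integrable (fun z => Complex.exp ((a * lead alg g (u, z) : ℝ) * Complex.I))
        (gaussianReal 0 1) := by
      simpa using integrable_section_mul_exp_lead hg alg (integrable_const (1 : ℝ)) a u
    have k1 : Integrable (fun z => ((a * lead alg g (u, z) : ℝ) : ℂ) * Complex.I)
        (gaussianReal 0 1) := (j1.const_mul a).ofReal.mul_const _
    have k2 : Integrable (fun z => ((a * lead alg g (u, z) : ℝ) : ℂ) ^ 2 / 2)
        (gaussianReal 0 1) := by
      have := ((j2.const_mul (a ^ 2)).ofReal (𝕜 := ℂ)).div_const 2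
      refine this.congr (ae_of_all _ fun z => ?_)
      simp [mul_pow]
    have e1 : ∫ z, ((a * lead alg g (u, z) : ℝ) : ℂ) * Complex.I ∂gaussianReal 0 1 = 0 := by
      rw [integral_mul_const, integral_complex_ofReal, integral_const_mul, integral_lead]
      simp
    have e2 : ∫ z, ((a * lead alg g (u, z) : ℝ) : ℂ) ^ 2 / 2 ∂gaussianReal 0 1 = (s : ℂ) := by
      have : ∀ z, ((a * lead alg g (u, z) : ℝ) : ℂ) ^ 2 / 2 =
          ((a ^ 2 / 2 * lead alg g (u, z) ^ 2 : ℝ) : ℂ) := fun z => by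
        push_cast
        ring
      simp only [this]
      rw [integral_complex_ofReal, integral_const_mul, integral_lead_sq, hs]
      push_cast
      ring
    -- Both functions are compared with `1 - s`: the linear term has mean zero and the quadratic one
    -- has mean `s`, so the errors are a third moment and `s ^ 2`.
    have e3 : leadCharFun alg g (fun _ => 1) a u - (Real.exp (-s) : ℂ) =
        ∫ z, (Complex.exp ((a * lead alg g (u, z) : ℝ) * Complex.I) - 1 -
          (a * lead alg g (u, z) : ℝ) * Complex.I + ((a * lead alg g (u, z) : ℝ) : ℂ) ^ 2 / 2)
          ∂gaussianReal 0 1 - ((Real.exp (-s) - 1 + s : ℝ) : ℂ) := by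
      have k3 : Integrable (fun z => Complex.exp ((a * lead alg g (u, z) : ℝ) * Complex.I) - 1)
          (gaussianReal 0 1) := k0.sub (integrable_const (1 : ℂ))
      have k4 : Integrable (fun z => Complex.exp ((a * lead alg g (u, z) : ℝ) * Complex.I) - 1 -
          (a * lead alg g (u, z) : ℝ) * Complex.I) (gaussianReal 0 1) := k3.sub k1
      rw [integral_add k4 k2, integral_sub k3 k1, integral_sub k0 (integrable_const (1 : ℂ)), e1,
        e2, leadCharFun]
      simp
    rw [e3]
    refine (norm_sub_le _ _).trans (add_le_add ?_ ?_)
    · refine (norm_integral_le_integral_norm _).trans ?_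
      rw [← integral_const_mul]
      refine integral_mono_of_nonneg (ae_of_all _ fun _ => norm_nonneg _) (j3.const_mul _)
        (ae_of_all _ fun z => ?_)
      refine (norm_exp_mul_I_sub_le _).trans (le_of_eq ?_)
      rw [abs_mul]
      ring
    · rw [Complex.norm_real, Real.norm_eq_abs]
      refine (abs_exp_neg_sub_le hs0).trans ?_
      rw [hs]
      have : 0 ≤ a ^ 4 * leadVar alg g u ^ 2 := by positivity
      nlinarith
  refine (integral_mono_of_nonneg (ae_of_all _ fun _ => norm_nonneg _)
    ((i3'.const_mul _).add (hv2.const_mul _)) (ae_of_all _ hpt)).trans (le_of_eq ?_)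
  rw [integral_add' (i3'.const_mul _) (hv2.const_mul _), integral_const_mul, integral_const_mul]
  have e4 : ∫ p, |lead alg g p| ^ 3 ∂pairLaw g =
      ∫ u, ∫ z, |lead alg g (u, z)| ^ 3 ∂gaussianReal 0 1 ∂marginal g := integral_prod _ i3
  rw [e4]
  ring

/-- A weighted conditional characteristic function of a leading term is close to `1`. -/
lemma integral_norm_leadCharFun_sq_sub_le (a : ℝ) :
    ∫ u, ‖leadCharFun alg g (fun z => z ^ 2) a u -
        (Real.exp (-(a ^ 2 * leadVar alg g u / 2)) : ℂ)‖ ∂marginal g ≤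
      |a| * (∫ p, p.2 ^ 2 * |lead alg g p| ∂pairLaw g) +
        a ^ 2 * ∫ u, leadVar alg g u ∂marginal g := by
  have := isProbabilityMeasure_marginal hg
  have hsm := hg.smoothPolyGrowth
  have hvc := continuous_leadVar hsm alg
  have hlc := continuous_lead hsm alg
  have hb : PolyBound fun _ p => p.2 ^ 2 * |lead alg g p| :=
    (PolyBound.snd.pow 2).mul (polyBound_lead hsm alg).abs
  have i3 : Integrable (fun p : ℝ × ℝ => p.2 ^ 2 * |lead alg g p|) (pairLaw g) :=
    hb.integrable hg (ε := 1) ⟨one_pos, le_rfl⟩ (by fun_prop)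
  have i3' := Integrable.integral_prod_left i3
  have hv1 : Integrable (leadVar alg g) (marginal g) :=
    PolyGrowth.integrable hg (polyGrowth_of_polyBound (polyBound_leadVar hsm alg)) hvc
  have hpt : ∀ u, ‖leadCharFun alg g (fun z => z ^ 2) a u -
      (Real.exp (-(a ^ 2 * leadVar alg g u / 2)) : ℂ)‖ ≤
      |a| * (∫ z, z ^ 2 * |lead alg g (u, z)| ∂gaussianReal 0 1) + a ^ 2 * leadVar alg g u := by
    intro u
    have hv0 := leadVar_nonneg alg g u
    set s := a ^ 2 * leadVar alg g u / 2 with hs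
    have hs0 : 0 ≤ s := by positivity
    have j1 : Integrable (fun z => z ^ 2 * |lead alg g (u, z)|) (gaussianReal 0 1) :=
      hb.integrable_section (ε := 1) ⟨one_pos, le_rfl⟩ (by fun_prop) u
    have k0 := integrable_section_mul_exp_lead hg alg (integrable_pow_gaussianReal 2) a u
    have k1 : Integrable (fun z : ℝ => ((z ^ 2 : ℝ) : ℂ)) (gaussianReal 0 1) :=
      (integrable_pow_gaussianReal 2).ofReal
    -- Both are compared with `1`, the mean of `z ^ 2`. Accuracy of first order is enough, because
    -- only one coordinate carries this weight.
    have e3 : leadCharFun alg g (fun z => z ^ 2) a u - (Real.exp (-s) : ℂ) =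
        ∫ z, (((z ^ 2 : ℝ) : ℂ) * Complex.exp ((a * lead alg g (u, z) : ℝ) * Complex.I) -
          ((z ^ 2 : ℝ) : ℂ)) ∂gaussianReal 0 1 + ((1 - Real.exp (-s) : ℝ) : ℂ) := by
      rw [integral_sub k0 k1, integral_complex_ofReal, integral_pow_two_gaussianReal, leadCharFun]
      push_cast
      ring
    rw [e3]
    refine (norm_add_le _ _).trans (add_le_add ?_ ?_)
    · refine (norm_integral_le_integral_norm _).trans ?_
      rw [← integral_const_mul]
      refine integral_mono_of_nonneg (ae_of_all _ fun _ => norm_nonneg _) (j1.const_mul _)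
        (ae_of_all _ fun z => ?_)
      have h1 := Real.norm_exp_I_mul_ofReal_sub_one_le (x := a * lead alg g (u, z))
      rw [mul_comm Complex.I] at h1
      have h2 : ((z ^ 2 : ℝ) : ℂ) * Complex.exp ((a * lead alg g (u, z) : ℝ) * Complex.I) -
          ((z ^ 2 : ℝ) : ℂ) = ((z ^ 2 : ℝ) : ℂ) *
          (Complex.exp ((a * lead alg g (u, z) : ℝ) * Complex.I) - 1) := by ring
      simp only
      rw [h2, norm_mul, Complex.norm_real, Real.norm_of_nonneg (sq_nonneg z)]
      rw [Real.norm_eq_abs, abs_mul] at h1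
      nlinarith [sq_nonneg z]
    · rw [Complex.norm_real, Real.norm_eq_abs]
      have := Real.add_one_le_exp (-s)
      rw [abs_of_nonneg (by linarith [Real.exp_le_one_iff.2 (neg_nonpos.2 hs0)])]
      have : 0 ≤ a ^ 2 * leadVar alg g u := by positivity
      linarith
  refine (integral_mono_of_nonneg (ae_of_all _ fun _ => norm_nonneg _)
    ((i3'.const_mul _).add (hv1.const_mul _)) (ae_of_all _ hpt)).trans (le_of_eq ?_)
  rw [integral_add' (i3'.const_mul _) (hv1.const_mul _), integral_const_mul, integral_const_mul]
  have e4 : ∫ p, p.2 ^ 2 * |lead alg g p| ∂pairLaw g =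
      ∫ u, ∫ z, z ^ 2 * |lead alg g (u, z)| ∂gaussianReal 0 1 ∂marginal g := integral_prod _ i3
  rw [e4]

end LeadCharFun

/-! ### Characteristic functions of sums of leading terms under a weight. -/

section WeightedCharFun

variable {g : ℝ → ℝ} (hg : IsRegularLogDensity g) (alg : Algorithm)
include hg

lemma integrable_norm_leadCharFun_sub {q : ℝ → ℝ} (hq : Integrable q (gaussianReal 0 1)) (a : ℝ) :
    Integrable (fun u => ‖leadCharFun alg g q a u -
      (Real.exp (-(a ^ 2 * leadVar alg g u / 2)) : ℂ)‖) (marginal g) := by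
  have := isProbabilityMeasure_marginal hg
  have hvc := continuous_leadVar hg.smoothPolyGrowth alg
  refine ((integrable_leadCharFun hg alg hq a).sub (Integrable.mono' (integrable_const (1 : ℝ))
    (by fun_prop) (ae_of_all _ fun u => ?_))).norm
  have := leadVar_nonneg alg g u
  rw [Complex.norm_real, Real.norm_of_nonneg (Real.exp_pos _).le, Real.exp_le_one_iff, neg_nonpos]
  positivity

/-- The weight `z ^ 2` for the coordinate `i` and the weight `1` for the other coordinates. -/
def coordWeight {n : ℕ} (i j : Fin n) (z : ℝ) : ℝ := if j = i then z ^ 2 else 1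

omit hg in
lemma integrable_coordWeight {n : ℕ} (i j : Fin n) :
    Integrable (coordWeight i j) (gaussianReal 0 1) := by
  unfold coordWeight
  by_cases h : j = i
  · simpa only [h, if_true] using integrable_pow_gaussianReal 2
  · simpa only [h, if_false] using integrable_const (1 : ℝ)

omit hg in
lemma coordWeight_nonneg {n : ℕ} (i j : Fin n) (z : ℝ) : 0 ≤ coordWeight i j z := by
  unfold coordWeight
  split_ifs
  · exact sq_nonneg z
  · exact zero_le_one

omit hg in
lemma integral_coordWeight {n : ℕ} (i j : Fin n) :
    ∫ z, coordWeight i j z ∂gaussianReal 0 1 = 1 := by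
  unfold coordWeight
  by_cases h : j = i
  · simpa only [h, if_true] using integral_pow_two_gaussianReal
  · simp only [h, if_false, integral_const, probReal_univ, smul_eq_mul, mul_one]

/-- Ordinary coordinates need an error of order `e ^ (2k + 1)`, whose sum over all of them vanishes
in the limit. The distinguished coordinate occurs once and may contribute an error of order `e`. -/
lemma exists_integral_norm_leadCharFun_coordWeight_sub_le (t : ℝ) :
    ∃ B D : ℝ, 0 ≤ B ∧ 0 ≤ D ∧ ∀ {n : ℕ} (i j : Fin n), ∀ e ∈ Set.Ioc (0 : ℝ) 1,
      ∫ u, ‖leadCharFun alg g (coordWeight i j) (t * e ^ alg.order) u -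
        (Real.exp (-((t * e ^ alg.order) ^ 2 * leadVar alg g u / 2)) : ℂ)‖ ∂marginal g ≤
        B * e ^ (2 * alg.order + 1) + if j = i then D * e else 0 := by
  have hI1 : 0 ≤ ∫ p, |lead alg g p| ^ 3 ∂pairLaw g := integral_nonneg fun _ => by positivity
  have hI2 : 0 ≤ ∫ u, leadVar alg g u ^ 2 ∂marginal g := integral_nonneg fun _ => sq_nonneg _
  have hI3 : 0 ≤ ∫ p, p.2 ^ 2 * |lead alg g p| ∂pairLaw g :=
    integral_nonneg fun _ => by positivity
  have hI4 : 0 ≤ ∫ u, leadVar alg g u ∂marginal g :=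
    integral_nonneg fun _ => leadVar_nonneg _ _ _
  have hk := alg.order_pos
  refine ⟨|t| ^ 3 * (4 * ∫ p, |lead alg g p| ^ 3 ∂pairLaw g) +
    t ^ 4 * ∫ u, leadVar alg g u ^ 2 ∂marginal g,
    |t| * (∫ p, p.2 ^ 2 * |lead alg g p| ∂pairLaw g) + t ^ 2 * ∫ u, leadVar alg g u ∂marginal g,
    by positivity, by positivity, ?_⟩
  rintro n i j e ⟨he0, he1⟩
  unfold coordWeight
  by_cases h : j = i
  · simp only [h, if_true]
    refine (integral_norm_leadCharFun_sq_sub_le hg alg (t * e ^ alg.order)).trans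
      (le_add_of_nonneg_of_le (by positivity) ?_)
    have h2 : e ^ alg.order ≤ e := pow_le_of_le_one he0.le he1 hk.ne'
    have h3 : (e ^ alg.order) ^ 2 ≤ e := by
      rw [← pow_mul]
      exact pow_le_of_le_one he0.le he1 (by omega)
    rw [abs_mul, abs_of_pos (pow_pos he0 _), mul_pow, add_mul]
    refine add_le_add ?_ ?_
    · calc _ = |t| * (∫ p, p.2 ^ 2 * |lead alg g p| ∂pairLaw g) * e ^ alg.order := by ring
        _ ≤ _ := by gcongr
    · calc _ = t ^ 2 * (∫ u, leadVar alg g u ∂marginal g) * (e ^ alg.order) ^ 2 := by ring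
        _ ≤ _ := by gcongr
  · simp only [h, if_false, add_zero]
    refine (integral_norm_leadCharFun_sub_le hg alg (t * e ^ alg.order)).trans ?_
    have h2 : (e ^ alg.order) ^ 3 ≤ e ^ (2 * alg.order + 1) := by
      rw [← pow_mul]
      exact pow_le_pow_of_le_one he0.le he1 (by omega)
    have h3 : (e ^ alg.order) ^ 4 ≤ e ^ (2 * alg.order + 1) := by
      rw [← pow_mul]
      exact pow_le_pow_of_le_one he0.le he1 (by omega)
    rw [abs_mul, abs_of_pos (pow_pos he0 _), mul_pow, mul_pow, add_mul]
    refine add_le_add ?_ ?_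
    · calc _ = |t| ^ 3 * (4 * ∫ p, |lead alg g p| ^ 3 ∂pairLaw g) * (e ^ alg.order) ^ 3 := by ring
        _ ≤ _ := by gcongr
    · calc _ = t ^ 4 * (∫ u, leadVar alg g u ^ 2 ∂marginal g) * (e ^ alg.order) ^ 4 := by ring
        _ ≤ _ := by gcongr

section FixedDimension

variable {n : ℕ} (e : Fin n → ℝ) (i : Fin n) {w : (Fin n → ℝ) → ℝ} (hwm : Measurable w)
  (hw0 : ∀ u, 0 ≤ w u) {W : ℝ} (hW : ∀ u, w u ≤ W)
include hwm hw0 hW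

/-- Given the positions, the Gaussian variables are independent, so the exponential factors over
coordinates, while the weight `w`, a function of positions, stays outside the inner integrals. -/
lemma integral_exp_sum_lead_eq (t : ℝ) :
    ∫ ω, ((w (fun j => (ω j).1) * (ω i).2 ^ 2 : ℝ) : ℂ) *
      Complex.exp (t * (∑ j, e j ^ alg.order * lead alg g (ω j) : ℝ) * Complex.I)
        ∂productLaw g n = ∫ u : Fin n → ℝ, (w u : ℂ) *
          ∏ j, leadCharFun alg g (coordWeight i j) (t * e j ^ alg.order) (u j)
          ∂(Measure.pi fun _ => marginal g) := by
  have := isProbabilityMeasure_marginal hg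
  have h1 := integral_mul_prod_pairs (𝕜 := ℂ)
    (fun j => integrable_mul_exp_lead hg alg (integrable_coordWeight i j) (t * e j ^ alg.order))
    (w := fun u => (w u : ℂ)) (Complex.measurable_ofReal.comp hwm) (W := W)
    (fun u => by
      rw [Complex.norm_real, Real.norm_of_nonneg (hw0 u)]
      exact hW u)
  refine Eq.trans (integral_congr_ae (ae_of_all _ fun ω => ?_)) h1
  simp only [Finset.prod_mul_distrib, ← Complex.exp_sum]
  have h2 : ∏ j, ((coordWeight i j (ω j).2 : ℝ) : ℂ) = ((ω i).2 ^ 2 : ℝ) := by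
    rw [← Complex.ofReal_prod]
    simp [coordWeight, Finset.prod_ite_eq']
  rw [h2, Complex.ofReal_mul, mul_assoc, ← Finset.sum_mul, ← Complex.ofReal_sum,
    ← Complex.ofReal_mul, Finset.mul_sum]
  simp only [mul_assoc]

omit hg hwm in
-- Each factor is replaced by its Gaussian approximation by telescoping. The product of these is one
-- exponential of the weighted sum of conditional variances, and `exp (-·)` is nonexpansive on the
-- half line.
lemma norm_mul_prod_leadCharFun_sub_le (t : ℝ) {v : ℝ} (hv : 0 ≤ v) (he : ∀ j, 0 ≤ e j)
    (u : Fin n → ℝ) :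
    ‖(w u : ℂ) * ∏ j, leadCharFun alg g (coordWeight i j) (t * e j ^ alg.order) (u j) -
      (w u : ℂ) * (Real.exp (-(t ^ 2 / 2 * v)) : ℂ)‖ ≤
      W * (∑ j, ‖leadCharFun alg g (coordWeight i j) (t * e j ^ alg.order) (u j) -
        (Real.exp (-((t * e j ^ alg.order) ^ 2 * leadVar alg g (u j) / 2)) : ℂ)‖ + t ^ 2 / 2 *
        |∑ j, e j ^ (2 * alg.order) * leadVar alg g (u j) - v|) := by
  rw [← mul_sub, norm_mul, Complex.norm_real, Real.norm_of_nonneg (hw0 u)]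
  refine mul_le_mul (hW u) ?_ (norm_nonneg _) ((hw0 u).trans (hW u))
  have h1 := norm_prod_sub_prod_le Finset.univ
    (fun j => leadCharFun alg g (coordWeight i j) (t * e j ^ alg.order) (u j))
    (fun j => (Real.exp (-((t * e j ^ alg.order) ^ 2 * leadVar alg g (u j) / 2)) : ℂ))
    (fun j _ => norm_leadCharFun_le alg (coordWeight_nonneg i j) (integral_coordWeight i j) _ _)
    (fun j _ => by
      have := leadVar_nonneg alg g (u j)
      rw [Complex.norm_real, Real.norm_of_nonneg (Real.exp_pos _).le, Real.exp_le_one_iff,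
        neg_nonpos]
      positivity)
  have h2 : ∏ j, (Real.exp (-((t * e j ^ alg.order) ^ 2 * leadVar alg g (u j) / 2)) : ℂ) =
      ((Real.exp (-(t ^ 2 / 2 *
        ∑ j, e j ^ (2 * alg.order) * leadVar alg g (u j))) : ℝ) : ℂ) := by
    rw [← Complex.ofReal_prod, ← Real.exp_sum, Finset.mul_sum, ← Finset.sum_neg_distrib]
    congr 2
    refine Finset.sum_congr rfl fun j _ => ?_
    ring
  have h3 : ‖∏ j, (Real.exp (-((t * e j ^ alg.order) ^ 2 * leadVar alg g (u j) / 2)) : ℂ) -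
      (Real.exp (-(t ^ 2 / 2 * v)) : ℂ)‖ ≤ t ^ 2 / 2 *
      |∑ j, e j ^ (2 * alg.order) * leadVar alg g (u j) - v| := by
    rw [h2, ← Complex.ofReal_sub, Complex.norm_real, Real.norm_eq_abs]
    refine (abs_exp_neg_sub_exp_neg_le ?_ (by positivity)).trans (le_of_eq ?_)
    · exact mul_nonneg (by positivity) (Finset.sum_nonneg fun j _ =>
        mul_nonneg (pow_nonneg (he j) _) (leadVar_nonneg _ _ _))
    · rw [← mul_sub, abs_mul, abs_of_nonneg (by positivity : 0 ≤ t ^ 2 / 2)]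
  rw [← sub_add_sub_cancel _
    (∏ j, (Real.exp (-((t * e j ^ alg.order) ^ 2 * leadVar alg g (u j) / 2)) : ℂ))]
  exact (norm_add_le _ _).trans (add_le_add h1 h3)

/-- The bound `W` on the weight allows the errors to be integrated under the unweighted product law,
where each one depends on a single coordinate or obeys the law of large numbers. -/
lemma norm_integral_exp_sum_lead_sub_le (hw1 : ∫ u, w u ∂(Measure.pi fun _ => marginal g) = 1)
    (t : ℝ) {v : ℝ} (hv : 0 ≤ v) (he : ∀ j, 0 ≤ e j) :
    ‖∫ ω, ((w (fun j => (ω j).1) * (ω i).2 ^ 2 : ℝ) : ℂ) *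
      Complex.exp (t * (∑ j, e j ^ alg.order * lead alg g (ω j) : ℝ) * Complex.I)
        ∂productLaw g n - (Real.exp (-(t ^ 2 / 2 * v)) : ℂ)‖ ≤
      W * (∑ j, ∫ u, ‖leadCharFun alg g (coordWeight i j) (t * e j ^ alg.order) u -
        (Real.exp (-((t * e j ^ alg.order) ^ 2 * leadVar alg g u / 2)) : ℂ)‖ ∂marginal g +
        t ^ 2 / 2 * ∫ u : Fin n → ℝ, |∑ j, e j ^ (2 * alg.order) * leadVar alg g (u j) - v|
          ∂(Measure.pi fun _ => marginal g)) := by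
  have := isProbabilityMeasure_marginal hg
  have hvc := continuous_leadVar hg.smoothPolyGrowth alg
  have hv1 : Integrable (leadVar alg g) (marginal g) :=
    PolyGrowth.integrable hg (polyGrowth_of_polyBound (polyBound_leadVar hg.smoothPolyGrowth alg))
      hvc
  rw [integral_exp_sum_lead_eq hg alg e i hwm hw0 hW t]
  have hwb : ∀ u, ‖w u‖ ≤ W := fun u => by
    rw [Real.norm_of_nonneg (hw0 u)]
    exact hW u
  have hwi : Integrable w (Measure.pi fun _ : Fin n => marginal g) :=
    (integrable_const W).mono' hwm.aestronglyMeasurable (ae_of_all _ hwb)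
  have hci : Integrable (fun u : Fin n → ℝ =>
      ∏ j, leadCharFun alg g (coordWeight i j) (t * e j ^ alg.order) (u j))
      (Measure.pi fun _ => marginal g) :=
    Integrable.fintype_prod fun j => integrable_leadCharFun hg alg (integrable_coordWeight i j) _
  have hwci : Integrable (fun u : Fin n → ℝ => (w u : ℂ) *
      ∏ j, leadCharFun alg g (coordWeight i j) (t * e j ^ alg.order) (u j))
      (Measure.pi fun _ => marginal g) :=
    hci.bdd_mul (c := W) (Complex.measurable_ofReal.comp hwm).aestronglyMeasurable
      (ae_of_all _ fun u => by
        rw [Complex.norm_real]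
        exact hwb u)
  -- As `w` has mass one, the constant is itself a weighted integral, and the two integrands can be
  -- compared pointwise.
  have he1 : (Real.exp (-(t ^ 2 / 2 * v)) : ℂ) =
      ∫ u, (w u : ℂ) * (Real.exp (-(t ^ 2 / 2 * v)) : ℂ) ∂(Measure.pi fun _ => marginal g) := by
    rw [integral_mul_const, integral_complex_ofReal, hw1, Complex.ofReal_one, one_mul]
  have hvs : Integrable (fun u : Fin n → ℝ => ∑ j, e j ^ (2 * alg.order) * leadVar alg g (u j))
      (Measure.pi fun _ => marginal g) :=
    integrable_finsetSum _ fun j _ => (integrable_comp_eval hv1).const_mul _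
  have hvi : Integrable (fun u : Fin n → ℝ =>
      |∑ j, e j ^ (2 * alg.order) * leadVar alg g (u j) - v|) (Measure.pi fun _ => marginal g) :=
    (hvs.sub (integrable_const v)).abs
  have hni := fun j => integrable_norm_leadCharFun_sub hg alg (integrable_coordWeight i j)
    (t * e j ^ alg.order)
  have hni' := fun j => integrable_comp_eval (μ := fun _ : Fin n => marginal g) (i := j) (hni j)
  nth_rewrite 1 [he1]
  have hwe : Integrable (fun u => (w u : ℂ) * (Real.exp (-(t ^ 2 / 2 * v)) : ℂ))
      (Measure.pi fun _ => marginal g) := hwi.ofReal.mul_const _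
  rw [← integral_sub hwci hwe]
  refine (norm_integral_le_integral_norm _).trans ?_
  refine (integral_mono_of_nonneg (ae_of_all _ fun _ => norm_nonneg _)
    (((integrable_finsetSum _ fun j _ => hni' j).add (hvi.const_mul _)).const_mul W)
    (ae_of_all _ (norm_mul_prod_leadCharFun_sub_le alg e i hw0 hW t hv he))).trans (le_of_eq ?_)
  rw [integral_const_mul, integral_add' (integrable_finsetSum _ fun j _ => hni' j)
    (hvi.const_mul _), integral_finsetSum _ fun j _ => hni' j, integral_const_mul]
  congr 2
  refine Finset.sum_congr rfl fun j _ => ?_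
  exact integral_comp_eval (μ := fun _ : Fin n => marginal g) (i := j)
    (hni j).aestronglyMeasurable

end FixedDimension

variable {N : ℕ → ℕ} {ε : (m : ℕ) → Fin (N m) → ℝ} {τ : ℝ} (hε : StepSizes alg.order ε τ)
  (i : ∀ m, Fin (N m)) {w : ∀ m, (Fin (N m) → ℝ) → ℝ} (hwm : ∀ m, Measurable (w m))
  (hw0 : ∀ m u, 0 ≤ w m u) {W : ℝ} (hW : ∀ m u, w m u ≤ W)
  (hw1 : ∀ m, ∫ u, w m u ∂(Measure.pi fun _ => marginal g) = 1)
include hε hwm hw0 hW hw1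

/-- Under the weighted law, the characteristic function of the sum of the leading terms converges
to that of a centred Gaussian. -/
lemma tendsto_integral_exp_sum_lead (t : ℝ) :
    Tendsto (fun m => ∫ ω, ((w m (fun j => (ω j).1) * (ω (i m)).2 ^ 2 : ℝ) : ℂ) *
      Complex.exp (t * (∑ j, ε m j ^ alg.order * lead alg g (ω j) : ℝ) * Complex.I)
        ∂productLaw g (N m)) atTop
      (𝓝 (Real.exp (-(t ^ 2 / 2 * (τ * constK alg g))) : ℂ)) := by
  obtain ⟨B, D, hB, hD, hfac⟩ := exists_integral_norm_leadCharFun_coordWeight_sub_le hg alg t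
  have hlim : Tendsto (fun m => W * (B * ∑ j, ε m j ^ (2 * alg.order + 1) + D * ε m (i m) +
      t ^ 2 / 2 * ∫ u : Fin (N m) → ℝ, |∑ j, ε m j ^ (2 * alg.order) * leadVar alg g (u j) -
        τ * constK alg g| ∂(Measure.pi fun _ => marginal g))) atTop (𝓝 0) := by
    have h1 := ((hε.tendsto_sum_succ.const_mul B).add ((hε.tendsto_coord i).const_mul D)).add
      ((tendsto_integral_abs_sum_leadVar hg alg hε).const_mul (t ^ 2 / 2))
    simpa using h1.const_mul W
  have hτ : 0 ≤ τ := ge_of_tendsto' hε.sum fun m =>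
    Finset.sum_nonneg fun j _ => pow_nonneg (hε.mem m j).1.le _
  have hK := constK_pos hg alg
  have hW0 : 0 ≤ W := (hw0 0 (fun _ => 0)).trans (hW 0 _)
  rw [tendsto_iff_norm_sub_tendsto_zero]
  refine squeeze_zero (fun _ => norm_nonneg _) (fun m => ?_) hlim
  refine (norm_integral_exp_sum_lead_sub_le hg alg (ε m) (i m) (hwm m) (hw0 m) (hW m) (hw1 m) t
    (by positivity) fun j => (hε.mem m j).1.le).trans ?_
  gcongr
  refine (Finset.sum_le_sum fun j _ => hfac (i m) j _ (hε.mem m j)).trans (le_of_eq ?_)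
  rw [Finset.sum_add_distrib, ← Finset.mul_sum]
  simp

end WeightedCharFun

/-! ### The limit of the weighted squared jump -/

/-- The mean of `min 1 (exp Y)` for a Gaussian variable `Y` of mean `-s / 2` and variance `s`. -/
noncomputable def gaussianAccept (s : ℝ) : ℝ :=
  ∫ x, min 1 (Real.exp (x - s / 2)) ∂gaussianReal 0 s.toNNReal

lemma min_one_exp_nonneg (x : ℝ) : 0 ≤ min 1 (Real.exp x) := le_min zero_le_one (Real.exp_pos x).le

lemma exists_integral_abs_move_sq_sub_le {g : ℝ → ℝ} (hg : IsRegularLogDensity g)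
    (alg : Algorithm) : ∃ c : ℝ, 0 ≤ c ∧ ∀ ε ∈ Set.Ioc (0 : ℝ) 1,
      ∫ p, |move alg g ε p ^ 2 - p.2 ^ 2| ∂pairLaw g ≤ c * ε := by
  have hd := polyBound_drift hg.smoothPolyGrowth alg
  obtain ⟨c, hc, h⟩ := (((PolyBound.const 2).mul (PolyBound.snd.mul hd)).add
    (PolyBound.eps.mul (hd.pow 2))).exists_integral_abs_le hg
  refine ⟨c, hc, fun ε hε => ?_⟩
  have h1 : ∀ p, |move alg g ε p ^ 2 - p.2 ^ 2| =
      ε * |2 * (p.2 * drift alg g p.1) + ε * drift alg g p.1 ^ 2| := fun p => by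
    nth_rewrite 2 [← abs_of_pos hε.1]
    rw [← abs_mul, move]
    ring_nf
  simp only [h1, integral_const_mul]
  rw [mul_comm]
  exact mul_le_mul_of_nonneg_right (h ε hε) hε.1.le

section WeightedJump

variable {g : ℝ → ℝ} (hg : IsRegularLogDensity g) (alg : Algorithm)
include hg

lemma integrable_move_sq {ε : ℝ} (hε : ε ∈ Set.Ioc (0 : ℝ) 1) :
    Integrable (fun p => move alg g ε p ^ 2) (pairLaw g) :=
  ((polyBound_move hg.smoothPolyGrowth alg).pow 2).integrable hg hε
    ((continuous_move hg.smoothPolyGrowth alg ε).pow 2).aestronglyMeasurable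

lemma integrable_snd_pow (k : ℕ) : Integrable (fun p : ℝ × ℝ => p.2 ^ k) (pairLaw g) :=
  (PolyBound.snd.pow k).integrable hg (ε := 1) ⟨one_pos, le_rfl⟩ (by fun_prop)

lemma measurable_sum_incr {n : ℕ} (e : Fin n → ℝ) :
    Measurable fun ω : Fin n → ℝ × ℝ => ∑ j, incr alg g (e j) (ω j) :=
  Finset.measurable_sum _ fun j _ =>
    (continuous_incr hg.smoothPolyGrowth alg (e j)).measurable.comp (measurable_pi_apply j)

lemma measurable_sum_lead {n : ℕ} (e : Fin n → ℝ) :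
    Measurable fun ω : Fin n → ℝ × ℝ => ∑ j, e j ^ alg.order * lead alg g (ω j) :=
  Finset.measurable_sum _ fun j _ => ((continuous_lead hg.smoothPolyGrowth alg).measurable.comp
    (measurable_pi_apply j)).const_mul _

/-- The factor `z ^ 2` has mean one and is independent of the positions, so together with `w` it
forms a probability density when `w` is one. -/
lemma integral_weight_mul_sq {n : ℕ} (i : Fin n) {w : (Fin n → ℝ) → ℝ} (hwm : Measurable w)
    {W : ℝ} (hW : ∀ u, ‖w u‖ ≤ W) :
    ∫ ω, w (fun j => (ω j).1) * (ω i).2 ^ 2 ∂productLaw g n =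
      ∫ u, w u ∂(Measure.pi fun _ => marginal g) := by
  have := isProbabilityMeasure_marginal hg
  have h1 := integral_mul_prod_pairs (𝕜 := ℝ) (ν := marginal g) (γ := gaussianReal 0 1)
    (f := fun j p => coordWeight i j p.2)
    (fun j => (integrable_coordWeight i j).comp_snd (marginal g)) hwm hW
  simp only [integral_coordWeight, Finset.prod_const_one, mul_one] at h1
  rw [← h1]
  refine integral_congr_ae (ae_of_all _ fun ω => ?_)
  simp [coordWeight, Finset.prod_ite_eq']

/-- The weighted squared jump is close to the same quantity for the leading terms. -/
lemma abs_integral_weighted_jump_sub_le {n : ℕ} {e : Fin n → ℝ}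
    (he : ∀ j, e j ∈ Set.Ioc (0 : ℝ) 1) (i : Fin n) {w : (Fin n → ℝ) → ℝ} (hwm : Measurable w)
    (hw0 : ∀ u, 0 ≤ w u) {W : ℝ} (hW : ∀ u, w u ≤ W) {Δ : (Fin n → ℝ × ℝ) → ℝ}
    (hΔm : Measurable Δ) (s : ℝ) :
    |∫ ω, w (fun j => (ω j).1) * move alg g (e i) (ω i) ^ 2 *
        min 1 (Real.exp (Δ ω + ∑ j, incr alg g (e j) (ω j))) ∂productLaw g n -
      ∫ ω, w (fun j => (ω j).1) * (ω i).2 ^ 2 *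
        min 1 (Real.exp (∑ j, e j ^ alg.order * lead alg g (ω j) - s / 2)) ∂productLaw g n| ≤
      W * (∫ p, |move alg g (e i) p ^ 2 - p.2 ^ 2| ∂pairLaw g +
        √(∫ p, (p.2 ^ 2) ^ 2 ∂pairLaw g) * √(∫ ω, min 1 |Δ ω| ∂productLaw g n) +
        √(∫ p, (p.2 ^ 2) ^ 2 ∂pairLaw g) * √(∫ ω, (∑ j, (incr alg g (e j) (ω j) -
          e j ^ alg.order * lead alg g (ω j)) + s / 2) ^ 2 ∂productLaw g n)) := by
  have := isProbabilityMeasure_pairLaw hg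
  have := isProbabilityMeasure_productLaw hg n
  have hW0 : 0 ≤ W := (hw0 fun _ => 0).trans (hW _)
  have hS := measurable_sum_incr hg alg e
  have hL := measurable_sum_lead hg alg e
  have hwf : Measurable fun ω : Fin n → ℝ × ℝ => w (fun j => (ω j).1) :=
    hwm.comp (by fun_prop)
  have hmc := continuous_move hg.smoothPolyGrowth alg (e i)
  have im : Integrable (fun ω : Fin n → ℝ × ℝ => move alg g (e i) (ω i) ^ 2) (productLaw g n) :=
    integrable_comp_eval (μ := fun _ : Fin n => pairLaw g) (i := i)
      (integrable_move_sq hg alg (he i))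
  have iz : Integrable (fun ω : Fin n → ℝ × ℝ => (ω i).2 ^ 2) (productLaw g n) :=
    integrable_comp_eval (μ := fun _ : Fin n => pairLaw g) (i := i) (integrable_snd_pow hg 2)
  have hbd : ∀ x : ℝ, ‖min 1 (Real.exp x)‖ ≤ 1 := fun x => by
    rw [Real.norm_of_nonneg (min_one_exp_nonneg x)]
    exact min_le_left _ _
  have hwb : ∀ u, ‖w u‖ ≤ W := fun u => by
    rw [Real.norm_of_nonneg (hw0 u)]
    exact hW u
  have i1 : Integrable (fun ω => w (fun j => (ω j).1) * move alg g (e i) (ω i) ^ 2 *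
      min 1 (Real.exp (Δ ω + ∑ j, incr alg g (e j) (ω j)))) (productLaw g n) :=
    (im.bdd_mul hwf.aestronglyMeasurable (ae_of_all _ fun _ => hwb _)).mul_bdd (c := 1)
      (by fun_prop) (ae_of_all _ fun _ => hbd _)
  have i2 : Integrable (fun ω => w (fun j => (ω j).1) * (ω i).2 ^ 2 *
      min 1 (Real.exp (∑ j, e j ^ alg.order * lead alg g (ω j) - s / 2))) (productLaw g n) :=
    (iz.bdd_mul hwf.aestronglyMeasurable (ae_of_all _ fun _ => hwb _)).mul_bdd (c := 1)
      (measurable_const.min (hL.sub_const _).exp).aestronglyMeasurable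
      (ae_of_all _ fun _ => hbd _)
  have m1 : MemLp (fun ω : Fin n → ℝ × ℝ => (ω i).2 ^ 2) 2 (productLaw g n) := by
    refine (memLp_two_iff_integrable_sq iz.1).2 ?_
    simp only [← pow_mul]
    exact integrable_comp_eval (μ := fun _ : Fin n => pairLaw g) (i := i)
      (integrable_snd_pow hg 4)
  have m2 : MemLp (fun ω => min 1 |Δ ω|) 2 (productLaw g n) :=
    MemLp.of_bound (by fun_prop) 1 (ae_of_all _ fun ω => by
      rw [Real.norm_of_nonneg (le_min zero_le_one (abs_nonneg _))]
      exact min_le_left _ _)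
  have m3 : MemLp (fun ω => ∑ j, (incr alg g (e j) (ω j) -
      e j ^ alg.order * lead alg g (ω j)) + s / 2) 2 (productLaw g n) :=
    memLp_sum_comp_eval (fun j => (memLp_incr hg alg (he j)).sub ((memLp_lead hg alg).const_mul _))
      _
  have c1 := integral_abs_mul_le_sqrt m1 m2
  have c2 := integral_abs_mul_le_sqrt m1 m3
  have e1 : ∫ ω, ((ω i).2 ^ 2) ^ 2 ∂productLaw g n = ∫ p, (p.2 ^ 2) ^ 2 ∂pairLaw g :=
    integral_comp_eval (μ := fun _ : Fin n => pairLaw g) (i := i)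
      (f := fun p : ℝ × ℝ => (p.2 ^ 2) ^ 2) (by fun_prop)
  have e2 : ∫ ω, |move alg g (e i) (ω i) ^ 2 - (ω i).2 ^ 2| ∂productLaw g n =
      ∫ p, |move alg g (e i) p ^ 2 - p.2 ^ 2| ∂pairLaw g :=
    integral_comp_eval (μ := fun _ : Fin n => pairLaw g) (i := i)
      (f := fun p : ℝ × ℝ => |move alg g (e i) p ^ 2 - p.2 ^ 2|) (by fun_prop)
  -- The truncation takes values in `[0, 1]`, so its square is no larger; the Cauchy–Schwarz bound
  -- then needs only the mean.
  have e3 : ∫ ω, min 1 |Δ ω| ^ 2 ∂productLaw g n ≤ ∫ ω, min 1 |Δ ω| ∂productLaw g n := by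
    refine integral_mono_of_nonneg (ae_of_all _ fun _ => sq_nonneg _)
      (m2.integrable (by norm_num)) (ae_of_all _ fun ω => ?_)
    have h1 : 0 ≤ min 1 |Δ ω| := le_min zero_le_one (abs_nonneg _)
    exact pow_le_of_le_one h1 (min_le_left _ _) two_ne_zero
  rw [e1] at c1 c2
  have iA : Integrable (fun ω => |move alg g (e i) (ω i) ^ 2 - (ω i).2 ^ 2|) (productLaw g n) :=
    (im.sub iz).abs
  have iB : Integrable (fun ω => |(ω i).2 ^ 2 * min 1 (|Δ ω|)|) (productLaw g n) :=
    (m1.integrable_mul m2).abs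
  have iC : Integrable (fun ω => |(ω i).2 ^ 2 * (∑ j, (incr alg g (e j) (ω j) -
      e j ^ alg.order * lead alg g (ω j)) + s / 2)|) (productLaw g n) :=
    (m1.integrable_mul m3).abs
  have iAB : Integrable (fun ω => |move alg g (e i) (ω i) ^ 2 - (ω i).2 ^ 2| +
      |(ω i).2 ^ 2 * min 1 (|Δ ω|)|) (productLaw g n) := iA.add iB
  have iABC : Integrable (fun ω => |move alg g (e i) (ω i) ^ 2 - (ω i).2 ^ 2| +
      |(ω i).2 ^ 2 * min 1 (|Δ ω|)| + |(ω i).2 ^ 2 * (∑ j, (incr alg g (e j) (ω j) -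
      e j ^ alg.order * lead alg g (ω j)) + s / 2)|) (productLaw g n) := iAB.add iC
  rw [← integral_sub i1 i2]
  refine abs_integral_le_integral_abs.trans ?_
  refine (integral_mono_of_nonneg (ae_of_all _ fun _ => abs_nonneg _) (iABC.const_mul W)
    (ae_of_all _ fun ω => ?_)).trans ?_
  · simp only
    set a := min 1 (Real.exp (Δ ω + ∑ j, incr alg g (e j) (ω j))) with ha
    set b := min 1 (Real.exp (∑ j, e j ^ alg.order * lead alg g (ω j) - s / 2)) with hb
    have h1 : |a - b| ≤ min 1 |Δ ω| + |∑ j, (incr alg g (e j) (ω j) -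
        e j ^ alg.order * lead alg g (ω j)) + s / 2| := by
      refine (abs_min_one_exp_add_sub_le _ _ _).trans (le_of_eq ?_)
      rw [Finset.sum_sub_distrib]
      ring_nf
    have h2 : |a| ≤ 1 := hbd _
    have h3 : w (fun j => (ω j).1) * move alg g (e i) (ω i) ^ 2 * a -
        w (fun j => (ω j).1) * (ω i).2 ^ 2 * b = w (fun j => (ω j).1) *
        ((move alg g (e i) (ω i) ^ 2 - (ω i).2 ^ 2) * a + (ω i).2 ^ 2 * (a - b)) := by ring
    rw [h3, abs_mul, abs_of_nonneg (hw0 _)]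
    refine mul_le_mul (hW _) ?_ (abs_nonneg _) hW0
    refine (abs_add_le _ _).trans ?_
    rw [add_assoc, abs_mul, abs_mul, abs_mul, abs_mul,
      abs_of_nonneg (le_min zero_le_one (abs_nonneg (Δ ω))), ← mul_add]
    exact add_le_add (mul_le_of_le_one_right (abs_nonneg _) h2)
      (mul_le_mul_of_nonneg_left h1 (abs_nonneg _))
  · rw [integral_const_mul, integral_add iAB iC, integral_add iA iB, e2]
    refine mul_le_mul_of_nonneg_left (add_le_add (add_le_add le_rfl (c1.trans ?_)) c2) hW0
    gcongr

variable {N : ℕ → ℕ} {ε : (m : ℕ) → Fin (N m) → ℝ} {τ : ℝ} (hε : StepSizes alg.order ε τ)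
  (i : ∀ m, Fin (N m)) {w : ∀ m, (Fin (N m) → ℝ) → ℝ} (hwm : ∀ m, Measurable (w m))
  (hw0 : ∀ m u, 0 ≤ w m u) {W : ℝ} (hW : ∀ m u, w m u ≤ W)
  (hw1 : ∀ m, ∫ u, w m u ∂(Measure.pi fun _ => marginal g) = 1)
include hε hwm hw0 hW hw1

/-- The limit of the weighted squared jump when the sum of the powers of the step sizes
converges. -/
lemma tendsto_integral_weighted_jump {Δ : ∀ m, (Fin (N m) → ℝ × ℝ) → ℝ}
    (hΔm : ∀ m, Measurable (Δ m))
    (hΔ : Tendsto (fun m => ∫ ω, min 1 |Δ m ω| ∂productLaw g (N m)) atTop (𝓝 0)) :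
    Tendsto (fun m => ∫ ω, w m (fun j => (ω j).1) * move alg g (ε m (i m)) (ω (i m)) ^ 2 *
        min 1 (Real.exp (Δ m ω + ∑ j, incr alg g (ε m j) (ω j))) ∂productLaw g (N m)) atTop
      (𝓝 (gaussianAccept (τ * constK alg g))) := by
  have hτ : 0 ≤ τ := ge_of_tendsto' hε.sum fun m =>
    Finset.sum_nonneg fun j _ => pow_nonneg (hε.mem m j).1.le _
  have hK := constK_pos hg alg
  set s := τ * constK alg g with hs
  have hs0 : 0 ≤ s := by positivity
  have hwb : ∀ m u, ‖w m u‖ ≤ W := fun m u => by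
    rw [Real.norm_of_nonneg (hw0 m u)]
    exact hW m u
  have hwf : ∀ m, Measurable fun ω : Fin (N m) → ℝ × ℝ => w m (fun j => (ω j).1) := fun m =>
    (hwm m).comp (by fun_prop)
  -- Lévy's theorem for the density `w * z ^ 2`: the sum of leading terms becomes normal with
  -- variance `s`, and the test function is bounded and continuous.
  have main : Tendsto (fun m => ∫ ω, w m (fun j => (ω j).1) * (ω (i m)).2 ^ 2 *
      min 1 (Real.exp (∑ j, ε m j ^ alg.order * lead alg g (ω j) - s / 2)) ∂productLaw g (N m))
      atTop (𝓝 (gaussianAccept s)) := by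
    refine tendsto_integral_of_tendsto_charFun (fun m => productLaw g (N m))
      (fun m ω => w m (fun j => (ω j).1) * (ω (i m)).2 ^ 2)
      (fun m ω => ∑ j, ε m j ^ alg.order * lead alg g (ω j)) (fun m => ?_)
      (fun m => measurable_sum_lead hg alg (ε m)) (fun m ω => mul_nonneg (hw0 m _) (sq_nonneg _))
      (fun m => ?_) (fun m => ?_) (gaussianReal 0 s.toNNReal) (fun t => ?_)
      (BoundedContinuousFunction.ofNormedAddCommGroup
        (fun x => min 1 (Real.exp (x - s / 2))) (by fun_prop) 1 fun x => ?_)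
    · exact (hwf m).mul (by fun_prop)
    · have := isProbabilityMeasure_pairLaw hg
      exact (integrable_comp_eval (μ := fun _ : Fin (N m) => pairLaw g) (i := i m)
        (integrable_snd_pow hg 2)).bdd_mul (hwf m).aestronglyMeasurable
          (ae_of_all _ fun _ => hwb m _)
    · rw [integral_weight_mul_sq hg (i m) (hwm m) (hwb m), hw1]
    · have h1 := tendsto_integral_exp_sum_lead hg alg hε i hwm hw0 hW hw1 t
      rw [charFun_gaussianReal]
      convert h1 using 2
      rw [← hs, Complex.ofReal_exp, Real.coe_toNNReal _ hs0]
      push_cast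
      ring_nf
    · rw [Real.norm_of_nonneg (min_one_exp_nonneg _)]
      exact min_le_left _ _
  obtain ⟨c, hc, hmove⟩ := exists_integral_abs_move_sq_sub_le hg alg
  have hW0 : 0 ≤ W := (hw0 0 (fun _ => 0)).trans (hW 0 _)
  have hlim : Tendsto (fun m => W * (c * ε m (i m) +
      √(∫ p, (p.2 ^ 2) ^ 2 ∂pairLaw g) * √(∫ ω, min 1 |Δ m ω| ∂productLaw g (N m)) +
      √(∫ p, (p.2 ^ 2) ^ 2 ∂pairLaw g) * √(∫ ω, (∑ j, (incr alg g (ε m j) (ω j) -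
        ε m j ^ alg.order * lead alg g (ω j)) + s / 2) ^ 2 ∂productLaw g (N m)))) atTop (𝓝 0) := by
    have h1 := (((hε.tendsto_coord i).const_mul c).add
      (hΔ.sqrt.const_mul (√(∫ p, (p.2 ^ 2) ^ 2 ∂pairLaw g)))).add
      ((tendsto_integral_sum_incr_sub_lead hg alg hε).sqrt.const_mul
        (√(∫ p, (p.2 ^ 2) ^ 2 ∂pairLaw g)))
    simpa using h1.const_mul W
  have hdiff : Tendsto (fun m => (∫ ω, w m (fun j => (ω j).1) *
      move alg g (ε m (i m)) (ω (i m)) ^ 2 *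
        min 1 (Real.exp (Δ m ω + ∑ j, incr alg g (ε m j) (ω j))) ∂productLaw g (N m)) -
      ∫ ω, w m (fun j => (ω j).1) * (ω (i m)).2 ^ 2 *
        min 1 (Real.exp (∑ j, ε m j ^ alg.order * lead alg g (ω j) - s / 2))
          ∂productLaw g (N m)) atTop (𝓝 0) := by
    refine squeeze_zero_norm (fun m => ?_) hlim
    rw [Real.norm_eq_abs]
    refine (abs_integral_weighted_jump_sub_le hg alg (hε.mem m) (i m) (hwm m) (hw0 m) (hW m)
      (hΔm m) s).trans (mul_le_mul_of_nonneg_left ?_ hW0)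
    exact add_le_add (add_le_add (hmove _ (hε.mem m (i m))) le_rfl) le_rfl
  simpa using hdiff.add main

end WeightedJump

/-! ### An exponential bound -/

/-- A minimum is at most the geometric mean; the bound factors over coordinates, unlike the minimum.
-/
lemma min_one_exp_le (x : ℝ) : min 1 (Real.exp x) ≤ Real.exp (x / 2) := by
  rcases le_total 0 x with h | h
  · exact (min_le_left _ _).trans (Real.one_le_exp (by positivity))
  · exact (min_le_right _ _).trans (Real.exp_le_exp.2 (by linarith))

/-- The weighted squared jump decays exponentially in the sum of the powers of the step sizes. -/
lemma exists_integral_weighted_jump_le {g : ℝ → ℝ} (hg : IsRegularLogDensity g)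
    (alg : Algorithm) : ∃ C c e₀ : ℝ, 0 ≤ C ∧ 0 < c ∧ 0 < e₀ ∧ e₀ ≤ 1 ∧
      ∀ {n : ℕ} {e : Fin n → ℝ}, (∀ j, e j ∈ Set.Ioc 0 e₀) → ∀ (i : Fin n)
        {w : (Fin n → ℝ) → ℝ}, (∀ u, 0 ≤ w u) → ∀ {A : ℝ} {Δ : (Fin n → ℝ × ℝ) → ℝ},
        (∀ ω, w (fun j => (ω j).1) * Real.exp (Δ ω / 2) ≤ A) →
        ∫ ω, w (fun j => (ω j).1) * move alg g (e i) (ω i) ^ 2 *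
          min 1 (Real.exp (Δ ω + ∑ j, incr alg g (e j) (ω j))) ∂productLaw g n ≤
        A * (C * Real.exp (-(c * ∑ j, e j ^ (2 * alg.order)))) := by
  have := isProbabilityMeasure_pairLaw hg
  have hsm := hg.smoothPolyGrowth
  have hK := constK_pos hg alg
  set K := constK alg g with hKdef
  obtain ⟨c, hc, hexp⟩ := exists_integral_exp_half_incr_le hg alg
  obtain ⟨d, hd, hmove⟩ := ((polyBound_move hsm alg).pow 4).exists_integral_abs_le hg
  -- The cap on the step sizes lets half of the decay `K / 8` absorb the error of the affinity. The
  -- distinguished factor is only bounded by `d + 1`; the constant `exp (K / 16)` makes up for its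
  -- missing exponential.
  refine ⟨(d + 1) * Real.exp (K / 16), K / 16, min 1 (K / (16 * (c + 1))), by positivity,
    by positivity, by positivity, min_le_left _ _, ?_⟩
  intro n e he i w hw0 A Δ hA
  have he1 : ∀ j, e j ∈ Set.Ioc (0 : ℝ) 1 := fun j => ⟨(he j).1, (he j).2.trans (min_le_left _ _)⟩
  have hexp' : ∀ j, ∫ p, Real.exp (incr alg g (e j) p / 2) ∂pairLaw g ≤
      Real.exp (-(K / 16 * e j ^ (2 * alg.order))) := by
    intro j
    have h1 := hexp _ (he1 j)
    have h2 : (c + 1) * e j ≤ K / 16 := by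
      have h3 := (he j).2.trans (min_le_right _ _)
      rw [le_div_iff₀ (by positivity)] at h3
      linarith
    have h3 : 0 < e j ^ (2 * alg.order) := pow_pos (he j).1 _
    have h4 := Real.add_one_le_exp (-(K / 16 * e j ^ (2 * alg.order)))
    rw [pow_succ] at h1
    have h5 : c * (e j ^ (2 * alg.order) * e j) ≤ e j ^ (2 * alg.order) * (K / 16) := by
      have h6 : c * e j ≤ K / 16 := by nlinarith [(he j).1]
      nlinarith
    linarith
  set f : Fin n → ℝ × ℝ → ℝ := fun j p =>
    (if j = i then move alg g (e i) p ^ 2 else 1) * Real.exp (incr alg g (e j) p / 2) with hf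
  -- A product is at most the sum of the squares of its factors; the first square has bounded mean
  -- and the second has mean one.
  have hbnd : ∀ p, move alg g (e i) p ^ 2 * Real.exp (incr alg g (e i) p / 2) ≤
      |move alg g (e i) p ^ 4| + Real.exp (incr alg g (e i) p) := fun p => by
    have h1 : Real.exp (incr alg g (e i) p) = Real.exp (incr alg g (e i) p / 2) ^ 2 := by
      rw [← Real.exp_nat_mul]
      ring_nf
    rw [h1, abs_of_nonneg (by positivity)]
    nlinarith [sq_nonneg (move alg g (e i) p ^ 2 - Real.exp (incr alg g (e i) p / 2)),
      sq_nonneg (move alg g (e i) p ^ 2), sq_nonneg (Real.exp (incr alg g (e i) p / 2))]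
  have ib : Integrable (fun p => |move alg g (e i) p ^ 4| + Real.exp (incr alg g (e i) p))
      (pairLaw g) :=
    (((polyBound_move hsm alg).pow 4).integrable hg (he1 i)
      ((continuous_move hsm alg (e i)).pow 4).aestronglyMeasurable).abs.add
      (integrable_exp_incr hg alg (he i).1)
  have hfi : ∀ j, Integrable (f j) (pairLaw g) := fun j => by
    by_cases h : j = i
    · subst h
      simp only [hf, if_true]
      have h1 := continuous_move hsm alg (e j)
      have h2 := continuous_incr hsm alg (e j)
      refine ib.mono' (by fun_prop) (ae_of_all _ fun p => ?_)
      rw [Real.norm_of_nonneg (by positivity)]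
      exact hbnd p
    · simp only [hf, h, if_false, one_mul]
      exact integrable_exp_half_incr hg alg (he j).1
  have hf0 : ∀ j p, 0 ≤ f j p := fun j p => by
    simp only [hf]
    split_ifs <;> positivity
  have hfle : ∀ j, ∫ p, f j p ∂pairLaw g ≤ (if j = i then (d + 1) * Real.exp (K / 16) else 1) *
      Real.exp (-(K / 16 * e j ^ (2 * alg.order))) := fun j => by
    by_cases h : j = i
    · subst h
      simp only [hf, if_true]
      have h1 : ∫ p, move alg g (e j) p ^ 2 * Real.exp (incr alg g (e j) p / 2) ∂pairLaw g ≤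
          d + 1 := by
        refine (integral_mono_of_nonneg (ae_of_all _ fun p => by positivity) ib
          (ae_of_all _ hbnd)).trans ?_
        rw [integral_add (((polyBound_move hsm alg).pow 4).integrable hg (he1 j)
          ((continuous_move hsm alg (e j)).pow 4).aestronglyMeasurable).abs
          (integrable_exp_incr hg alg (he j).1), integral_exp_incr hg alg (he j).1]
        linarith [hmove _ (he1 j)]
      rw [mul_assoc, ← Real.exp_add]
      refine h1.trans (le_mul_of_one_le_right (by positivity) (Real.one_le_exp ?_))
      have h2 : e j ^ (2 * alg.order) ≤ 1 := pow_le_one₀ (he1 j).1.le (he1 j).2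
      nlinarith
    · simp only [hf, h, if_false, one_mul]
      exact hexp' j
  have hA0 : 0 ≤ A := (mul_nonneg (hw0 _) (Real.exp_pos _).le).trans (hA fun _ => 0)
  calc ∫ ω, w (fun j => (ω j).1) * move alg g (e i) (ω i) ^ 2 *
          min 1 (Real.exp (Δ ω + ∑ j, incr alg g (e j) (ω j))) ∂productLaw g n
      ≤ ∫ ω, A * ∏ j, f j (ω j) ∂productLaw g n := by
        refine integral_mono_of_nonneg (ae_of_all _ fun ω => ?_)
          ((Integrable.fintype_prod hfi).const_mul A) (ae_of_all _ fun ω => ?_)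
        · exact mul_nonneg (mul_nonneg (hw0 _) (sq_nonneg _)) (min_one_exp_nonneg _)
        · have h1 : ∏ j, f j (ω j) = move alg g (e i) (ω i) ^ 2 *
              Real.exp ((∑ j, incr alg g (e j) (ω j)) / 2) := by
            simp only [hf, Finset.prod_mul_distrib, ← Real.exp_sum, Finset.sum_div]
            congr 1
            simp
          simp only
          rw [h1]
          calc _ ≤ w (fun j => (ω j).1) * move alg g (e i) (ω i) ^ 2 *
                Real.exp ((Δ ω + ∑ j, incr alg g (e j) (ω j)) / 2) :=
                mul_le_mul_of_nonneg_left (min_one_exp_le _)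
                  (mul_nonneg (hw0 _) (sq_nonneg _))
            _ = (w (fun j => (ω j).1) * Real.exp (Δ ω / 2)) * (move alg g (e i) (ω i) ^ 2 *
                Real.exp ((∑ j, incr alg g (e j) (ω j)) / 2)) := by
                rw [add_div, Real.exp_add]
                ring
            _ ≤ _ := mul_le_mul_of_nonneg_right (hA ω) (by positivity)
    _ = A * ∏ j, ∫ p, f j p ∂pairLaw g := by
        rw [integral_const_mul, productLaw, integral_fintype_prod_eq_prod]
    _ ≤ A * ∏ j, ((if j = i then (d + 1) * Real.exp (K / 16) else 1) *
          Real.exp (-(K / 16 * e j ^ (2 * alg.order)))) := by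
        refine mul_le_mul_of_nonneg_left (Finset.prod_le_prod (fun j _ => ?_)
          fun j _ => hfle j) hA0
        exact integral_nonneg (hf0 j)
    _ = _ := by
        rw [Finset.prod_mul_distrib, ← Real.exp_sum, Finset.sum_neg_distrib, ← Finset.mul_sum]
        simp

/-! ### The Gaussian acceptance rate -/

/-- The exponential is the likelihood ratio of two unit normal laws whose means differ by `r`. -/
lemma min_one_exp_mul_gaussianPDFReal (r x : ℝ) :
    gaussianPDFReal 0 1 x * min 1 (Real.exp (r * x - r ^ 2 / 2)) =
      min (gaussianPDFReal 0 1 x) (gaussianPDFReal r 1 x) := by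
  rw [mul_min_of_nonneg _ _ (gaussianPDFReal_nonneg _ _ _), mul_one]
  congr 1
  simp only [gaussianPDFReal, mul_assoc, ← Real.exp_add]
  congr 3
  simp
  ring

lemma gaussianReal_real_Iic (m : ℝ) (x : ℝ) :
    (gaussianReal m 1).real (Set.Iic x) = cdf (gaussianReal 0 1) (x - m) := by
  have h := gaussianReal_map_const_add (μ := 0) (v := 1) m
  rw [zero_add] at h
  rw [cdf_eq_real, ← h, map_measureReal_apply (by fun_prop) measurableSet_Iic]
  congr 1
  ext y
  simp only [Set.mem_preimage, Set.mem_Iic]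
  constructor <;> intro <;> linarith

lemma gaussianReal_real_Ioi (x : ℝ) :
    (gaussianReal 0 1).real (Set.Ioi x) = cdf (gaussianReal 0 1) (-x) := by
  have h := gaussianReal_map_neg (μ := 0) (v := 1)
  rw [neg_zero] at h
  have := nullSingletonClass_gaussianReal (μ := 0) (v := 1) one_ne_zero
  rw [cdf_eq_real]
  nth_rewrite 1 [← h]
  rw [map_measureReal_apply (by fun_prop) measurableSet_Ioi]
  have h1 : (fun y : ℝ => -y) ⁻¹' Set.Ioi x = Set.Iio (-x) := by
    ext y
    simp only [Set.mem_preimage, Set.mem_Iio, Set.mem_Ioi]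
    constructor <;> intro <;> linarith
  rw [h1]
  exact measureReal_congr Iio_ae_eq_Iic

lemma setIntegral_gaussianPDFReal (m : ℝ) (S : Set ℝ) :
    ∫ x in S, gaussianPDFReal m 1 x = (gaussianReal m 1).real S := by
  rw [measureReal_def, gaussianReal_apply_eq_integral _ one_ne_zero,
    ENNReal.toReal_ofReal (integral_nonneg fun _ => gaussianPDFReal_nonneg _ _ _)]

/-- After rescaling to unit variance the integral is the overlap of the normal densities centred at
`0` and `r`. They cross at `r / 2`, and each side contributes a tail `Φ(-r / 2)`. -/
lemma gaussianAccept_sq {r : ℝ} (hr : 0 ≤ r) :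
    gaussianAccept (r ^ 2) = 2 * cdf (gaussianReal 0 1) (-(r / 2)) := by
  have hmap : gaussianReal 0 (r ^ 2).toNNReal = (gaussianReal 0 1).map (fun x => r * x) := by
    rw [gaussianReal_map_const_mul, mul_zero, mul_one]
    congr 1
    exact Real.toNNReal_of_nonneg (sq_nonneg r)
  have h1 : gaussianAccept (r ^ 2) =
      ∫ x, min (gaussianPDFReal 0 1 x) (gaussianPDFReal r 1 x) := by
    rw [gaussianAccept, hmap, integral_map (by fun_prop) (by fun_prop),
      integral_gaussianReal_eq_integral_smul one_ne_zero]
    simp only [smul_eq_mul, min_one_exp_mul_gaussianPDFReal]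
  have hcmp : ∀ x, gaussianPDFReal r 1 x ≤ gaussianPDFReal 0 1 x ↔
      r * x - r ^ 2 / 2 ≤ 0 := fun x => by
    simp only [gaussianPDFReal]
    rw [mul_le_mul_iff_right₀ (by positivity), Real.exp_le_exp]
    simp only [NNReal.coe_one]
    constructor <;> intro h <;> nlinarith
  have hi : Integrable fun x => min (gaussianPDFReal 0 1 x) (gaussianPDFReal r 1 x) :=
    (integrable_gaussianPDFReal 0 1).inf (integrable_gaussianPDFReal r 1)
  rw [h1, ← integral_add_compl (measurableSet_Iic (a := r / 2)) hi]
  have h2 : ∫ x in Set.Iic (r / 2), min (gaussianPDFReal 0 1 x) (gaussianPDFReal r 1 x) =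
      ∫ x in Set.Iic (r / 2), gaussianPDFReal r 1 x :=
    setIntegral_congr_fun measurableSet_Iic fun x hx => min_eq_right ((hcmp x).2 (by
      have : x ≤ r / 2 := hx
      nlinarith))
  have h3 : ∫ x in (Set.Iic (r / 2))ᶜ, min (gaussianPDFReal 0 1 x) (gaussianPDFReal r 1 x) =
      ∫ x in Set.Ioi (r / 2), gaussianPDFReal 0 1 x := by
    rw [Set.compl_Iic]
    refine setIntegral_congr_fun measurableSet_Ioi fun x hx => ?_
    have hx' : r / 2 < x := hx
    -- For `r = 0` the densities coincide, and the comparison beyond the crossing point is not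
    -- strict.
    rcases hr.eq_or_lt with h0 | h0
    · subst h0
      exact min_self _
    · refine min_eq_left (le_of_not_ge fun h => ?_)
      have := (hcmp x).1 h
      nlinarith
  rw [h2, h3, setIntegral_gaussianPDFReal,
    setIntegral_gaussianPDFReal, gaussianReal_real_Iic, gaussianReal_real_Ioi]
  ring_nf

/-! ### Product measures with densities -/

lemma lintegral_prod_eval {n : ℕ} (μ : Fin n → Measure ℝ) [∀ i, SigmaFinite (μ i)]
    {f : Fin n → ℝ → ENNReal} (hf : ∀ i, Measurable (f i)) :
    ∫⁻ x, ∏ i, f i (x i) ∂Measure.pi μ = ∏ i, ∫⁻ x, f i x ∂μ i := by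
  induction n with
  | zero => simp
  | succ n ih =>
    rw [← ((measurePreserving_piFinSuccAbove μ 0).symm).lintegral_comp
      (f := fun x => ∏ i, f i (x i))
      (Finset.measurable_prod _ fun i _ => (hf i).comp (measurable_pi_apply i))]
    simp_rw [MeasurableEquiv.piFinSuccAbove_symm_apply, Fin.insertNthEquiv,
      Fin.prod_univ_succ, Fin.insertNth_zero, Equiv.coe_fn_mk, Fin.cons_succ,
      Fin.zero_succAbove, cast_eq, Fin.cons_zero]
    rw [lintegral_prod_mul (f := f 0) (g := fun y : Fin n → ℝ => ∏ i, f i.succ (y i))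
      (hf 0).aemeasurable (Finset.measurable_prod _ fun i _ =>
        (hf i.succ).comp (measurable_pi_apply i)).aemeasurable,
      ih (fun i => μ i.succ) fun i => hf i.succ]

lemma pi_withDensity {n : ℕ} (μ : Fin n → Measure ℝ) [∀ i, SigmaFinite (μ i)]
    {f : Fin n → ℝ → ENNReal} (hf : ∀ i, Measurable (f i))
    [∀ i, SigmaFinite ((μ i).withDensity (f i))] :
    Measure.pi (fun i => (μ i).withDensity (f i)) =
      (Measure.pi μ).withDensity fun x => ∏ i, f i (x i) := by
  refine Measure.pi_eq fun s hs => ?_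
  rw [withDensity_apply _ (MeasurableSet.univ_pi hs), ← lintegral_indicator
    (MeasurableSet.univ_pi hs)]
  have h1 : ∀ x : Fin n → ℝ, (Set.univ.pi s).indicator (fun x => ∏ i, f i (x i)) x =
      ∏ i, (s i).indicator (f i) (x i) := fun x => by
    by_cases h : x ∈ Set.univ.pi s
    · rw [Set.indicator_of_mem h]
      exact Finset.prod_congr rfl fun i _ => (Set.indicator_of_mem (h i trivial) _).symm
    · rw [Set.indicator_of_notMem h]
      simp only [Set.mem_pi, Set.mem_univ, true_implies, not_forall] at h
      obtain ⟨i, hi⟩ := h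
      exact (Finset.prod_eq_zero (Finset.mem_univ i) (Set.indicator_of_notMem hi _)).symm
  simp only [h1]
  rw [lintegral_prod_eval μ fun i => (hf i).indicator (hs i)]
  exact Finset.prod_congr rfl fun i _ => by
    rw [lintegral_indicator (hs i), withDensity_apply _ (hs i)]

/-- The product of the Radon–Nikodym derivatives is a density of the one product measure with
respect to the other. -/
lemma pi_absolutelyContinuous {n : ℕ} {μ ν : Fin n → Measure ℝ} [∀ i, SigmaFinite (μ i)]
    [∀ i, SigmaFinite (ν i)] (h : ∀ i, μ i ≪ ν i) : Measure.pi μ ≪ Measure.pi ν := by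
  have h1 : μ = fun i => (ν i).withDensity ((μ i).rnDeriv (ν i)) :=
    funext fun i => (Measure.withDensity_rnDeriv_eq _ _ (h i)).symm
  have h2 : ∀ i, SigmaFinite ((ν i).withDensity ((μ i).rnDeriv (ν i))) := fun i => by
    rw [Measure.withDensity_rnDeriv_eq _ _ (h i)]
    infer_instance
  have h3 := pi_withDensity ν fun i => Measure.measurable_rnDeriv (μ i) (ν i)
  rw [← h1] at h3
  rw [h3]
  exact withDensity_absolutelyContinuous _ _

/-! ### The reference law in the scaled coordinates -/

lemma scale_pos (κ : ℝ) (i : ℕ) : 0 < scale κ i := Real.rpow_pos_of_pos (by positivity) _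

lemma refDensity_pos (g : ℝ → ℝ) (κ : ℝ) {n : ℕ} (x : Fin n → ℝ) : 0 < refDensity g κ x :=
  Finset.prod_pos fun i _ =>
    mul_pos (one_div_pos.2 (scale_pos κ i)) (Real.exp_pos _)

lemma measurable_refDensity {g : ℝ → ℝ} (hg : Continuous g) (κ : ℝ) {n : ℕ} :
    Measurable fun x : Fin n → ℝ => refDensity g κ x := by
  unfold refDensity
  exact Finset.measurable_prod _ fun i _ =>
    ((hg.measurable.comp ((measurable_pi_apply i).div_const _)).neg.exp).const_mul _

lemma map_mul_withDensity {a : ℝ} (ha : 0 < a) {f : ℝ → ENNReal} (hf : Measurable f) :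
    ((volume : Measure ℝ).withDensity f).map (fun u => a * u) =
      volume.withDensity fun x => ENNReal.ofReal (1 / a) * f (x / a) := by
  refine Measure.ext_of_lintegral _ fun F hF => ?_
  rw [lintegral_map hF (by fun_prop), lintegral_withDensity_eq_lintegral_mul _ hf (by fun_prop),
    lintegral_withDensity_eq_lintegral_mul _ (by fun_prop) hF]
  have h1 : ∀ u, (f * fun u => F (a * u)) u = (fun x => f (x / a) * F x) (a * u) := fun u => by
    simp only [Pi.mul_apply]
    rw [mul_div_cancel_left₀ _ ha.ne']
  simp only [h1]
  have h2 : Measurable fun x => f (x / a) * F x := by fun_prop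
  rw [← lintegral_map (f := fun x => f (x / a) * F x) (g := fun u => a * u) h2 (by fun_prop),
    Real.map_volume_mul_left ha.ne', lintegral_smul_measure, smul_eq_mul, ← lintegral_const_mul _ h2]
  simp only [Pi.mul_apply, mul_assoc, abs_of_pos (inv_pos.2 ha), one_div]

/-- The point of scaled coordinates `(ω j).1`. -/
noncomputable def startPoint (κ : ℝ) {n : ℕ} (ω : Fin n → ℝ × ℝ) : Fin n → ℝ :=
  fun j => scale κ j * (ω j).1

/-- The proposal from `startPoint κ ω` with the Gaussian increments `(ω j).2`. -/
noncomputable def endPoint (alg : Algorithm) (g : ℝ → ℝ) (κ σ : ℝ) {n : ℕ}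
    (ω : Fin n → ℝ × ℝ) : Fin n → ℝ :=
  fun j => scale κ j * ((ω j).1 + σ / scale κ j * move alg g (σ / scale κ j) (ω j))

lemma measurable_startPoint (κ : ℝ) {n : ℕ} : Measurable (startPoint κ (n := n)) := by
  unfold startPoint
  fun_prop

section Reference

variable {g : ℝ → ℝ} (hg : IsRegularLogDensity g) (κ : ℝ)
include hg

/-- The coordinates scaled to the reference law. -/
lemma map_scale_eq_refMeasure (n : ℕ) :
    (Measure.pi fun _ : Fin n => marginal g).map (fun u (j : Fin n) => scale κ j * u j) =
      refMeasure g κ n := by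
  have := isProbabilityMeasure_marginal hg
  have hc := hg.smoothPolyGrowth.continuous
  have hpr : ∀ j : Fin n, IsProbabilityMeasure ((marginal g).map fun u => scale κ j * u) :=
    fun j => Measure.isProbabilityMeasure_map (by fun_prop)
  rw [Measure.pi_map_pi (f := fun (j : Fin n) u => scale κ j * u) fun _ => by fun_prop]
  have h1 : (fun j : Fin n => (marginal g).map fun u => scale κ j * u) = fun j : Fin n =>
      (volume : Measure ℝ).withDensity fun x =>
        ENNReal.ofReal (1 / scale κ j * Real.exp (-g (x / scale κ j))) := by
    funext j
    rw [marginal, map_mul_withDensity (scale_pos κ j) (measurable_ofReal_exp_neg hc)]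
    simp only [ENNReal.ofReal_mul (one_div_pos.2 (scale_pos κ j)).le]
  have h2 : ∀ j : Fin n, IsProbabilityMeasure ((volume : Measure ℝ).withDensity fun x =>
      ENNReal.ofReal (1 / scale κ j * Real.exp (-g (x / scale κ j)))) := fun j => by
    rw [← show (marginal g).map (fun u => scale κ j * u) = _ from congrFun h1 j]
    exact hpr j
  simp only [h1]
  rw [pi_withDensity (fun _ => (volume : Measure ℝ)) (fun j => by fun_prop)]
  rw [refMeasure, ← volume_pi]
  congr 1
  funext x
  rw [refDensity, ENNReal.ofReal_prod_of_nonneg]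
  exact fun i _ => (mul_pos (one_div_pos.2 (scale_pos κ i)) (Real.exp_pos _)).le

lemma volume_absolutelyContinuous_refMeasure (n : ℕ) :
    (volume : Measure (Fin n → ℝ)) ≪ refMeasure g κ n :=
  withDensity_absolutelyContinuous'
    (measurable_refDensity hg.smoothPolyGrowth.continuous κ).ennreal_ofReal.aemeasurable
    (ae_of_all _ fun x => (ENNReal.ofReal_pos.2 (refDensity_pos g κ x)).ne')

lemma map_productLaw_eq (n : ℕ) :
    (productLaw g n).map (fun ω => (startPoint κ ω, fun j => (ω j).2)) =
      (refMeasure g κ n).prod (Measure.pi fun _ => gaussianReal 0 1) := by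
  have := isProbabilityMeasure_marginal hg
  have h1 := (measurePreserving_arrowProdEquivProdArrow ℝ ℝ (Fin n) (fun _ => marginal g)
    fun _ => gaussianReal 0 1).map_eq
  have h2 := Measure.map_prod_map (Measure.pi fun _ : Fin n => marginal g)
    (Measure.pi fun _ : Fin n => gaussianReal 0 1) (f := fun u (j : Fin n) => scale κ j * u j)
    (g := id) (by fun_prop) measurable_id
  rw [map_scale_eq_refMeasure hg, Measure.map_id, ← h1,
    Measure.map_map (by fun_prop) (MeasurableEquiv.measurable _)] at h2
  exact h2.symm

lemma map_startPoint_eq (n : ℕ) :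
    (productLaw g n).map (startPoint κ) = refMeasure g κ n := by
  have h1 := map_productLaw_eq hg κ n
  have h2 := congrArg (Measure.map Prod.fst) h1
  rw [Measure.map_map (by fun_prop) (by unfold startPoint; fun_prop), Measure.map_fst_prod,
    measure_univ, one_smul] at h2
  exact h2

/-- The law of the proposal is absolutely continuous. -/
lemma map_endPoint_absolutelyContinuous (alg : Algorithm) {σ : ℝ} (hσ : 0 < σ) (n : ℕ) :
    (productLaw g n).map (endPoint alg g κ σ) ≪ refMeasure g κ n := by
  have := isProbabilityMeasure_pairLaw hg
  have hc := hg.smoothPolyGrowth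
  -- The reference density is positive, so it suffices to compare with Lebesgue measure, and that
  -- can be done one coordinate at a time.
  refine Measure.AbsolutelyContinuous.trans ?_ (volume_absolutelyContinuous_refMeasure hg κ n)
  have hm : ∀ j : Fin n, Measurable fun p : ℝ × ℝ => scale κ j * (p.1 + σ / scale κ j *
      move alg g (σ / scale κ j) p) := fun j => by
    have := (continuous_move hc alg (σ / scale κ j)).measurable
    fun_prop
  have hpr : ∀ j : Fin n, IsProbabilityMeasure ((pairLaw g).map fun p => scale κ j *
      (p.1 + σ / scale κ j * move alg g (σ / scale κ j) p)) :=
    fun j => Measure.isProbabilityMeasure_map (hm j).aemeasurable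
  unfold endPoint
  rw [productLaw, Measure.pi_map_pi (f := fun (j : Fin n) (p : ℝ × ℝ) => scale κ j *
    (p.1 + σ / scale κ j * move alg g (σ / scale κ j) p)) fun j => (hm j).aemeasurable, volume_pi]
  refine pi_absolutelyContinuous fun j => ?_
  have hε : 0 < σ / scale κ j := div_pos hσ (scale_pos κ j)
  have h2 : (fun p : ℝ × ℝ => scale κ j * (p.1 + σ / scale κ j *
      move alg g (σ / scale κ j) p)) = (fun v => scale κ j * v) ∘ Prod.snd ∘
        fun p => (p.1, p.1 + σ / scale κ j * move alg g (σ / scale κ j) p) := rfl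
  have hmm := (continuous_move hc alg (σ / scale κ j)).measurable
  rw [h2, ← Measure.map_map (by fun_prop) (by fun_prop), ← Measure.map_map (by fun_prop)
    (by fun_prop), map_move_eq hg alg hε]
  have h3 : Measure.QuasiMeasurePreserving (fun v : ℝ => scale κ j * v) volume volume :=
    ⟨by fun_prop, by
      rw [Real.map_volume_mul_left (scale_pos κ j).ne']
      exact Measure.smul_absolutelyContinuous⟩
  refine ((withDensity_absolutelyContinuous _ _).map (measurable_snd)).map (by fun_prop) |>.trans ?_
  refine (Measure.AbsolutelyContinuous.map ?_ h3.1).trans h3.2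
  rw [Measure.volume_eq_prod]
  exact Measure.quasiMeasurePreserving_snd.2

end Reference

/-! ### The acceptance probability in the scaled coordinates -/

lemma refDensity_update (g : ℝ → ℝ) (κ : ℝ) {n : ℕ} (x : Fin n → ℝ) (i : Fin n) (t : ℝ) :
    refDensity g κ (Function.update x i t) =
      refDensity g κ x * Real.exp (g (x i / scale κ i) - g (t / scale κ i)) := by
  have h1 : ∀ j : Fin n, 1 / scale κ j * Real.exp (-g (Function.update x i t j / scale κ j)) =
      1 / scale κ j * Real.exp (-g (x j / scale κ j)) *
        if j = i then Real.exp (g (x i / scale κ i) - g (t / scale κ i)) else 1 := fun j => by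
    by_cases h : j = i
    · subst h
      rw [Function.update_self, if_pos rfl, mul_assoc, ← Real.exp_add]
      ring_nf
    · rw [Function.update_of_ne h, if_neg h, mul_one]
  simp only [refDensity, h1, Finset.prod_mul_distrib, Finset.prod_ite_eq', Finset.mem_univ,
    if_true]

lemma gradLogRef_eq {g : ℝ → ℝ} (hg : SmoothPolyGrowth g) (κ : ℝ) {n : ℕ} (x : Fin n → ℝ)
    (i : Fin n) : gradLogRef g κ x i = -(deriv g (x i / scale κ i) / scale κ i) := by
  have h1 : (fun t => Real.log (refDensity g κ (Function.update x i t))) = fun t =>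
      Real.log (refDensity g κ x) + (g (x i / scale κ i) - g (t / scale κ i)) := by
    funext t
    rw [refDensity_update, Real.log_mul (refDensity_pos g κ x).ne' (Real.exp_ne_zero _),
      Real.log_exp]
  have h2 : HasDerivAt (fun t => g (t / scale κ i)) (deriv g (x i / scale κ i) *
      (1 / scale κ i)) (x i) :=
    (hg.hasDerivAt (x i / scale κ i)).comp (x i) ((hasDerivAt_id (x i)).div_const _)
  rw [gradLogRef, h1, ((h2.const_sub _).const_add _).deriv]
  ring

lemma proposalMean_eq {g : ℝ → ℝ} (hg : SmoothPolyGrowth g) (alg : Algorithm) {κ σ : ℝ} {n : ℕ}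
    (x : Fin n → ℝ) (i : Fin n) : proposalMean alg g κ σ x i = scale κ i * (x i / scale κ i +
      (σ / scale κ i) ^ 2 * drift alg g (x i / scale κ i)) := by
  have := (scale_pos κ i).ne'
  cases alg
  · simp only [proposalMean, drift]
    field_simp
    ring
  · simp only [proposalMean, drift, gradLogRef_eq hg]
    field_simp

lemma proposal_eq {g : ℝ → ℝ} (hg : SmoothPolyGrowth g) (alg : Algorithm) {κ σ : ℝ} {n : ℕ}
    (x z : Fin n → ℝ) (i : Fin n) : proposal alg g κ σ x z i =
      x i + σ * move alg g (σ / scale κ i) (x i / scale κ i, z i) := by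
  have := (scale_pos κ i).ne'
  simp only [proposal, proposalMean_eq hg, move]
  field_simp
  ring

/-- Detailed balance for one coordinate of scale `a`: in units of `a` the step size is `σ / a`, and
the Gaussian exponents are unchanged by the scaling. -/
lemma mul_gaussianPDFReal_eq {g : ℝ → ℝ} (alg : Algorithm) {σ a : ℝ} (hσ : 0 < σ) (ha : 0 < a)
    (u v : ℝ) : 1 / a * Real.exp (-g v) * gaussianPDFReal (a * (v + (σ / a) ^ 2 * drift alg g v))
        ⟨σ ^ 2, sq_nonneg σ⟩ (a * u) =
      1 / a * Real.exp (-g u) * gaussianPDFReal (a * (u + (σ / a) ^ 2 * drift alg g u))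
        ⟨σ ^ 2, sq_nonneg σ⟩ (a * v) * Real.exp (logRatio alg g (σ / a) u v) := by
  have h1 := gaussianPDFReal_mul_exp (ε := σ) (a * (u + (σ / a) ^ 2 * drift alg g u))
    (a * (v + (σ / a) ^ 2 * drift alg g v)) (a * v) (a * u)
  have h2 : Real.exp (-g v) = Real.exp (-g u) * Real.exp (g u - g v) := by
    rw [← Real.exp_add]; ring_nf
  have h3 : logRatio alg g (σ / a) u v = (g u - g v) +
      ((a * v - a * (u + (σ / a) ^ 2 * drift alg g u)) ^ 2 -
        (a * u - a * (v + (σ / a) ^ 2 * drift alg g v)) ^ 2) / (2 * σ ^ 2) := by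
    rw [logRatio]
    have := hσ.ne'
    have := ha.ne'
    field_simp
  rw [h3, Real.exp_add, h2]
  change _ = 1 / a * Real.exp (-g u) * gaussianPDFReal _ (NNReal.mk (σ ^ 2) (sq_nonneg σ)) _ * _
  rw [show gaussianPDFReal (a * (v + (σ / a) ^ 2 * drift alg g v))
    ⟨σ ^ 2, sq_nonneg σ⟩ (a * u) = _ from h1.symm]
  ring

lemma proposalDensity_pos (alg : Algorithm) (g : ℝ → ℝ) (κ : ℝ) {σ : ℝ} (hσ : 0 < σ) {n : ℕ}
    (x y : Fin n → ℝ) : 0 < proposalDensity alg g κ σ x y :=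
  Finset.prod_pos fun _ _ => gaussianPDFReal_pos _ _ _ fun h =>
    pow_ne_zero 2 hσ.ne' (congrArg NNReal.toReal h)

/-- All densities are positive, so the degenerate branch never occurs, and the product structure
turns the ratio into an exponential of a sum over coordinates. -/
lemma acceptProb_eq {g : ℝ → ℝ} (hg : SmoothPolyGrowth g) (alg : Algorithm) (κ : ℝ) {σ : ℝ}
    (hσ : 0 < σ) {n : ℕ} (φ : (Fin n → ℝ) → ℝ) (x y : Fin n → ℝ) :
    acceptProb alg g κ σ φ x y = min 1 (Real.exp (φ x - φ y + ∑ j : Fin n,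
      logRatio alg g (σ / scale κ j) (x j / scale κ j) (y j / scale κ j))) := by
  have hpos : ∀ x y : Fin n → ℝ,
      0 < targetDensity g κ φ x * proposalDensity alg g κ σ x y := fun x y =>
    mul_pos (mul_pos (Real.exp_pos _) (refDensity_pos g κ x)) (proposalDensity_pos alg g κ hσ x y)
  rw [acceptProb, if_pos (hpos x y)]
  congr 1
  rw [div_eq_iff (hpos x y).ne']
  have h1 : refDensity g κ y * proposalDensity alg g κ σ y x =
      refDensity g κ x * proposalDensity alg g κ σ x y * ∏ j : Fin n, Real.exp (
        logRatio alg g (σ / scale κ j) (x j / scale κ j) (y j / scale κ j)) := by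
    simp only [refDensity, proposalDensity, ← Finset.prod_mul_distrib]
    refine Finset.prod_congr rfl fun j _ => ?_
    have h2 := mul_gaussianPDFReal_eq (g := g) alg hσ (scale_pos κ j) (x j / scale κ j)
      (y j / scale κ j)
    rw [mul_div_cancel₀ _ (scale_pos κ j).ne', mul_div_cancel₀ _ (scale_pos κ j).ne',
      ← proposalMean_eq hg, ← proposalMean_eq hg] at h2
    exact h2
  have h3 : Real.exp (-φ y) = Real.exp (-φ x) * Real.exp (φ x - φ y) := by
    rw [← Real.exp_add]; ring_nf
  rw [targetDensity, targetDensity, mul_assoc, h1, Real.exp_add, Real.exp_sum, h3]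
  ring

/-! ### The mean squared jump in the scaled coordinates -/

lemma setIntegral_Icc_ite_le {a : ℝ} (h0 : 0 ≤ a) (h1 : a ≤ 1) (c : ℝ) :
    ∫ u in Set.Icc (0 : ℝ) 1, (if u ≤ a then c else 0) = a * c := by
  have h2 : (fun u : ℝ => if u ≤ a then c else 0) = (Set.Iic a).indicator fun _ => c := by
    funext u
    simp [Set.indicator_apply]
  have h3 : Set.Icc (0 : ℝ) 1 ∩ Set.Iic a = Set.Icc 0 a := by
    ext u
    simp only [Set.mem_inter_iff, Set.mem_Icc, Set.mem_Iic]
    constructor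
    · rintro ⟨⟨h, _⟩, h'⟩
      exact ⟨h, h'⟩
    · rintro ⟨h, h'⟩
      exact ⟨⟨h, h'.trans h1⟩, h'⟩
  rw [h2, setIntegral_indicator measurableSet_Iic, h3, setIntegral_const, smul_eq_mul]
  simp [Measure.real, h0]

lemma sqJump_eq {g : ℝ → ℝ} (alg : Algorithm) (κ : ℝ) {σ : ℝ} {n : ℕ}
    (φ : (Fin n → ℝ) → ℝ) (i : Fin n) (w : ((Fin n → ℝ) × (Fin n → ℝ)) × ℝ) :
    sqJump alg g κ σ φ i w =
      if w.2 ≤ acceptProb alg g κ σ φ w.1.1 (proposal alg g κ σ w.1.1 w.1.2) then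
        (proposal alg g κ σ w.1.1 w.1.2 i - w.1.1 i) ^ 2 else 0 := by
  rw [sqJump, mhStep]
  split_ifs <;> simp

section Reduction

variable {g : ℝ → ℝ} (hg : IsRegularLogDensity g) (alg : Algorithm) (κ : ℝ) {σ : ℝ} (hσ : 0 < σ)
  {n : ℕ}
include hg

lemma measurable_endPoint : Measurable (endPoint alg g κ σ (n := n)) := by
  unfold endPoint
  refine measurable_pi_lambda _ fun j => ?_
  have := (continuous_move hg.smoothPolyGrowth alg (σ / scale κ j)).measurable
  fun_prop

lemma measurable_proposal (i : Fin n) : Measurable fun p : (Fin n → ℝ) × (Fin n → ℝ) =>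
    proposal alg g κ σ p.1 p.2 i := by
  simp only [proposal_eq hg.smoothPolyGrowth]
  have := (continuous_move hg.smoothPolyGrowth alg (σ / scale κ i)).measurable
  fun_prop

lemma endPoint_eq (ω : Fin n → ℝ × ℝ) :
    proposal alg g κ σ (startPoint κ ω) (fun j => (ω j).2) = endPoint alg g κ σ ω := by
  funext j
  have := (scale_pos κ j).ne'
  rw [proposal_eq hg.smoothPolyGrowth, startPoint, endPoint, mul_div_cancel_left₀ _ this]
  field_simp

include hσ

lemma acceptProb_startPoint (φ : (Fin n → ℝ) → ℝ) (ω : Fin n → ℝ × ℝ) :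
    acceptProb alg g κ σ φ (startPoint κ ω) (endPoint alg g κ σ ω) =
      min 1 (Real.exp (φ (startPoint κ ω) - φ (endPoint alg g κ σ ω) +
        ∑ j : Fin n, incr alg g (σ / scale κ j) (ω j))) := by
  rw [acceptProb_eq hg.smoothPolyGrowth alg κ hσ]
  congr 4
  funext j
  have := (scale_pos κ j).ne'
  rw [startPoint, endPoint, mul_div_cancel_left₀ _ this, mul_div_cancel_left₀ _ this, incr]

lemma measurable_acceptProb {φ : (Fin n → ℝ) → ℝ} (hφ : Measurable φ) :
    Measurable fun p : (Fin n → ℝ) × (Fin n → ℝ) =>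
      acceptProb alg g κ σ φ p.1 (proposal alg g κ σ p.1 p.2) := by
  simp only [acceptProb_eq hg.smoothPolyGrowth alg κ hσ]
  have h1 : Measurable fun p : (Fin n → ℝ) × (Fin n → ℝ) => proposal alg g κ σ p.1 p.2 :=
    measurable_pi_lambda _ fun i => measurable_proposal hg alg κ i
  refine measurable_const.min ((((hφ.comp measurable_fst).sub (hφ.comp h1)).add
    (Finset.measurable_sum _ fun j _ => ?_)).exp)
  have h2 := measurable_proposal hg alg κ (σ := σ) j
  exact (continuous_logRatio hg.smoothPolyGrowth alg (σ / scale κ j)).measurable.comp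
    (f := fun p : (Fin n → ℝ) × (Fin n → ℝ) =>
      (p.1 j / scale κ j, proposal alg g κ σ p.1 p.2 j / scale κ j)) (by fun_prop)

lemma integrable_endPoint_sub_sq (hσ1 : ∀ j : Fin n, σ / scale κ j ≤ 1) (i : Fin n) :
    Integrable (fun p => (proposal alg g κ σ p.1 p.2 i - p.1 i) ^ 2)
      ((refMeasure g κ n).prod (Measure.pi fun _ => gaussianReal 0 1)) := by
  have := isProbabilityMeasure_pairLaw hg
  have hm := measurable_proposal hg alg κ (σ := σ) i
  have hT : Measurable fun ω : Fin n → ℝ × ℝ => (startPoint κ ω, fun j => (ω j).2) :=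
    (measurable_startPoint κ).prodMk (by fun_prop)
  rw [← map_productLaw_eq hg, integrable_map_measure (by fun_prop) hT.aemeasurable]
  have h1 : ((fun p : (Fin n → ℝ) × (Fin n → ℝ) => (proposal alg g κ σ p.1 p.2 i - p.1 i) ^ 2) ∘
      fun ω : Fin n → ℝ × ℝ => (startPoint κ ω, fun j => (ω j).2)) =
      fun ω => σ ^ 2 * move alg g (σ / scale κ i) (ω i) ^ 2 := by
    funext ω
    simp only [Function.comp, proposal_eq hg.smoothPolyGrowth]
    rw [startPoint, mul_div_cancel_left₀ _ (scale_pos κ i).ne']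
    ring
  rw [h1]
  exact (integrable_comp_eval (μ := fun _ : Fin n => pairLaw g) (i := i)
    (integrable_move_sq hg alg ⟨div_pos hσ (scale_pos κ i), hσ1 i⟩)).const_mul _

variable {φ : (Fin n → ℝ) → ℝ} (hφ : Measurable φ) {M : ℝ}
  (hM : ∀ᵐ x ∂refMeasure g κ n, M ≤ φ x)
include hφ

omit hσ in
lemma target_prod_eq : (target g κ φ).prod (Measure.pi fun _ : Fin n => gaussianReal 0 1) =
    ((refMeasure g κ n).prod (Measure.pi fun _ => gaussianReal 0 1)).withDensity
      fun p => ENNReal.ofReal (Real.exp (-φ p.1)) := by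
  have : IsProbabilityMeasure (refMeasure g κ n) := by
    have := isProbabilityMeasure_marginal hg
    rw [← map_scale_eq_refMeasure hg]
    exact Measure.isProbabilityMeasure_map
      (by fun_prop : Measurable fun (u : Fin n → ℝ) (j : Fin n) => scale κ j * u j).aemeasurable
  exact prod_withDensity_left hφ.neg.exp.ennreal_ofReal

include hM

lemma integrable_proposal_sub_sq (hσ1 : ∀ j : Fin n, σ / scale κ j ≤ 1) (i : Fin n) :
    Integrable (fun p => (proposal alg g κ σ p.1 p.2 i - p.1 i) ^ 2)
      ((target g κ φ).prod (Measure.pi fun _ => gaussianReal 0 1)) := by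
  rw [target_prod_eq hg κ hφ, integrable_withDensity_iff_integrable_smul' (by fun_prop)
    (ae_of_all _ fun _ => ENNReal.ofReal_lt_top)]
  have hM' : ∀ᵐ p : (Fin n → ℝ) × (Fin n → ℝ) ∂(refMeasure g κ n).prod (Measure.pi fun _ => gaussianReal 0 1),
      M ≤ φ p.1 := Measure.quasiMeasurePreserving_fst.ae hM
  refine (integrable_endPoint_sub_sq hg alg κ hσ hσ1 i).bdd_mul (c := Real.exp (-M))
    (hφ.comp measurable_fst).neg.exp.ennreal_ofReal.ennreal_toReal.aestronglyMeasurable ?_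
  filter_upwards [hM'] with p hp
  rw [ENNReal.toReal_ofReal (Real.exp_pos _).le, Real.norm_of_nonneg (Real.exp_pos _).le]
  exact Real.exp_le_exp.2 (neg_le_neg hp)

lemma integrable_sqJump (hσ1 : ∀ j : Fin n, σ / scale κ j ≤ 1) (i : Fin n) :
    Integrable (sqJump alg g κ σ φ i) (stepLaw g κ φ) := by
  have h1 := (integrable_proposal_sub_sq hg alg κ hσ hφ hM hσ1 i).comp_fst
    (volume.restrict (Set.Icc (0 : ℝ) 1))
  refine h1.mono' (Measurable.aestronglyMeasurable ?_) (ae_of_all _ fun w => ?_)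
  · have h2 := measurable_acceptProb hg alg κ hσ hφ
    have h3 := measurable_proposal hg alg κ (σ := σ) i
    rw [show sqJump alg g κ σ φ i = _ from funext (sqJump_eq alg κ φ i)]
    refine Measurable.ite (measurableSet_le measurable_snd (h2.comp measurable_fst)) ?_
      measurable_const
    exact ((h3.comp measurable_fst).sub (by fun_prop)).pow_const 2
  · rw [sqJump_eq alg κ]
    split_ifs
    · rw [Real.norm_of_nonneg (sq_nonneg _)]
    · rw [norm_zero]
      exact sq_nonneg _

/-- Integrating out the uniform variable replaces the acceptance event by its probability. The rest
is a change of variables to scaled coordinates, where the jump of a coordinate is `σ` times its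
move. -/
lemma integral_sqJump_eq (hP : IsProbabilityMeasure (target g κ φ))
    (hσ1 : ∀ j : Fin n, σ / scale κ j ≤ 1) (i : Fin n) :
    ∫ w, sqJump alg g κ σ φ i w ∂stepLaw g κ φ = σ ^ 2 * ∫ ω, Real.exp (-φ (startPoint κ ω)) *
      move alg g (σ / scale κ i) (ω i) ^ 2 * min 1 (Real.exp (φ (startPoint κ ω) -
        φ (endPoint alg g κ σ ω) + ∑ j : Fin n, incr alg g (σ / scale κ j) (ω j))) ∂productLaw g n := by
  have h1 := integrable_sqJump hg alg κ hσ hφ hM hσ1 i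
  have h2 := measurable_acceptProb hg alg κ hσ hφ
  have h3 := measurable_proposal hg alg κ (σ := σ) i
  have hT : Measurable fun ω : Fin n → ℝ × ℝ => (startPoint κ ω, fun j => (ω j).2) :=
    (measurable_startPoint κ).prodMk (by fun_prop)
  rw [stepLaw] at h1 ⊢
  rw [integral_prod _ h1]
  have h4 : ∀ p : (Fin n → ℝ) × (Fin n → ℝ), ∫ u in Set.Icc (0 : ℝ) 1,
      sqJump alg g κ σ φ i (p, u) = acceptProb alg g κ σ φ p.1 (proposal alg g κ σ p.1 p.2) *
        (proposal alg g κ σ p.1 p.2 i - p.1 i) ^ 2 := fun p => by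
    simp only [sqJump_eq alg κ]
    refine setIntegral_Icc_ite_le ?_ ?_ _
    · rw [acceptProb_eq hg.smoothPolyGrowth alg κ hσ]
      exact min_one_exp_nonneg _
    · rw [acceptProb_eq hg.smoothPolyGrowth alg κ hσ]
      exact min_le_left _ _
  simp only [h4]
  rw [target_prod_eq hg κ hφ, integral_withDensity_eq_integral_toReal_smul (by fun_prop)
    (ae_of_all _ fun _ => ENNReal.ofReal_lt_top), ← map_productLaw_eq hg,
    integral_map hT.aemeasurable (Measurable.aestronglyMeasurable (by fun_prop)),
    ← integral_const_mul]
  refine integral_congr_ae (ae_of_all _ fun ω => ?_)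
  simp only
  rw [endPoint_eq hg alg κ, acceptProb_startPoint hg alg κ hσ,
    ENNReal.toReal_ofReal (Real.exp_pos _).le, smul_eq_mul, startPoint, endPoint]
  have := (scale_pos κ i).ne'
  field_simp
  ring

variable {ψ : (Fin n → ℝ) → ℝ} (hψ : ψ =ᵐ[refMeasure g κ n] φ)
include hψ

/-- The null set where `ψ` and `φ` differ is avoided almost surely by the start, which has the
reference law, and by the proposal, whose law is absolutely continuous. -/
lemma integral_sqJump_eq_version (hP : IsProbabilityMeasure (target g κ φ))
    (hσ1 : ∀ j : Fin n, σ / scale κ j ≤ 1) (i : Fin n) :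
    ∫ w, sqJump alg g κ σ φ i w ∂stepLaw g κ φ = σ ^ 2 * ∫ ω, Real.exp (-ψ (startPoint κ ω)) *
      move alg g (σ / scale κ i) (ω i) ^ 2 * min 1 (Real.exp (ψ (startPoint κ ω) -
        ψ (endPoint alg g κ σ ω) + ∑ j : Fin n, incr alg g (σ / scale κ j) (ω j))) ∂productLaw g n := by
  rw [integral_sqJump_eq hg alg κ hσ hφ hM hP hσ1]
  congr 1
  have h1 : ∀ᵐ ω ∂productLaw g n, ψ (startPoint κ ω) = φ (startPoint κ ω) := by
    rw [← map_startPoint_eq hg κ n] at hψ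
    exact ae_of_ae_map (measurable_startPoint κ).aemeasurable hψ
  have h2 : ∀ᵐ ω ∂productLaw g n, ψ (endPoint alg g κ σ ω) = φ (endPoint alg g κ σ ω) :=
    ae_of_ae_map (measurable_endPoint hg alg κ).aemeasurable
      ((map_endPoint_absolutelyContinuous hg κ alg hσ n).ae_eq hψ)
  refine integral_congr_ae ?_
  filter_upwards [h1, h2] with ω h1 h2
  rw [h1, h2]

omit hσ hM in
lemma integral_exp_neg_version (hP : IsProbabilityMeasure (target g κ φ)) :
    ∫ u, Real.exp (-ψ fun j => scale κ j * u j) ∂(Measure.pi fun _ : Fin n => marginal g) = 1 := by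
  have hφ' : Measurable fun x => Real.exp (-φ x) := by fun_prop
  have h1 : ∫ x, Real.exp (-ψ x) ∂refMeasure g κ n = 1 := by
    have h2 : ∫ x, Real.exp (-ψ x) ∂refMeasure g κ n = ∫ x, Real.exp (-φ x) ∂refMeasure g κ n :=
      integral_congr_ae (by
        filter_upwards [hψ] with x hx
        rw [hx])
    have h3 := hP.measure_univ
    rw [target, withDensity_apply _ MeasurableSet.univ, Measure.restrict_univ] at h3
    rw [h2, integral_eq_lintegral_of_nonneg_ae (ae_of_all _ fun _ => (Real.exp_pos _).le)
      hφ'.aestronglyMeasurable, h3, ENNReal.toReal_one]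
  rw [← map_scale_eq_refMeasure hg] at h1 hψ
  rw [integral_map
    (by fun_prop : Measurable fun (u : Fin n → ℝ) (j : Fin n) => scale κ j * u j).aemeasurable] at h1
  · exact h1
  · exact (hφ'.aestronglyMeasurable).congr (by
      filter_upwards [hψ] with x hx
      rw [hx])


end Reduction

/-! ### Weighted norms -/

lemma weightedNorm_nonneg (s : ℝ) {n : ℕ} (x : Fin n → ℝ) : 0 ≤ weightedNorm s x :=
  Real.sqrt_nonneg _

lemma weightedNorm_sq (s : ℝ) {n : ℕ} (x : Fin n → ℝ) :
    weightedNorm s x ^ 2 = ∑ i : Fin n, ((i : ℕ) + 1 : ℝ) ^ (2 * s) * x i ^ 2 :=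
  Real.sq_sqrt (Finset.sum_nonneg fun i _ =>
    mul_nonneg (Real.rpow_nonneg (by positivity) _) (sq_nonneg _))

lemma continuous_weightedNorm (s : ℝ) {n : ℕ} : Continuous (weightedNorm s (n := n)) := by
  unfold weightedNorm
  fun_prop

/-- The local Lipschitz condition in weighted norms implies continuity. -/
lemma continuous_of_weightedNorm_le {δ : ℝ → ℝ → ℝ}
    (hδ : ∀ R : ℝ, ∃ B : ℝ, ∀ a ∈ Set.Icc 0 R, ∀ b ∈ Set.Icc 0 R, 0 ≤ δ a b ∧ δ a b ≤ B)
    {s s' : ℝ} {n : ℕ} {ψ : (Fin n → ℝ) → ℝ}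
    (h : ∀ x y, |ψ y - ψ x| ≤ δ (weightedNorm s x) (weightedNorm s y) * weightedNorm s' (y - x)) :
    Continuous ψ := by
  refine continuous_iff_continuousAt.2 fun x => ?_
  -- The radius exceeds the norm of `x`, so the same bound on `δ` serves all nearby `y`.
  obtain ⟨B, hB⟩ := hδ (weightedNorm s x + 1)
  have h1 : ∀ᶠ y in 𝓝 x, weightedNorm s y < weightedNorm s x + 1 :=
    (continuous_weightedNorm s).continuousAt.eventually_lt continuousAt_const (by linarith)
  have h2 : Tendsto (fun y => B * weightedNorm s' (y - x)) (𝓝 x) (𝓝 0) := by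
    have : Continuous fun y => B * weightedNorm s' (y - x) :=
      ((continuous_weightedNorm s').comp (by fun_prop)).const_mul B
    have h3 := this.tendsto x
    have h4 : weightedNorm s' (0 : Fin n → ℝ) = 0 := by simp [weightedNorm]
    simpa [h4] using h3
  rw [ContinuousAt, tendsto_iff_norm_sub_tendsto_zero]
  refine squeeze_zero' (Eventually.of_forall fun _ => norm_nonneg _) ?_ h2
  filter_upwards [h1] with y hy
  refine (h x y).trans (mul_le_mul_of_nonneg_right (hB _ ⟨weightedNorm_nonneg _ _, by linarith⟩ _
    ⟨weightedNorm_nonneg _ _, hy.le⟩).2 (weightedNorm_nonneg _ _))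

lemma rpow_mul_scale_sq (s κ : ℝ) (j : ℕ) :
    ((j : ℕ) + 1 : ℝ) ^ (2 * s) * scale κ j ^ 2 = ((j : ℕ) + 1 : ℝ) ^ (2 * s - 2 * κ) := by
  have h : (0 : ℝ) < (j : ℝ) + 1 := by positivity
  rw [scale, ← Real.rpow_natCast, ← Real.rpow_mul h.le, ← Real.rpow_add h]
  congr 1
  push_cast
  ring

/-- The condition on `s` says precisely that the exponent is below `-1`; this is what makes weighted
norms bounded in mean square, uniformly in the dimension. -/
lemma summable_rpow_weight {s κ : ℝ} (hs : s < κ - 1 / 2) :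
    Summable fun j : ℕ => ((j : ℕ) + 1 : ℝ) ^ (2 * s - 2 * κ) := by
  have h := (summable_nat_add_iff 1).2 (Real.summable_nat_rpow.2
    (show 2 * s - 2 * κ < -1 by linarith))
  simpa using h

/-- Second moments of weighted norms are bounded uniformly in the dimension. -/
lemma exists_integral_weightedNorm_sq_le {g : ℝ → ℝ} (hg : IsRegularLogDensity g)
    {F : ℝ → ℝ × ℝ → ℝ} (hF : PolyBound F) (hFc : ∀ ε, Continuous (F ε)) {s κ : ℝ}
    (hs : s < κ - 1 / 2) : ∃ C : ℝ, 0 ≤ C ∧ ∀ (n : ℕ) (e : Fin n → ℝ),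
      (∀ j, e j ∈ Set.Ioc (0 : ℝ) 1) →
      Integrable (fun ω => weightedNorm s (fun j => scale κ j * F (e j) (ω j)) ^ 2)
        (productLaw g n) ∧
      ∫ ω, weightedNorm s (fun j => scale κ j * F (e j) (ω j)) ^ 2 ∂productLaw g n ≤ C := by
  have := isProbabilityMeasure_pairLaw hg
  obtain ⟨c, hc, hle⟩ := (hF.pow 2).exists_integral_abs_le hg
  have hsum := summable_rpow_weight hs
  have hnn : ∀ j : ℕ, 0 ≤ ((j : ℕ) + 1 : ℝ) ^ (2 * s - 2 * κ) := fun j =>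
    Real.rpow_nonneg (by positivity) _
  refine ⟨(∑' j : ℕ, ((j : ℕ) + 1 : ℝ) ^ (2 * s - 2 * κ)) * c,
    mul_nonneg (tsum_nonneg hnn) hc, fun n e he => ?_⟩
  have hi : ∀ j : Fin n, Integrable (fun p => F (e j) p ^ 2) (pairLaw g) := fun j =>
    (hF.pow 2).integrable hg (he j) ((hFc (e j)).pow 2).aestronglyMeasurable
  have hi' : ∀ j : Fin n, Integrable (fun ω : Fin n → ℝ × ℝ =>
      ((j : ℕ) + 1 : ℝ) ^ (2 * s - 2 * κ) * F (e j) (ω j) ^ 2) (productLaw g n) := fun j =>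
    (integrable_comp_eval (μ := fun _ : Fin n => pairLaw g) (i := j) (hi j)).const_mul _
  have h1 : (fun ω : Fin n → ℝ × ℝ => weightedNorm s (fun j => scale κ j * F (e j) (ω j)) ^ 2) =
      fun ω => ∑ j : Fin n, ((j : ℕ) + 1 : ℝ) ^ (2 * s - 2 * κ) * F (e j) (ω j) ^ 2 := by
    funext ω
    rw [weightedNorm_sq]
    refine Finset.sum_congr rfl fun j _ => ?_
    rw [mul_pow, ← mul_assoc, rpow_mul_scale_sq]
  rw [h1]
  refine ⟨integrable_finsetSum _ fun j _ => hi' j, ?_⟩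
  rw [integral_finsetSum _ fun j _ => hi' j]
  calc ∑ j : Fin n, ∫ ω, ((j : ℕ) + 1 : ℝ) ^ (2 * s - 2 * κ) * F (e j) (ω j) ^ 2 ∂productLaw g n
      ≤ ∑ j : Fin n, ((j : ℕ) + 1 : ℝ) ^ (2 * s - 2 * κ) * c := by
        refine Finset.sum_le_sum fun j _ => ?_
        rw [integral_const_mul]
        refine mul_le_mul_of_nonneg_left ?_ (hnn j)
        have h2 : ∫ p, |F (e j) p ^ 2| ∂pairLaw g ≤ c := hle _ (he j)
        simp only [abs_sq] at h2
        refine le_of_eq_of_le ?_ h2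
        exact integral_comp_eval (μ := fun _ : Fin n => pairLaw g) (i := j)
          (f := fun p => F (e j) p ^ 2) (hi j).1
    _ ≤ _ := by
        rw [← Finset.sum_mul]
        refine mul_le_mul_of_nonneg_right ?_ hc
        rw [Fin.sum_univ_eq_sum_range (fun j : ℕ => ((j : ℕ) + 1 : ℝ) ^ (2 * s - 2 * κ)) n]
        exact hsum.sum_le_tsum _ fun j _ => hnn j

/-- If `a` or `b` exceeds `R`, its quadratic term is at least `1` and dominates, as in Chebyshev's
inequality. Otherwise Young's inequality splits `B * t`. In either case second moments are all that
is needed to take expectations. -/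
lemma min_one_abs_le {a b t B R D : ℝ} (hR : 0 < R)
    (h : a ≤ R → b ≤ R → |D| ≤ B * t) :
    min 1 |D| ≤ 1 / R ^ 2 * a ^ 2 + 1 / R ^ 2 * b ^ 2 + (1 / R + R * B ^ 2 * t ^ 2) := by
  have h0 : 0 ≤ 1 / R + R * B ^ 2 * t ^ 2 := by positivity
  have h1 : ∀ c, R < c → 1 ≤ 1 / R ^ 2 * c ^ 2 := fun c hc => by
    rw [one_div, ← div_eq_inv_mul, le_div_iff₀ (by positivity), one_mul]
    exact pow_le_pow_left₀ hR.le hc.le 2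
  by_cases h2 : a ≤ R
  · by_cases h3 : b ≤ R
    · have h4 : B * t ≤ 1 / R + R * B ^ 2 * t ^ 2 := by
        have h5 : 1 / R + R * B ^ 2 * t ^ 2 - B * t =
            1 / R * ((R * (B * t) - 1 / 2) ^ 2 + 3 / 4) := by
          field_simp
          ring
        have : 0 ≤ 1 / R * ((R * (B * t) - 1 / 2) ^ 2 + 3 / 4) := by positivity
        linarith
      have : 0 ≤ 1 / R ^ 2 * a ^ 2 := by positivity
      have : 0 ≤ 1 / R ^ 2 * b ^ 2 := by positivity
      linarith [min_le_right 1 |D|, h h2 h3]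
    · have := h1 b (not_le.1 h3)
      have : 0 ≤ 1 / R ^ 2 * a ^ 2 := by positivity
      linarith [min_le_left 1 |D|]
  · have := h1 a (not_le.1 h2)
    have : 0 ≤ 1 / R ^ 2 * b ^ 2 := by positivity
    linarith [min_le_left 1 |D|]

lemma integral_linear_combination {α : Type*} [MeasurableSpace α] {μ : Measure α}
    [IsProbabilityMeasure μ] {X Y Z : α → ℝ} (hX : Integrable X μ) (hY : Integrable Y μ)
    (hZ : Integrable Z μ) (a b c d : ℝ) :
    Integrable (fun ω => a * X ω + b * Y ω + (c + d * Z ω)) μ ∧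
      ∫ ω, a * X ω + b * Y ω + (c + d * Z ω) ∂μ =
        a * ∫ ω, X ω ∂μ + b * ∫ ω, Y ω ∂μ + (c + d * ∫ ω, Z ω ∂μ) := by
  have h1 : Integrable (fun ω => a * X ω) μ := hX.const_mul a
  have h2 : Integrable (fun ω => b * Y ω) μ := hY.const_mul b
  have h3 : Integrable (fun ω => d * Z ω) μ := hZ.const_mul d
  have h4 : Integrable (fun ω => a * X ω + b * Y ω) μ := h1.add h2
  have h5 : Integrable (fun ω => c + d * Z ω) μ := (integrable_const c).add h3
  refine ⟨h4.add h5, ?_⟩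
  rw [integral_add h4 h5, integral_add h1 h2, integral_add (integrable_const c) h3,
    integral_const_mul, integral_const_mul, integral_const_mul, integral_const, probReal_univ,
    one_smul]

/-- The change of a locally Lipschitz functional along a proposal is negligible. -/
lemma tendsto_integral_min_one_abs_sub {g : ℝ → ℝ} (hg : IsRegularLogDensity g) (alg : Algorithm)
    {κ : ℝ} {N : ℕ → ℕ} {σ : ℕ → ℝ} {d : ℕ → ℝ}
    (hmem : ∀ m (j : Fin (N m)), σ m / scale κ j ∈ Set.Ioc (0 : ℝ) 1) (hd : Tendsto d atTop (𝓝 0))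
    (hle : ∀ m (j : Fin (N m)), σ m / scale κ j ≤ d m) {δ : ℝ → ℝ → ℝ}
    (hδ : ∀ R : ℝ, ∃ B : ℝ, ∀ a ∈ Set.Icc 0 R, ∀ b ∈ Set.Icc 0 R, 0 ≤ δ a b ∧ δ a b ≤ B)
    {s s' : ℝ} (hs : s < κ - 1 / 2) (hs' : s' < κ - 1 / 2) {ψ : ∀ m, (Fin (N m) → ℝ) → ℝ}
    (h : ∀ m x y, |ψ m y - ψ m x| ≤
      δ (weightedNorm s x) (weightedNorm s y) * weightedNorm s' (y - x)) :
    Tendsto (fun m => ∫ ω, min 1 |ψ m (startPoint κ ω) - ψ m (endPoint alg g κ (σ m) ω)|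
      ∂productLaw g (N m)) atTop (𝓝 0) := by
  have hsm := hg.smoothPolyGrowth
  have hpm := polyBound_move hsm alg
  have hcm := continuous_move hsm alg
  obtain ⟨C₁, hC₁, hx⟩ := exists_integral_weightedNorm_sq_le hg PolyBound.fst
    (fun _ => continuous_fst) hs
  obtain ⟨C₂, hC₂, hy⟩ := exists_integral_weightedNorm_sq_le hg
    (PolyBound.fst.add (PolyBound.eps.mul hpm))
    (fun ε => continuous_fst.add ((hcm ε).const_mul ε)) hs
  obtain ⟨C₃, hC₃, hz⟩ := exists_integral_weightedNorm_sq_le hg hpm hcm hs'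
  -- The local Lipschitz constant depends on `R`, so `R` is chosen first, to make the bracket small,
  -- and then `m` is sent to infinity.
  have key : ∀ R : ℝ, 0 < R → ∃ B : ℝ, ∀ m,
      ∫ ω, min 1 |ψ m (startPoint κ ω) - ψ m (endPoint alg g κ (σ m) ω)| ∂productLaw g (N m) ≤
        (1 / R ^ 2 * C₁ + 1 / R ^ 2 * C₂ + 1 / R) + B * d m ^ 2 := by
    intro R hR
    obtain ⟨B, hB⟩ := hδ R
    refine ⟨R * B ^ 2 * C₃, fun m => ?_⟩
    have := isProbabilityMeasure_productLaw hg (N m)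
    obtain ⟨ix, lx⟩ := hx (N m) (fun j => σ m / scale κ j) (hmem m)
    obtain ⟨iy, ly⟩ := hy (N m) (fun j => σ m / scale κ j) (hmem m)
    obtain ⟨iz, lz⟩ := hz (N m) (fun j => σ m / scale κ j) (hmem m)
    have hpt : ∀ ω : Fin (N m) → ℝ × ℝ,
        min 1 |ψ m (startPoint κ ω) - ψ m (endPoint alg g κ (σ m) ω)| ≤
        1 / R ^ 2 * weightedNorm s (fun j => scale κ j * (ω j).1) ^ 2 +
        1 / R ^ 2 * weightedNorm s (fun j => scale κ j * ((ω j).1 + σ m / scale κ j *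
          move alg g (σ m / scale κ j) (ω j))) ^ 2 +
        (1 / R + R * B ^ 2 * d m ^ 2 * weightedNorm s' (fun j => scale κ j *
          move alg g (σ m / scale κ j) (ω j)) ^ 2) := by
      intro ω
      -- Each coordinate is displaced by its step size, at most `d m`, times its scaled move.
      have h1 : weightedNorm s' (startPoint κ ω - endPoint alg g κ (σ m) ω) ^ 2 ≤
          d m ^ 2 * weightedNorm s' (fun j => scale κ j *
            move alg g (σ m / scale κ j) (ω j)) ^ 2 := by
        rw [weightedNorm_sq, weightedNorm_sq, Finset.mul_sum]
        refine Finset.sum_le_sum fun j _ => ?_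
        have h2 : (σ m / scale κ j) ^ 2 ≤ d m ^ 2 :=
          pow_le_pow_left₀ (hmem m j).1.le (hle m j) 2
        have h3 : (0 : ℝ) ≤ ((j : ℕ) + 1 : ℝ) ^ (2 * s') := Real.rpow_nonneg (by positivity) _
        have h4 : (startPoint κ ω - endPoint alg g κ (σ m) ω) j ^ 2 =
            (σ m / scale κ j) ^ 2 * (scale κ j * move alg g (σ m / scale κ j) (ω j)) ^ 2 := by
          rw [Pi.sub_apply, startPoint, endPoint]
          ring
        rw [h4, mul_left_comm]
        exact mul_le_mul_of_nonneg_right h2 (mul_nonneg h3 (sq_nonneg _))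
      refine (min_one_abs_le (a := weightedNorm s (startPoint κ ω))
        (b := weightedNorm s (endPoint alg g κ (σ m) ω)) hR (B := B)
        (t := weightedNorm s' (startPoint κ ω - endPoint alg g κ (σ m) ω)) fun ha hb => ?_).trans ?_
      · refine (h m _ _).trans (mul_le_mul_of_nonneg_right ?_ (weightedNorm_nonneg _ _))
        exact (hB _ ⟨weightedNorm_nonneg _ _, hb⟩ _ ⟨weightedNorm_nonneg _ _, ha⟩).2
      · refine add_le_add le_rfl (add_le_add le_rfl ?_)
        rw [mul_assoc (R * B ^ 2)]
        exact mul_le_mul_of_nonneg_left h1 (by positivity)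
    obtain ⟨ic, ec⟩ := integral_linear_combination ix iy iz (1 / R ^ 2) (1 / R ^ 2) (1 / R)
      (R * B ^ 2 * d m ^ 2)
    refine (integral_mono_of_nonneg (ae_of_all _ fun ω => le_min zero_le_one (abs_nonneg _)) ic
      (ae_of_all _ hpt)).trans ?_
    rw [ec]
    have e1 := mul_le_mul_of_nonneg_left lx (show 0 ≤ 1 / R ^ 2 by positivity)
    have e2 := mul_le_mul_of_nonneg_left ly (show 0 ≤ 1 / R ^ 2 by positivity)
    have e3 := mul_le_mul_of_nonneg_left lz (show 0 ≤ R * B ^ 2 * d m ^ 2 by positivity)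
    have e4 : R * B ^ 2 * C₃ * d m ^ 2 = R * B ^ 2 * d m ^ 2 * C₃ := by ring
    rw [e4]
    linarith
  have hR : Tendsto (fun R : ℝ => 1 / R ^ 2 * C₁ + 1 / R ^ 2 * C₂ + 1 / R) atTop (𝓝 0) := by
    have h1 : Tendsto (fun R : ℝ => 1 / R) atTop (𝓝 0) := tendsto_const_nhds.div_atTop tendsto_id
    have h2 : Tendsto (fun R : ℝ => 1 / R ^ 2) atTop (𝓝 0) :=
      tendsto_const_nhds.div_atTop (tendsto_pow_atTop two_ne_zero)
    simpa using ((h2.mul_const C₁).add (h2.mul_const C₂)).add h1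
  refine tendsto_order.2 ⟨fun a ha => Eventually.of_forall fun m => ha.trans_le
    (integral_nonneg fun ω => le_min zero_le_one (abs_nonneg _)), fun a ha => ?_⟩
  obtain ⟨R, hR1, hR2⟩ := ((hR.eventually_lt_const (half_pos ha)).and
    (eventually_gt_atTop 0)).exists
  obtain ⟨B, hB⟩ := key R hR2
  have hd2 : Tendsto (fun m => B * d m ^ 2) atTop (𝓝 0) := by
    simpa using (hd.pow 2).const_mul B
  filter_upwards [hd2.eventually_lt_const (half_pos ha)] with m hm
  linarith [hB m]

/-! ### Sums of powers -/

lemma rpow_div_le_sum_rpow {a : ℝ} (ha : 0 ≤ a) (n : ℕ) :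
    (n : ℝ) ^ (a + 1) / (a + 1) ≤ ∑ j ∈ Finset.range n, ((j : ℝ) + 1) ^ a := by
  have h := MonotoneOn.integral_le_sum (f := fun x : ℝ => x ^ a) (x₀ := 0) (a := n)
    ((Real.monotoneOn_rpow_Ici_of_exponent_nonneg ha).mono fun x hx => hx.1)
  rw [integral_rpow (Or.inl (by linarith)), zero_add, Real.zero_rpow (by linarith), sub_zero] at h
  simpa using h

lemma sum_rpow_le_rpow_div {a : ℝ} (ha : 0 ≤ a) (n : ℕ) :
    ∑ j ∈ Finset.range n, ((j : ℝ) + 1) ^ a ≤ ((n : ℝ) + 1) ^ (a + 1) / (a + 1) := by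
  have h := MonotoneOn.sum_le_integral (f := fun x : ℝ => x ^ a) (x₀ := 1) (a := n)
    ((Real.monotoneOn_rpow_Ici_of_exponent_nonneg ha).mono fun x hx => zero_le_one.trans hx.1)
  rw [integral_rpow (Or.inl (by linarith)), Real.one_rpow] at h
  simp only [add_comm (1 : ℝ)] at h
  refine h.trans ?_
  gcongr
  linarith

/-- The sum lies between the integrals of `x ^ a` up to `n` and up to `n + 1`, whose ratio tends to
one. -/
lemma tendsto_sum_rpow {a : ℝ} (ha : 0 ≤ a) :
    Tendsto (fun n : ℕ => (n : ℝ) ^ (-(a + 1)) * ∑ j ∈ Finset.range n, ((j : ℝ) + 1) ^ a) atTop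
      (𝓝 (1 / (a + 1))) := by
  have h1 : Tendsto (fun n : ℕ => (1 + 1 / (n : ℝ)) ^ (a + 1) * (1 / (a + 1))) atTop
      (𝓝 (1 / (a + 1))) := by
    have h2 : Tendsto (fun n : ℕ => (1 + 1 / (n : ℝ))) atTop (𝓝 1) := by
      simpa using (tendsto_one_div_atTop_nhds_zero_nat (𝕜 := ℝ)).const_add 1
    simpa using (h2.rpow_const (p := a + 1) (Or.inl one_ne_zero)).mul_const (1 / (a + 1))
  refine tendsto_of_tendsto_of_tendsto_of_le_of_le' tendsto_const_nhds h1 ?_ ?_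
  · filter_upwards [eventually_ge_atTop 1] with n hn
    have hn' : (0 : ℝ) < n := by exact_mod_cast hn
    refine le_of_eq_of_le ?_ (mul_le_mul_of_nonneg_left (rpow_div_le_sum_rpow ha n)
      (Real.rpow_nonneg hn'.le _))
    rw [Real.rpow_neg hn'.le]
    field_simp
  · filter_upwards [eventually_ge_atTop 1] with n hn
    have hn' : (0 : ℝ) < n := by exact_mod_cast hn
    refine (mul_le_mul_of_nonneg_left (sum_rpow_le_rpow_div ha n)
      (Real.rpow_nonneg hn'.le _)).trans (le_of_eq ?_)
    have h3 : 1 + 1 / (n : ℝ) = ((n : ℝ) + 1) / n := by field_simp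
    rw [h3, Real.div_rpow (by positivity) hn'.le, Real.rpow_neg hn'.le]
    field_simp

/-! ### Asymptotics of the mean squared jump -/

lemma tendsto_div_scale_bound (l : ℝ) {κ ρ : ℝ} (hρ : 2 * κ < ρ) :
    Tendsto (fun n : ℕ => l * (n : ℝ) ^ (κ - ρ / 2)) atTop (𝓝 0) := by
  have h := (tendsto_rpow_neg_atTop (show 0 < ρ / 2 - κ by linarith)).comp
    tendsto_natCast_atTop_atTop
  simpa [Function.comp_def] using h.const_mul l

/-! ### Asymptotics of the sums of powers of the step sizes. -/

section StepSize

variable {κ : ℝ} (hκ : 0 ≤ κ) {l ρ : ℝ} (hl : 0 < l) {σ : ℕ → ℝ}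
  (hσ : ∀ n : ℕ, 1 ≤ n → 0 < σ n ∧ σ n ^ 2 = l ^ 2 * (n : ℝ) ^ (-ρ))

lemma div_scale_eq (κ σ : ℝ) (j : ℕ) : σ / scale κ j = σ * ((j : ℝ) + 1) ^ κ := by
  rw [scale, Real.rpow_neg (by positivity), div_inv_eq_mul]

include hl hσ

lemma stdDev_eq {n : ℕ} (hn : 1 ≤ n) : σ n = l * (n : ℝ) ^ (-(ρ / 2)) := by
  have hn' : (0 : ℝ) < n := by exact_mod_cast hn
  refine (pow_left_inj₀ (hσ n hn).1.le (by positivity) two_ne_zero).1 ?_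
  rw [(hσ n hn).2, mul_pow, ← Real.rpow_natCast (_ ^ _), ← Real.rpow_mul hn'.le]
  congr 2
  push_cast
  ring

include hκ

lemma div_scale_le {n : ℕ} (j : Fin n) : σ n / scale κ j ≤ l * (n : ℝ) ^ (κ - ρ / 2) := by
  have hn : 1 ≤ n := j.pos
  have hn' : (0 : ℝ) < n := by exact_mod_cast hn
  have h1 : ((j : ℕ) : ℝ) + 1 ≤ n := by exact_mod_cast j.isLt
  rw [div_scale_eq, stdDev_eq hl hσ hn, mul_assoc, sub_eq_neg_add, Real.rpow_add hn']
  gcongr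

omit hκ in
-- The last factor converges to `1 / (2kκ + 1)`, so the sign of `2κ + 1/k - ρ` alone separates the
-- three regimes.
lemma sum_div_scale_pow {n : ℕ} (hn : 1 ≤ n) {k : ℕ} (hk : 0 < k) :
    ∑ j : Fin n, (σ n / scale κ j) ^ (2 * k) = l ^ (2 * k) * (n : ℝ) ^ (k * (2 * κ + 1 / k - ρ)) *
      ((n : ℝ) ^ (-(2 * k * κ + 1)) * ∑ j ∈ Finset.range n, ((j : ℝ) + 1) ^ (2 * k * κ)) := by
  have hn' : (0 : ℝ) < n := by exact_mod_cast hn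
  have hk' : (0 : ℝ) < k := by exact_mod_cast hk
  have e1 : ((n : ℝ) ^ (-(ρ / 2))) ^ (2 * k) = (n : ℝ) ^ (-(ρ * k)) := by
    rw [← Real.rpow_natCast, ← Real.rpow_mul hn'.le]
    congr 1
    push_cast
    ring
  have e2 : ∀ j : ℕ, (((j : ℝ) + 1) ^ κ) ^ (2 * k) = ((j : ℝ) + 1) ^ (2 * k * κ) := fun j => by
    rw [← Real.rpow_natCast, ← Real.rpow_mul (by positivity)]
    congr 1
    push_cast
    ring
  have e3 : (n : ℝ) ^ (-(ρ * k)) =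
      (n : ℝ) ^ (k * (2 * κ + 1 / k - ρ)) * (n : ℝ) ^ (-(2 * k * κ + 1)) := by
    rw [← Real.rpow_add hn']
    congr 1
    field_simp
    ring
  have h1 : ∀ j : ℕ, (σ n / scale κ j) ^ (2 * k) =
      l ^ (2 * k) * (n : ℝ) ^ (-(ρ * k)) * ((j : ℝ) + 1) ^ (2 * k * κ) := fun j => by
    rw [div_scale_eq, stdDev_eq hl hσ hn, mul_pow, mul_pow, e1, e2]
  rw [Fin.sum_univ_eq_sum_range (fun j : ℕ => (σ n / scale κ j) ^ (2 * k)) n]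
  simp only [h1]
  rw [← Finset.mul_sum, e3]
  ring

lemma tendsto_sum_div_scale_pow_of_eq {k : ℕ} (hk : 0 < k) (hρ : ρ = 2 * κ + 1 / k) :
    Tendsto (fun n : ℕ => ∑ j : Fin n, (σ n / scale κ j) ^ (2 * k)) atTop
      (𝓝 (l ^ (2 * k) / (1 + 2 * k * κ))) := by
  have h1 := (tendsto_sum_rpow (show 0 ≤ 2 * k * κ by positivity)).const_mul (l ^ (2 * k))
  rw [mul_one_div, add_comm _ (1 : ℝ)] at h1
  refine h1.congr' ?_
  filter_upwards [eventually_ge_atTop 1] with n hn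
  rw [sum_div_scale_pow hl hσ hn hk, ← hρ, sub_self, mul_zero, Real.rpow_zero, mul_one, add_comm]

lemma tendsto_sum_div_scale_pow_of_lt {k : ℕ} (hk : 0 < k) (hρ : 2 * κ + 1 / k < ρ) :
    Tendsto (fun n : ℕ => ∑ j : Fin n, (σ n / scale κ j) ^ (2 * k)) atTop (𝓝 0) := by
  have hk' : (0 : ℝ) < k := by exact_mod_cast hk
  have h0 := (tendsto_rpow_neg_atTop (show 0 < -(k * (2 * κ + 1 / k - ρ)) by
    have : 0 < k * (ρ - (2 * κ + 1 / k)) := mul_pos hk' (by linarith)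
    linarith)).comp tendsto_natCast_atTop_atTop
  simp only [neg_neg] at h0
  have h1 := (h0.const_mul (l ^ (2 * k))).mul (tendsto_sum_rpow (show 0 ≤ 2 * k * κ by positivity))
  rw [mul_zero, zero_mul] at h1
  refine h1.congr' ?_
  filter_upwards [eventually_ge_atTop 1] with n hn
  rw [sum_div_scale_pow hl hσ hn hk]
  rfl

lemma le_sum_div_scale_pow {k : ℕ} (hk : 0 < k) {n : ℕ} (hn : 1 ≤ n) :
    l ^ (2 * k) / (2 * k * κ + 1) * (n : ℝ) ^ (k * (2 * κ + 1 / k - ρ)) ≤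
      ∑ j : Fin n, (σ n / scale κ j) ^ (2 * k) := by
  have hn' : (0 : ℝ) < n := by exact_mod_cast hn
  rw [sum_div_scale_pow hl hσ hn hk]
  have h1 := mul_le_mul_of_nonneg_left (rpow_div_le_sum_rpow (show 0 ≤ 2 * k * κ by positivity) n)
    (Real.rpow_nonneg hn'.le (-(2 * k * κ + 1)))
  have h2 : (n : ℝ) ^ (-(2 * k * κ + 1)) * ((n : ℝ) ^ (2 * k * κ + 1) / (2 * k * κ + 1)) =
      1 / (2 * k * κ + 1) := by
    rw [Real.rpow_neg hn'.le]
    field_simp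
  rw [h2] at h1
  refine le_of_eq_of_le ?_ (mul_le_mul_of_nonneg_left h1 (show
    0 ≤ l ^ (2 * k) * (n : ℝ) ^ (k * (2 * κ + 1 / k - ρ)) by positivity))
  ring

end StepSize

lemma limitAccept_eq {g : ℝ → ℝ} (hg : IsRegularLogDensity g) (alg : Algorithm) {κ : ℝ}
    (hκ : 0 ≤ κ) {l : ℝ} (hl : 0 < l) : limitAccept alg g κ l =
      gaussianAccept (l ^ (2 * alg.order) / (1 + 2 * alg.order * κ) * constK alg g) := by
  have hK := constK_pos hg alg
  have h1 : l ^ (2 * alg.order) / (1 + 2 * alg.order * κ) * constK alg g =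
      (l ^ alg.order * √(constK alg g / (1 + 2 * alg.order * κ))) ^ 2 := by
    rw [mul_pow, Real.sq_sqrt (by positivity)]
    ring
  rw [h1, gaussianAccept_sq (by positivity)]
  cases alg
  · simp only [limitAccept, Algorithm.order, pow_one, Nat.cast_one, mul_one]
    ring_nf
  · simp only [limitAccept, Algorithm.order]
    norm_num
    ring_nf

lemma gaussianAccept_zero : gaussianAccept 0 = 1 := by
  simp [gaussianAccept]

section Asymptotics

variable {g : ℝ → ℝ} (hg : IsRegularLogDensity g) (alg : Algorithm) {κ : ℝ} (hκ : 0 ≤ κ)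
  {φ : (n : ℕ) → (Fin n → ℝ) → ℝ} (hφ_meas : ∀ n : ℕ, 1 ≤ n → Measurable (φ n))
  (hφ_prob : ∀ n : ℕ, 1 ≤ n → IsProbabilityMeasure (target g κ (φ n)))
  {ψ : (n : ℕ) → (Fin n → ℝ) → ℝ} (hψ : ∀ n : ℕ, 1 ≤ n → ψ n =ᵐ[refMeasure g κ n] φ n)
  (hψ_below : EventuallyBoundedBelow ψ) {l ρ : ℝ} (hl : 0 < l) {σ : ℕ → ℝ}
  (hσ : ∀ n : ℕ, 1 ≤ n → 0 < σ n ∧ σ n ^ 2 = l ^ 2 * (n : ℝ) ^ (-ρ)) (hρ : 2 * κ < ρ)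

include hκ hl hσ hρ in
lemma eventually_div_scale_mem {e : ℝ} (he : 0 < e) :
    ∀ᶠ n in atTop, ∀ j : Fin n, σ n / scale κ j ∈ Set.Ioc 0 e := by
  filter_upwards [(tendsto_div_scale_bound l hρ).eventually_lt_const he] with n hn j
  exact ⟨div_pos (hσ n j.pos).1 (scale_pos κ j), (div_scale_le hκ hl hσ j).trans hn.le⟩

include hg hφ_meas hψ in
lemma meanSqJump_eq {n i : ℕ} (hi : i < n) (hP : IsProbabilityMeasure (target g κ (φ n))) {M : ℝ}
    (hM : ∀ x, M ≤ ψ n x) (hσ0 : 0 < σ n) (hσ1 : ∀ j : Fin n, σ n / scale κ j ≤ 1) :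
    meanSqJump alg g κ (σ n) (φ n) i = σ n ^ 2 * ∫ ω, Real.exp (-ψ n (startPoint κ ω)) *
      move alg g (σ n / scale κ i) (ω ⟨i, hi⟩) ^ 2 * min 1 (Real.exp (ψ n (startPoint κ ω) -
        ψ n (endPoint alg g κ (σ n) ω) + ∑ j : Fin n, incr alg g (σ n / scale κ j) (ω j)))
          ∂productLaw g n := by
  have hn : 1 ≤ n := by omega
  rw [meanSqJump, dif_pos hi]
  refine integral_sqJump_eq_version hg alg κ hσ0 (hφ_meas n hn) (M := M) ?_ (hψ n hn) hP
    hσ1 ⟨i, hi⟩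
  filter_upwards [hψ n hn] with x hx
  exact hx ▸ hM x

include hg hκ hφ_meas hψ hψ_below hl hσ hρ in
lemma eventually_integrable_sqJump :
    ∀ᶠ n : ℕ in atTop, ∀ i (h : i < n),
      Integrable (sqJump alg g κ (σ n) (φ n) ⟨i, h⟩) (stepLaw g κ (φ n)) := by
  obtain ⟨M, hM⟩ := hψ_below
  filter_upwards [hM, eventually_div_scale_mem hκ hl hσ hρ one_pos] with n hM hn i h
  have h1 : 1 ≤ n := by omega
  refine integrable_sqJump hg alg κ (hσ n h1).1 (hφ_meas n h1) (M := M) ?_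
    (fun j => (hn j).2) ⟨i, h⟩
  filter_upwards [hψ n h1] with x hx
  exact hx ▸ hM x

include hg hκ hφ_meas hφ_prob hψ hψ_below hl hσ hρ in
/-- The mean squared jump when the sum of the powers of the step sizes converges. -/
lemma isLittleO_meanSqJump_sub (hψ_lip : LocallyLipschitzWithGrowth κ ψ) {τ : ℝ}
    (hτ : Tendsto (fun n : ℕ => ∑ j : Fin n, (σ n / scale κ j) ^ (2 * alg.order)) atTop (𝓝 τ))
    (i : ℕ) : (fun n : ℕ => meanSqJump alg g κ (σ n) (φ n) i -
        l ^ 2 * gaussianAccept (τ * constK alg g) * (n : ℝ) ^ (-ρ))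
      =o[atTop] fun n : ℕ => (n : ℝ) ^ (-ρ) := by
  obtain ⟨M, hM⟩ := hψ_below
  obtain ⟨δ, hδ, C, p, s, s', s'', -, -, hs, hs', -, hlip⟩ := hψ_lip
  -- From `n₀` on, the coordinate `i` exists and all the eventual hypotheses hold. The limit
  -- theorems are applied to the sequences shifted by `n₀`, for which they hold at every index.
  obtain ⟨n₀, h0⟩ := eventually_atTop.1 ((eventually_ge_atTop (i + 1)).and
    (hM.and (hlip.and (eventually_div_scale_mem hκ hl hσ hρ one_pos))))
  have hle : ∀ m, n₀ ≤ m + n₀ := fun m => Nat.le_add_left _ _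
  have hin : ∀ m, i < m + n₀ := fun m => (h0 _ (hle m)).1
  have h1n : ∀ m, 1 ≤ m + n₀ := fun m => (Nat.zero_le i).trans_lt (hin m)
  have hcont : ∀ m, Continuous (ψ (m + n₀)) := fun m =>
    continuous_of_weightedNorm_le hδ fun x y => ((h0 _ (hle m)).2.2.1 x y).1
  have hε : StepSizes alg.order (N := fun m => m + n₀)
      (fun m (j : Fin (m + n₀)) => σ (m + n₀) / scale κ j) τ :=
    ⟨fun m j => (h0 _ (hle m)).2.2.2 j,
      ⟨fun m => l * ((m + n₀ : ℕ) : ℝ) ^ (κ - ρ / 2),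
        (tendsto_div_scale_bound l hρ).comp (tendsto_add_atTop_nat n₀),
        fun m j => div_scale_le hκ hl hσ j⟩, hτ.comp (tendsto_add_atTop_nat n₀)⟩
  have hlim := tendsto_integral_weighted_jump hg alg hε (fun m => (⟨i, hin m⟩ : Fin (m + n₀)))
    (w := fun m u => Real.exp (-ψ (m + n₀) fun j => scale κ j * u j))
    (fun m => by
      have := (hcont m).measurable
      fun_prop) (fun m u => (Real.exp_pos _).le)
    (W := Real.exp (-M)) (fun m u => Real.exp_le_exp.2 (neg_le_neg ((h0 _ (hle m)).2.1 _)))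
    (fun m => integral_exp_neg_version hg κ (hφ_meas _ (h1n m)) (hψ _ (h1n m))
      (hφ_prob _ (h1n m)))
    (Δ := fun m ω => ψ (m + n₀) (startPoint κ ω) -
      ψ (m + n₀) (endPoint alg g κ (σ (m + n₀)) ω))
    (fun m => ((hcont m).measurable.comp (measurable_startPoint κ)).sub
      ((hcont m).measurable.comp (measurable_endPoint hg alg κ)))
    (tendsto_integral_min_one_abs_sub hg alg (N := fun m => m + n₀) (σ := fun m => σ (m + n₀))
      hε.mem hε.small.choose_spec.1 hε.small.choose_spec.2 hδ hs hs'
      (ψ := fun m => ψ (m + n₀)) fun m x y => ((h0 _ (hle m)).2.2.1 x y).1)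
  have hquot : Tendsto (fun n => meanSqJump alg g κ (σ n) (φ n) i / σ n ^ 2) atTop
      (𝓝 (gaussianAccept (τ * constK alg g))) := by
    refine (tendsto_add_atTop_iff_nat n₀).1 (hlim.congr fun m => ?_)
    rw [meanSqJump_eq hg alg hφ_meas hψ (hin m) (hφ_prob _ (h1n m)) (h0 _ (hle m)).2.1
      (hσ _ (h1n m)).1 fun j => ((h0 _ (hle m)).2.2.2 j).2,
      mul_div_cancel_left₀ _ (pow_ne_zero 2 (hσ _ (h1n m)).1.ne')]
    rfl
  have hpos : ∀ᶠ n : ℕ in atTop, (0 : ℝ) < (n : ℝ) ^ (-ρ) := by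
    filter_upwards [eventually_ge_atTop 1] with n hn
    exact Real.rpow_pos_of_pos (by exact_mod_cast hn) _
  refine (isLittleO_iff_tendsto' (hpos.mono fun n h1 h2 => absurd h2 h1.ne')).2 ?_
  have h2 := (hquot.sub_const (gaussianAccept (τ * constK alg g))).const_mul (l ^ 2)
  rw [sub_self, mul_zero] at h2
  refine h2.congr' ?_
  filter_upwards [eventually_ge_atTop 1, hpos] with n hn hp
  rw [(hσ n hn).2]
  have := hp.ne'
  field_simp

include hg hκ hφ_meas hφ_prob hψ hψ_below hl hσ hρ in
/-- The mean squared jump for too large proposals decays faster than any power. -/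
lemma isBigO_meanSqJump (hρ' : ρ < 2 * κ + 1 / alg.order) (i : ℕ) (p : ℝ) :
    (fun n : ℕ => meanSqJump alg g κ (σ n) (φ n) i) =O[atTop] fun n : ℕ => (n : ℝ) ^ (-p) := by
  obtain ⟨M, hM⟩ := hψ_below
  obtain ⟨C, c, e₀, hC, hc, he₀, he₁, hbound⟩ := exists_integral_weighted_jump_le hg alg
  have hk := alg.order_pos
  have hk' : (0 : ℝ) < alg.order := by exact_mod_cast hk
  set γ := alg.order * (2 * κ + 1 / alg.order - ρ) with hγdef
  have hγ : 0 < γ := mul_pos hk' (by linarith)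
  set b := c * (l ^ (2 * alg.order) / (2 * alg.order * κ + 1)) with hbdef
  have hb : 0 < b := by positivity
  have h1 : (fun n : ℕ => Real.exp (-b * (n : ℝ) ^ γ)) =O[atTop] fun n : ℕ => (n : ℝ) ^ (-p) := by
    -- In the variable `n ^ γ` the exponential beats every power, and the exponent `-p / γ` returns
    -- `n ^ (-p)`.
    have h2 := ((isLittleO_exp_neg_mul_rpow_atTop hb (-p / γ)).comp_tendsto
      ((tendsto_rpow_atTop hγ).comp tendsto_natCast_atTop_atTop)).isBigO
    refine h2.congr' EventuallyEq.rfl (Eventually.of_forall fun n => ?_)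
    simp only [Function.comp]
    rw [← Real.rpow_mul n.cast_nonneg, mul_div_cancel₀ _ hγ.ne']
  refine IsBigO.trans (IsBigO.of_bound (l ^ 2 * (Real.exp (-M) * C)) ?_) h1
  filter_upwards [hM, eventually_ge_atTop (i + 1), eventually_div_scale_mem hκ hl hσ hρ he₀]
    with n hM hi hn
  have hn1 : 1 ≤ n := by omega
  -- The weight and half the change of `ψ` combine to `exp (-(ψ x + ψ y) / 2)`, so the lower bound
  -- `M` controls them without any continuity.
  have h3 := hbound hn ⟨i, hi⟩ (w := fun u => Real.exp (-ψ n fun j => scale κ j * u j))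
    (fun u => (Real.exp_pos _).le) (A := Real.exp (-M))
    (Δ := fun ω => ψ n (startPoint κ ω) - ψ n (endPoint alg g κ (σ n) ω)) (fun ω => by
      rw [← Real.exp_add]
      refine Real.exp_le_exp.2 ?_
      have h4 := hM (startPoint κ ω)
      have h5 := hM (endPoint alg g κ (σ n) ω)
      change -ψ n (startPoint κ ω) + _ ≤ _
      linarith)
  have h0 : 0 ≤ meanSqJump alg g κ (σ n) (φ n) i := by
    rw [meanSqJump]
    split_ifs
    · exact integral_nonneg fun w => sq_nonneg _
    · exact le_rfl
  rw [Real.norm_of_nonneg h0, Real.norm_of_nonneg (Real.exp_pos _).le,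
    meanSqJump_eq hg alg hφ_meas hψ hi (hφ_prob n hn1) hM (hσ n hn1).1
      fun j => (hn j).2.trans he₁]
  have h6 : σ n ^ 2 ≤ l ^ 2 := by
    rw [(hσ n hn1).2]
    refine mul_le_of_le_one_right (sq_nonneg _) (Real.rpow_le_one_of_one_le_of_nonpos
      (by exact_mod_cast hn1) (by linarith))
  have h7 : Real.exp (-(c * ∑ j : Fin n, (σ n / scale κ j) ^ (2 * alg.order))) ≤
      Real.exp (-b * (n : ℝ) ^ γ) := by
    refine Real.exp_le_exp.2 ?_
    have h8 := mul_le_mul_of_nonneg_left (le_sum_div_scale_pow hκ hl hσ hk hn1) hc.le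
    rw [hbdef, neg_mul, mul_assoc]
    exact neg_le_neg h8
  calc _ ≤ l ^ 2 * (Real.exp (-M) * (C * Real.exp (-b * (n : ℝ) ^ γ))) := by
        refine mul_le_mul h6 (h3.trans ?_) ?_ (sq_nonneg _)
        · gcongr
        · exact integral_nonneg fun ω => mul_nonneg
            (mul_nonneg (Real.exp_pos _).le (sq_nonneg _)) (min_one_exp_nonneg _)
    _ = _ := by ring

end Asymptotics

/-! ### The upper tail of the standard normal law -/

/-- The upper tail `1 - Φ(t) = Φ(-t)` of the standard normal law. -/
noncomputable def upperTail (t : ℝ) : ℝ := cdf (gaussianReal 0 1) (-t)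

lemma gaussianPDFReal_zero_one (x : ℝ) :
    gaussianPDFReal 0 1 x = (√(2 * Real.pi))⁻¹ * Real.exp (-(x ^ 2 / 2)) := by
  simp [gaussianPDFReal, neg_div]

lemma continuous_gaussianPDFReal_zero_one : Continuous (gaussianPDFReal 0 1) := by
  rw [show gaussianPDFReal 0 1 = _ from funext gaussianPDFReal_zero_one]
  fun_prop

lemma cdf_add_upperTail (t : ℝ) : cdf (gaussianReal 0 1) t + upperTail t = 1 := by
  rw [upperTail, ← gaussianReal_real_Ioi, cdf_eq_real, ← Set.compl_Iic,
    probReal_compl_eq_one_sub measurableSet_Iic]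
  ring

/-- By symmetry the tail at `0` is one half; the integral form gives the derivative and the
numerical bounds. -/
lemma upperTail_eq_sub_integral (t : ℝ) :
    upperTail t = 1 / 2 - ∫ x in (0 : ℝ)..t, gaussianPDFReal 0 1 x := by
  have h1 := cdf_add_upperTail t
  have h2 := cdf_add_upperTail 0
  have h3 : upperTail 0 = cdf (gaussianReal 0 1) 0 := by rw [upperTail, neg_zero]
  have hi : ∀ s : Set ℝ, IntegrableOn (gaussianPDFReal 0 1) s := fun s =>
    (integrable_gaussianPDFReal 0 1).integrableOn
  rw [← intervalIntegral.integral_Iic_sub_Iic (hi _) (hi _), setIntegral_gaussianPDFReal,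
    setIntegral_gaussianPDFReal, ← cdf_eq_real, ← cdf_eq_real]
  linarith

lemma hasDerivAt_upperTail (t : ℝ) : HasDerivAt upperTail (-gaussianPDFReal 0 1 t) t := by
  rw [show upperTail = _ from funext upperTail_eq_sub_integral]
  exact (intervalIntegral.integral_hasDerivAt_right
    (continuous_gaussianPDFReal_zero_one.intervalIntegrable _ _)
    (continuous_gaussianPDFReal_zero_one.stronglyMeasurableAtFilter _ _)
    continuous_gaussianPDFReal_zero_one.continuousAt).const_sub _

lemma hasDerivAt_gaussianPDFReal_zero_one (t : ℝ) :
    HasDerivAt (gaussianPDFReal 0 1) (-t * gaussianPDFReal 0 1 t) t := by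
  rw [gaussianPDFReal_zero_one, show gaussianPDFReal 0 1 = _ from funext gaussianPDFReal_zero_one]
  have h := (((hasDerivAt_pow 2 t).div_const 2).neg.exp).const_mul (√(2 * Real.pi))⁻¹
  refine h.congr_deriv ?_
  simp
  ring

lemma strictAnti_upperTail : StrictAnti upperTail :=
  strictAnti_of_hasDerivAt_neg hasDerivAt_upperTail fun t =>
    neg_lt_zero.2 (gaussianPDFReal_pos 0 1 t one_ne_zero)

/-- The derivative of `t ^ b * upperTail t` is a positive multiple of this function. -/
noncomputable def tailScore (b t : ℝ) : ℝ := b * upperTail t - t * gaussianPDFReal 0 1 t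

lemma hasDerivAt_tailScore (b t : ℝ) :
    HasDerivAt (tailScore b) (gaussianPDFReal 0 1 t * (t ^ 2 - (1 + b))) t := by
  have h := ((hasDerivAt_upperTail t).const_mul b).sub
    ((hasDerivAt_id t).mul (hasDerivAt_gaussianPDFReal_zero_one t))
  refine h.congr_deriv ?_
  simp only [id]
  ring

lemma tendsto_tailScore (b : ℝ) : Tendsto (tailScore b) atTop (𝓝 0) := by
  have h1 : Tendsto upperTail atTop (𝓝 0) :=
    (tendsto_cdf_atBot (gaussianReal 0 1)).comp tendsto_neg_atTop_atBot
  have h2 : Tendsto (fun t => t * gaussianPDFReal 0 1 t) atTop (𝓝 0) := by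
    have h3 : Tendsto (fun t : ℝ => (√(2 * Real.pi))⁻¹ * (2 / t)) atTop (𝓝 0) := by
      simpa using (tendsto_const_nhds.div_atTop tendsto_id :
        Tendsto (fun t : ℝ => 2 / t) atTop (𝓝 0)).const_mul (√(2 * Real.pi))⁻¹
    refine squeeze_zero' ?_ ?_ h3
    · filter_upwards [eventually_ge_atTop 0] with t ht
      exact mul_nonneg ht (gaussianPDFReal_nonneg 0 1 t)
    · filter_upwards [eventually_gt_atTop 0] with t ht
      rw [gaussianPDFReal_zero_one, mul_left_comm]
      refine mul_le_mul_of_nonneg_left ?_ (by positivity)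
      have h4 := Real.add_one_le_exp (t ^ 2 / 2)
      rw [Real.exp_neg, ← div_eq_mul_inv, div_le_div_iff₀ (Real.exp_pos _) ht]
      nlinarith
  have h5 := (h1.const_mul b).sub h2
  rw [mul_zero, sub_zero] at h5
  exact h5

/-- Past the turning point `√(1 + b)` the score strictly increases to its limit `0` at infinity, so
it stays below it. -/
lemma tailScore_neg_of_le {b t : ℝ} (ht : √(1 + b) ≤ t) : tailScore b t < 0 := by
  have hmono : StrictMonoOn (tailScore b) (Set.Ici t) := by
    refine strictMonoOn_of_deriv_pos (convex_Ici t)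
      (fun x _ => (hasDerivAt_tailScore b x).continuousAt.continuousWithinAt) fun x hx => ?_
    rw [interior_Ici] at hx
    rw [(hasDerivAt_tailScore b x).deriv]
    refine mul_pos (gaussianPDFReal_pos 0 1 x one_ne_zero) (sub_pos.2 ?_)
    exact (Real.sqrt_lt' ((Real.sqrt_nonneg _).trans_lt (ht.trans_lt hx))).1 (ht.trans_lt hx)
  have h1 : tailScore b t < tailScore b (t + 1) :=
    hmono Set.self_mem_Ici (by simp) (by linarith)
  refine h1.trans_le (ge_of_tendsto (tendsto_tailScore b) ?_)
  filter_upwards [eventually_ge_atTop (t + 1)] with x hx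
  exact hmono.monotoneOn (by simp) (by simp only [Set.mem_Ici]; linarith) hx

lemma strictAntiOn_tailScore (b : ℝ) :
    StrictAntiOn (tailScore b) (Set.Icc 0 √(1 + b)) := by
  refine strictAntiOn_of_deriv_neg (convex_Icc _ _)
    (fun x _ => (hasDerivAt_tailScore b x).continuousAt.continuousWithinAt) fun x hx => ?_
  rw [interior_Icc] at hx
  rw [(hasDerivAt_tailScore b x).deriv]
  exact mul_neg_of_pos_of_neg (gaussianPDFReal_pos 0 1 x one_ne_zero)
    (sub_neg.2 ((Real.lt_sqrt hx.1.le).1 hx.2))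

/-- The sign change of `tailScore b` on the positive half line. -/
lemma exists_tailScore_sign {b t₁ t₂ : ℝ} (h₁ : 0 < t₁) (h₁₂ : t₁ < t₂)
    (hpos : 0 < tailScore b t₁) (hneg : tailScore b t₂ < 0) :
    ∃ t ∈ Set.Ioo t₁ t₂, (∀ x, 0 < x → x < t → 0 < tailScore b x) ∧
      ∀ x, t < x → tailScore b x < 0 := by
  have hc : ContinuousOn (tailScore b) (Set.Icc t₁ t₂) := fun x _ =>
    (hasDerivAt_tailScore b x).continuousAt.continuousWithinAt
  obtain ⟨t, ht, h0⟩ := intermediate_value_Ioo' h₁₂.le hc ⟨hneg, hpos⟩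
  -- The zero lies before the turning point, where the score is strictly decreasing; this gives the
  -- signs on both sides and uniqueness.
  have hts : t < √(1 + b) := by
    by_contra h
    exact (tailScore_neg_of_le (not_lt.1 h)).ne h0
  have ht0 : 0 < t := h₁.trans ht.1
  refine ⟨t, ht, fun x hx hxt => ?_, fun x hx => ?_⟩
  · rw [← h0]
    exact strictAntiOn_tailScore b ⟨hx.le, (hxt.trans hts).le⟩ ⟨ht0.le, hts.le⟩ hxt
  · rcases le_total x √(1 + b) with h | h
    · rw [← h0]
      exact strictAntiOn_tailScore b ⟨ht0.le, hts.le⟩ ⟨(ht0.trans hx).le, h⟩ hx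
    · exact tailScore_neg_of_le h

/-- The unique maximizer of `l ^ 2 * upperTail (c * l ^ k)`. -/
lemma exists_maximizer_upperTail {k : ℕ} (hk : 0 < k) {c : ℝ} (hc : 0 < c) {t₁ t₂ : ℝ}
    (h₁ : 0 < t₁) (h₁₂ : t₁ < t₂) (hpos : 0 < tailScore (2 / k) t₁)
    (hneg : tailScore (2 / k) t₂ < 0) :
    ∃ l : ℝ, 0 < l ∧ c * l ^ k ∈ Set.Ioo t₁ t₂ ∧ ∀ x, 0 < x → x ≠ l →
      x ^ 2 * upperTail (c * x ^ k) < l ^ 2 * upperTail (c * l ^ k) := by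
  have hk' : (0 : ℝ) < k := by exact_mod_cast hk
  obtain ⟨t, ht, hlt, hgt⟩ := exists_tailScore_sign h₁ h₁₂ hpos hneg
  have ht0 : 0 < t := h₁.trans ht.1
  -- Factoring `k * x` out of the derivative leaves the score with `b = 2 / k`, evaluated at `c * x
  -- ^ k`.
  have hd : ∀ x : ℝ, HasDerivAt (fun x : ℝ => x ^ 2 * upperTail (c * x ^ k))
      (k * x * tailScore (2 / k) (c * x ^ k)) x := fun x => by
    have h1 := (hasDerivAt_pow 2 x).mul
      ((hasDerivAt_upperTail (c * x ^ k)).comp x ((hasDerivAt_pow k x).const_mul c))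
    refine h1.congr_deriv ?_
    simp only [Function.comp, tailScore]
    obtain ⟨m, rfl⟩ : ∃ m, k = m + 1 := ⟨k - 1, by omega⟩
    have := hk'.ne'
    simp only [Nat.add_sub_cancel]
    field_simp
    push_cast
    ring
  -- The maximizer solves `c * l ^ k = t`, where `t` is the zero of the score.
  have hl0 : 0 < (t / c) ^ ((k : ℝ)⁻¹) := Real.rpow_pos_of_pos (by positivity) _
  have hlk : c * ((t / c) ^ ((k : ℝ)⁻¹)) ^ k = t := by
    rw [Real.rpow_inv_natCast_pow (by positivity) hk.ne']
    field_simp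
  refine ⟨(t / c) ^ ((k : ℝ)⁻¹), hl0, hlk.symm ▸ ht, fun x hx hne => ?_⟩
  set l := (t / c) ^ ((k : ℝ)⁻¹)
  have hcont : Continuous fun x : ℝ => x ^ 2 * upperTail (c * x ^ k) :=
    continuous_iff_continuousAt.2 fun x => (hd x).continuousAt
  rcases lt_or_gt_of_ne hne with h | h
  · have hm : StrictMonoOn (fun x : ℝ => x ^ 2 * upperTail (c * x ^ k)) (Set.Icc 0 l) := by
      refine strictMonoOn_of_deriv_pos (convex_Icc _ _) hcont.continuousOn fun y hy => ?_
      rw [interior_Icc] at hy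
      rw [(hd y).deriv]
      have hy0 : 0 < y := hy.1
      refine mul_pos (by positivity) (hlt _ (by positivity) ?_)
      rw [← hlk]
      exact mul_lt_mul_of_pos_left (pow_lt_pow_left₀ hy.2 hy0.le hk.ne') hc
    exact hm ⟨hx.le, h.le⟩ ⟨hl0.le, le_rfl⟩ h
  · have hm : StrictAntiOn (fun x : ℝ => x ^ 2 * upperTail (c * x ^ k)) (Set.Ici l) := by
      refine strictAntiOn_of_deriv_neg (convex_Ici _) hcont.continuousOn fun y hy => ?_
      rw [interior_Ici] at hy
      rw [(hd y).deriv]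
      have hy0 : 0 < y := hl0.trans hy
      refine mul_neg_of_pos_of_neg (by positivity) (hgt _ ?_)
      rw [← hlk]
      exact mul_lt_mul_of_pos_left (pow_lt_pow_left₀ hy hl0.le hk.ne') hc
    exact hm Set.self_mem_Ici h.le h

/-! ### Numerical bounds -/

/-- The Taylor polynomial of `exp (-(t ^ 2 / 2))`. -/
noncomputable def expTaylor (t : ℝ) : ℝ :=
  ∑ m ∈ Finset.range 8, (-1 / 2) ^ m / (m.factorial : ℝ) * t ^ (2 * m)

/-- The integral of the Taylor polynomial. -/
noncomputable def integralTaylor (t : ℝ) : ℝ :=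
  ∑ m ∈ Finset.range 8, (-1 / 2) ^ m / (m.factorial : ℝ) * (t ^ (2 * m + 1) / (2 * m + 1))

lemma abs_exp_sub_expTaylor_le {t x : ℝ} (hx0 : 0 ≤ x) (hx : x ≤ t) (ht : t ^ 2 / 2 ≤ 1) :
    |Real.exp (-(x ^ 2 / 2)) - expTaylor x| ≤ (t ^ 2 / 2) ^ 8 * (1 / 35840) := by
  have h1 : x ^ 2 / 2 ≤ t ^ 2 / 2 := by gcongr
  have h2 : |-(x ^ 2 / 2)| ≤ t ^ 2 / 2 := by rwa [abs_neg, abs_of_nonneg (by positivity)]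
  -- Eight terms leave the remainder constant `9 / (8! * 8) = 1 / 35840`.
  have h := Real.exp_bound (h2.trans ht) (n := 8) (by norm_num)
  have h3 : ∑ m ∈ Finset.range 8, (-(x ^ 2 / 2)) ^ m / (m.factorial : ℝ) = expTaylor x := by
    refine Finset.sum_congr rfl fun m _ => ?_
    rw [show -(x ^ 2 / 2) = -1 / 2 * x ^ 2 by ring, mul_pow, ← pow_mul]
    ring
  rw [h3] at h
  exact h.trans (mul_le_mul (pow_le_pow_left₀ (abs_nonneg _) h2 8)
    (by norm_num [Nat.factorial]) (by positivity) (by positivity))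

lemma abs_integral_sub_integralTaylor_le {t : ℝ} (ht0 : 0 ≤ t) (ht : t ^ 2 / 2 ≤ 1) :
    |(∫ x in (0 : ℝ)..t, Real.exp (-(x ^ 2 / 2))) - integralTaylor t| ≤
      (t ^ 2 / 2) ^ 8 * (1 / 35840) * t := by
  have h1 : ∫ x in (0 : ℝ)..t, expTaylor x = integralTaylor t := by
    unfold expTaylor integralTaylor
    rw [intervalIntegral.integral_finsetSum fun m _ => by
      apply Continuous.intervalIntegrable; fun_prop]
    refine Finset.sum_congr rfl fun m _ => ?_
    rw [intervalIntegral.integral_const_mul, integral_pow]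
    simp
  have hc : Continuous expTaylor := by
    unfold expTaylor
    fun_prop
  rw [← h1, ← intervalIntegral.integral_sub (Continuous.intervalIntegrable (by fun_prop) _ _)
    (hc.intervalIntegrable _ _)]
  have h2 := intervalIntegral.norm_integral_le_of_norm_le_const (a := 0) (b := t)
    (f := fun x => Real.exp (-(x ^ 2 / 2)) - expTaylor x) (C := (t ^ 2 / 2) ^ 8 * (1 / 35840))
    fun x hx => by
      rw [Set.uIoc_of_le ht0] at hx
      exact abs_exp_sub_expTaylor_le hx.1.le hx.2 ht
  rwa [sub_zero, abs_of_nonneg ht0] at h2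

lemma inv_sqrt_two_pi_bounds :
    0.398942 < (√(2 * Real.pi))⁻¹ ∧ (√(2 * Real.pi))⁻¹ < 0.398943 := by
  have h1 := Real.pi_gt_d6
  have h2 := Real.pi_lt_d6
  constructor
  · rw [lt_inv_comm₀ (by norm_num) (by positivity), Real.sqrt_lt' (by norm_num)]
    norm_num at *
    linarith
  · rw [inv_lt_comm₀ (by positivity) (by norm_num), Real.lt_sqrt (by norm_num)]
    norm_num at *
    linarith

lemma upperTail_eq (t : ℝ) : upperTail t =
    1 / 2 - (√(2 * Real.pi))⁻¹ * ∫ x in (0 : ℝ)..t, Real.exp (-(x ^ 2 / 2)) := by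
  rw [upperTail_eq_sub_integral, ← intervalIntegral.integral_const_mul]
  simp only [gaussianPDFReal_zero_one]

section Bounds

variable {t : ℝ} (ht0 : 0 ≤ t) (ht : t ^ 2 / 2 ≤ 1)
include ht0 ht

lemma le_upperTail : 1 / 2 - 0.398943 * (integralTaylor t + (t ^ 2 / 2) ^ 8 * (1 / 35840) * t) ≤
    upperTail t := by
  have h1 := abs_le.1 (abs_integral_sub_integralTaylor_le ht0 ht)
  have h2 : 0 ≤ ∫ x in (0 : ℝ)..t, Real.exp (-(x ^ 2 / 2)) :=
    intervalIntegral.integral_nonneg ht0 fun _ _ => (Real.exp_pos _).le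
  rw [upperTail_eq]
  refine sub_le_sub_left (mul_le_mul inv_sqrt_two_pi_bounds.2.le ?_ h2 (by norm_num)) _
  linarith [h1.2]

lemma upperTail_le : upperTail t ≤
    1 / 2 - 0.398942 * (integralTaylor t - (t ^ 2 / 2) ^ 8 * (1 / 35840) * t) := by
  have h1 := abs_le.1 (abs_integral_sub_integralTaylor_le ht0 ht)
  have h2 : 0 ≤ ∫ x in (0 : ℝ)..t, Real.exp (-(x ^ 2 / 2)) :=
    intervalIntegral.integral_nonneg ht0 fun _ _ => (Real.exp_pos _).le
  rw [upperTail_eq]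
  refine sub_le_sub_left ((mul_le_mul_of_nonneg_left ?_ (by norm_num)).trans
    (mul_le_mul_of_nonneg_right inv_sqrt_two_pi_bounds.1.le h2)) _
  linarith [h1.1]

lemma gaussianPDFReal_zero_one_le : gaussianPDFReal 0 1 t ≤
    0.398943 * (expTaylor t + (t ^ 2 / 2) ^ 8 * (1 / 35840)) := by
  have h1 := abs_le.1 (abs_exp_sub_expTaylor_le ht0 le_rfl ht)
  rw [gaussianPDFReal_zero_one]
  refine mul_le_mul inv_sqrt_two_pi_bounds.2.le ?_ (Real.exp_pos _).le (by norm_num)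
  linarith [h1.2]

lemma le_gaussianPDFReal_zero_one : 0.398942 * (expTaylor t - (t ^ 2 / 2) ^ 8 * (1 / 35840)) ≤
    gaussianPDFReal 0 1 t := by
  have h1 := abs_le.1 (abs_exp_sub_expTaylor_le ht0 le_rfl ht)
  rw [gaussianPDFReal_zero_one]
  refine (mul_le_mul_of_nonneg_left ?_ (by norm_num)).trans
    (mul_le_mul_of_nonneg_right inv_sqrt_two_pi_bounds.1.le (Real.exp_pos _).le)
  linarith [h1.1]

lemma tailScore_pos_of_bound {b : ℝ} (hb : 0 ≤ b)
    (h : 0 < b * (1 / 2 - 0.398943 * (integralTaylor t + (t ^ 2 / 2) ^ 8 * (1 / 35840) * t)) -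
      t * (0.398943 * (expTaylor t + (t ^ 2 / 2) ^ 8 * (1 / 35840)))) : 0 < tailScore b t :=
  h.trans_le (sub_le_sub (mul_le_mul_of_nonneg_left (le_upperTail ht0 ht) hb)
    (mul_le_mul_of_nonneg_left (gaussianPDFReal_zero_one_le ht0 ht) ht0))

lemma tailScore_neg_of_bound {b : ℝ} (hb : 0 ≤ b)
    (h : b * (1 / 2 - 0.398942 * (integralTaylor t - (t ^ 2 / 2) ^ 8 * (1 / 35840) * t)) -
      t * (0.398942 * (expTaylor t - (t ^ 2 / 2) ^ 8 * (1 / 35840))) < 0) : tailScore b t < 0 :=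
  (sub_le_sub (mul_le_mul_of_nonneg_left (upperTail_le ht0 ht) hb)
    (mul_le_mul_of_nonneg_left (le_gaussianPDFReal_zero_one ht0 ht) ht0)).trans_lt h

end Bounds

/-! ### The optimal acceptance rate -/

/-- The bracket of the optimal argument of `upperTail`. -/
noncomputable def Algorithm.bracket : Algorithm → ℝ × ℝ
  | .RWM => (1.19, 1.191)
  | .SLA => (0.5616, 0.5622)

/-- Opposite signs of the score place its zero in the bracket. The tail is decreasing, so its values
at the two ends confine the rate to within `0.0005` of the stated one. -/
lemma Algorithm.bracket_spec (alg : Algorithm) :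
    0 < alg.bracket.1 ∧ alg.bracket.1 < alg.bracket.2 ∧
      0 < tailScore (2 / alg.order) alg.bracket.1 ∧ tailScore (2 / alg.order) alg.bracket.2 < 0 ∧
      2 * upperTail alg.bracket.1 < alg.optimalRate + 0.0005 ∧
      alg.optimalRate - 0.0005 < 2 * upperTail alg.bracket.2 := by
  cases alg
  all_goals
    simp only [Algorithm.bracket, Algorithm.order, Algorithm.optimalRate]
    refine ⟨by norm_num, by norm_num, ?_, ?_, ?_, ?_⟩
    · apply tailScore_pos_of_bound (by norm_num) (by norm_num) (by norm_num)
      norm_num [expTaylor, integralTaylor, Finset.sum_range_succ, Nat.factorial]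
    · apply tailScore_neg_of_bound (by norm_num) (by norm_num) (by norm_num)
      norm_num [expTaylor, integralTaylor, Finset.sum_range_succ, Nat.factorial]
    · refine (mul_le_mul_of_nonneg_left (upperTail_le (by norm_num) (by norm_num))
        zero_le_two).trans_lt ?_
      norm_num [integralTaylor, Finset.sum_range_succ, Nat.factorial]
    · refine lt_of_lt_of_le ?_ (mul_le_mul_of_nonneg_left
        (le_upperTail (by norm_num) (by norm_num)) zero_le_two)
      norm_num [integralTaylor, Finset.sum_range_succ, Nat.factorial]

lemma limitAccept_eq_upperTail (alg : Algorithm) (g : ℝ → ℝ) (κ l : ℝ) : limitAccept alg g κ l =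
    2 * upperTail (√(constK alg g / (1 + 2 * alg.order * κ)) / 2 * l ^ alg.order) := by
  cases alg
  · simp only [limitAccept, upperTail, Algorithm.order, pow_one, Nat.cast_one, mul_one]
    ring_nf
  · simp only [limitAccept, upperTail, Algorithm.order]
    norm_num
    ring_nf

/-- The speed `l ^ 2 * a(l)` has a unique maximizer, with the known acceptance rate. -/
lemma exists_optimal_accept {g : ℝ → ℝ} (hg : IsRegularLogDensity g) (alg : Algorithm) {κ : ℝ}
    (hκ : 0 ≤ κ) : ∃ lopt : ℝ, 0 < lopt ∧
      (∀ l' : ℝ, 0 < l' → l' ≠ lopt →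
        l' ^ 2 * limitAccept alg g κ l' < lopt ^ 2 * limitAccept alg g κ lopt) ∧
      |limitAccept alg g κ lopt - alg.optimalRate| < 0.0005 := by
  have hK := constK_pos hg alg
  obtain ⟨h₁, h₁₂, hpos, hneg, hr₁, hr₂⟩ := alg.bracket_spec
  obtain ⟨l, hl, hmem, hmax⟩ := exists_maximizer_upperTail alg.order_pos
    (c := √(constK alg g / (1 + 2 * alg.order * κ)) / 2) (by positivity) h₁ h₁₂ hpos hneg
  simp only [limitAccept_eq_upperTail]
  refine ⟨l, hl, fun x hx hne => ?_, abs_sub_lt_iff.2 ⟨?_, ?_⟩⟩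
  · linarith [hmax x hx hne]
  · linarith [strictAnti_upperTail hmem.1]
  · linarith [strictAnti_upperTail hmem.2]

end MHScaling

open MHScaling

/-- The hypotheses on `φ` are on a version `ψ` of `φ`. The optimality claim is that `l² a(l)` has a
unique maximizer on `(0, ∞)`, at which `a` rounds to the stated rate. -/
theorem theorem4 (alg : Algorithm) (g : ℝ → ℝ) (hg : IsRegularLogDensity g)
    (κ : ℝ) (hκ : 0 ≤ κ)
    (φ : (n : ℕ) → (Fin n → ℝ) → ℝ)
    (hφ_meas : ∀ n : ℕ, 1 ≤ n → Measurable (φ n))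
    (hφ_prob : ∀ n : ℕ, 1 ≤ n → IsProbabilityMeasure (target g κ (φ n)))
    (ψ : (n : ℕ) → (Fin n → ℝ) → ℝ)
    (hψ : ∀ n : ℕ, 1 ≤ n → ψ n =ᵐ[refMeasure g κ n] φ n)
    (hψ_below : EventuallyBoundedBelow ψ)
    (hψ_lip : LocallyLipschitzWithGrowth κ ψ)
    (l ρ : ℝ) (hl : 0 < l) (hρ : 0 < ρ)
    (σ : ℕ → ℝ) (hσ : ∀ n : ℕ, 1 ≤ n → 0 < σ n ∧ σ n ^ 2 = l ^ 2 * (n : ℝ) ^ (-ρ))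
    (i : ℕ) :
    (ρ = 2 * κ + alg.index →
      (fun n : ℕ => meanSqJump alg g κ (σ n) (φ n) i -
          l ^ 2 * limitAccept alg g κ l * (n : ℝ) ^ (-2 * κ - alg.index))
        =o[atTop] fun n : ℕ => (n : ℝ) ^ (-2 * κ - alg.index)) ∧
    (2 * κ + alg.index < ρ →
      (fun n : ℕ => meanSqJump alg g κ (σ n) (φ n) i - l ^ 2 * (n : ℝ) ^ (-ρ))
        =o[atTop] fun n : ℕ => (n : ℝ) ^ (-ρ)) ∧
    (2 * κ < ρ → ρ < 2 * κ + alg.index →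
      ∀ p : ℝ, 0 ≤ p →
        (fun n : ℕ => meanSqJump alg g κ (σ n) (φ n) i) =O[atTop] fun n : ℕ => (n : ℝ) ^ (-p)) ∧
    (2 * κ < ρ →
      ∀ᶠ n : ℕ in atTop, ∀ h : i < n,
        Integrable (sqJump alg g κ (σ n) (φ n) ⟨i, h⟩) (stepLaw g κ (φ n))) ∧
    0 < constK alg g ∧
    (∃ lopt : ℝ, 0 < lopt ∧
      (∀ l' : ℝ, 0 < l' → l' ≠ lopt →
        l' ^ 2 * limitAccept alg g κ l' < lopt ^ 2 * limitAccept alg g κ lopt) ∧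
      |limitAccept alg g κ lopt - alg.optimalRate| < 0.0005) := by
  have hindex := alg.index_eq
  have hk := alg.order_pos
  have hpow : -2 * κ - alg.index = -(2 * κ + alg.index) := by ring
  refine ⟨fun h => ?_, fun h => ?_, fun h1 h2 p _ => ?_, fun h => ?_, constK_pos hg alg,
    exists_optimal_accept hg alg hκ⟩
  · rw [hpow, ← h, limitAccept_eq hg alg hκ hl]
    refine isLittleO_meanSqJump_sub hg alg hκ hφ_meas hφ_prob hψ hψ_below hl hσ ?_ hψ_lip
      (tendsto_sum_div_scale_pow_of_eq hκ hl hσ hk (hindex ▸ h)) i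
    have : 0 < alg.index := by rw [hindex]; positivity
    linarith
  -- The same limit with `τ = 0`, where the Gaussian is degenerate and every proposal is accepted
  -- asymptotically.
  · have h0 := isLittleO_meanSqJump_sub hg alg hκ hφ_meas hφ_prob hψ hψ_below hl hσ (by
      have : 0 < alg.index := by rw [hindex]; positivity
      linarith) hψ_lip (tendsto_sum_div_scale_pow_of_lt hκ hl hσ hk (hindex ▸ h)) i
    simpa only [zero_mul, gaussianAccept_zero, mul_one] using h0
  · exact isBigO_meanSqJump hg alg hκ hφ_meas hφ_prob hψ hψ_below hl hσ h1 (hindex ▸ h2) i p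
  · filter_upwards [eventually_integrable_sqJump hg alg hκ hφ_meas hψ hψ_below hl hσ h] with n hn
      h using hn i h
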